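/- **Asymptotic type I error control of the stratified Cochran–Mantel–Haenszel test.** Let $P$ be the law of $(X,Y,Z)$ with $X,Y\in\{0,1\}$ and $Z\in\mathcal Z$ almost surely, where $\mathcal Z\subseteq\mathbb R^d$ is measurable. Suppose that $X\perp Y\mid Z$, i.e. $P_{XY\mid Z}=P_{X\mid Z}\,P_{Y\mid Z}$ almost surely. Suppose also that $P$ is marginally smooth: for suitable versions of the conditional laws there is $L\ge 0$ such that for all $z,z'\in\mathcal Z$ $$\max\{D_H(P_{X\mid Z=z},P_{X\mid Z=z'}),\;D_H(P_{Y\mid Z=z},P_{Y\mid Z=z'})\}\le L\,\|z-z'\|,$$ where $D_H(p,q)=\big(\tfrac12\sum_{x\in\{0,1\}}(\sqrt{p(x)}-\sqrt{q(x)})^2\big)^{1/2}$ is the Hellinger distance. For each $n$ let $\mathcal S_n=\{S_t\}$ be a (nonrandom) finite or countably infinite partition of $\mathcal Z$ into $T_n$ measurable strata, and let $h_n=\sup_{t}\sup_{z,z'\in S_t}\|z-z'\|$. Given $n$ i.i.d. observations from $P$, let $n(x,y,S_t)=|\{i: X_i=x,\,Y_i=y,\,Z_i\in S_t\}|$, with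 a dot denoting summation over an index, and $$\mu_t=\frac{n(0,\cdot,S_t)\,n(\cdot,0,S_t)}{n(\cdot,\cdot,S_t)},\qquad \sigma_t^2=\frac{n(0,\cdot,S_t)\,n(1,\cdot,S_t)\,n(\cdot,0,S_t)\,n(\cdot,1,S_t)}{n(\cdot,\cdot,S_t)^2\,(n(\cdot,\cdot,S_t)-1)},\qquad M_n=\frac{\sum_t\big(n(0,0,S_t)-\mu_t\big)}{\sqrt{\sum_t\sigma_t^2}},$$ where $0/0:=0$. For $\alpha\in[0,1]$ let $\chi^2_{\alpha,1}\in[0,\infty]$ be the upper $\alpha$-quantile of the chi-square law with one degree of freedom ($\infty$ for $\alpha=0$, and $0$ for $\alpha=1$), and let $\psi_n=\mathbf 1\{M_n^2>\chi^2_{\alpha,1}\}$. Assume that $h_n=o(n^{-1/4})$ and that the tables do not degenerate, in the sense that at least one of the following holds: 1. $T_n=O(n)$, and with positive probability (over $Z$) all four cell probabilities $P_{XY\mid Z}(x,y\mid Z)$, $x,y\in\{0,1\}$, are positive; 2. $\mathbb E_{P^n}\big[\sum_t\sigma_t^2\big]\to\infty$. Then for every $\alpha\in[0,1]$, $\displaystyle\lim_{n\to\infty}\mathbb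 E_{P^n}[\psi_n]=\alpha$. -/

import Mathlib

open MeasureTheory ProbabilityTheory Filter Topology
open scoped ENNReal

noncomputable section

namespace CMH

/-- The space of one observation `(x, y, z)` with `x, y ∈ {0, 1}` and `z ∈ ℝ^d`. -/
abbrev Obs (d : ℕ) : Type := Fin 2 × Fin 2 × EuclideanSpace ℝ (Fin d)

variable {d : ℕ}

/-- The coordinate `X`. -/
def obsX (w : Obs d) : Fin 2 := w.1

/-- The coordinate `Y`. -/
def obsY (w : Obs d) : Fin 2 := w.2.1

/-- The coordinate `Z`. -/
def obsZ (w : Obs d) : EuclideanSpace ℝ (Fin d) := w.2.2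

/-- The null hypothesis `X ⊥ Y | Z`: the conditional law of `(X, Y)` given `Z = z` is the product
of the conditional laws of `X` and of `Y`, for almost every `z`. -/
def CondIndependent (P : Measure (Obs d)) [IsFiniteMeasure P] : Prop :=
  ∀ᵐ z ∂(P.map obsZ),
    condDistrib (fun w => (obsX w, obsY w)) obsZ P z
      = (condDistrib obsX obsZ P z).prod (condDistrib obsY obsZ P z)

/-- The Hellinger distance `(½ ∑ₓ (√p(x) - √q(x))²)^{1/2}` of two laws on `{0, 1}`. -/
def hellingerDist (p q : Measure (Fin 2)) : ℝ :=
  Real.sqrt ((∑ x : Fin 2, (Real.sqrt (p.real {x}) - Real.sqrt (q.real {x})) ^ 2) / 2)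

/-- Marginal smoothness on `𝒵`: suitable versions of the conditional laws of `X` and of `Y`
given `Z = z` are Lipschitz in `z ∈ 𝒵` for the Hellinger distance, with a common constant. -/
def MarginallySmooth (P : Measure (Obs d)) [IsFiniteMeasure P]
    (𝒵 : Set (EuclideanSpace ℝ (Fin d))) : Prop :=
  ∃ κX κY : Kernel (EuclideanSpace ℝ (Fin d)) (Fin 2),
    IsMarkovKernel κX ∧ IsMarkovKernel κY ∧
    (∀ᵐ z ∂(P.map obsZ), κX z = condDistrib obsX obsZ P z) ∧
    (∀ᵐ z ∂(P.map obsZ), κY z = condDistrib obsY obsZ P z) ∧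
    ∃ L : ℝ, 0 ≤ L ∧ ∀ z ∈ 𝒵, ∀ z' ∈ 𝒵,
      max (hellingerDist (κX z) (κX z')) (hellingerDist (κY z) (κY z')) ≤ L * dist z z'

/-- A stratification of `𝒵`: a measurable partition indexed by `ι` (empty strata are harmless,
they do not contribute to any statistic below). -/
structure Stratification (𝒵 : Set (EuclideanSpace ℝ (Fin d))) (ι : Type) where
  stratum : ι → Set (EuclideanSpace ℝ (Fin d))
  measurableSet_stratum : ∀ t, MeasurableSet (stratum t)
  pairwise_disjoint : Pairwise (fun s t => Disjoint (stratum s) (stratum t))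
  iUnion_stratum : ⋃ t, stratum t = 𝒵

/-- The maximal stratum diameter `h`. -/
def Stratification.mesh {𝒵 : Set (EuclideanSpace ℝ (Fin d))} {ι : Type}
    (S : Stratification 𝒵 ι) : ℝ≥0∞ :=
  ⨆ t, Metric.ediam (S.stratum t)

section Statistic

variable {n : ℕ}

open Classical in
/-- The cell count `n(x, y, S)`. -/
def cellCount (w : Fin n → Obs d) (x y : Fin 2) (S : Set (EuclideanSpace ℝ (Fin d))) : ℕ :=
  (Finset.univ.filter (fun i => obsX (w i) = x ∧ obsY (w i) = y ∧ obsZ (w i) ∈ S)).card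

/-- `n(x, ·, S)`. -/
def xCount (w : Fin n → Obs d) (x : Fin 2) (S : Set (EuclideanSpace ℝ (Fin d))) : ℕ :=
  ∑ y : Fin 2, cellCount w x y S

/-- `n(·, y, S)`. -/
def yCount (w : Fin n → Obs d) (y : Fin 2) (S : Set (EuclideanSpace ℝ (Fin d))) : ℕ :=
  ∑ x : Fin 2, cellCount w x y S

/-- `n(·, ·, S)`. -/
def totalCount (w : Fin n → Obs d) (S : Set (EuclideanSpace ℝ (Fin d))) : ℕ :=
  ∑ x : Fin 2, ∑ y : Fin 2, cellCount w x y S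

/-- `μ_t = n(0, ·, S) n(·, 0, S) / n(·, ·, S)`, and `0` for a stratum without observations. -/
def stratumMean (w : Fin n → Obs d) (S : Set (EuclideanSpace ℝ (Fin d))) : ℝ :=
  (xCount w 0 S : ℝ) * yCount w 0 S / totalCount w S

/-- `σ_t²`, which is `0` for a stratum with at most one observation: the numerator vanishes. -/
def stratumVar (w : Fin n → Obs d) (S : Set (EuclideanSpace ℝ (Fin d))) : ℝ :=
  (xCount w 0 S : ℝ) * xCount w 1 S * yCount w 0 S * yCount w 1 S
    / ((totalCount w S : ℝ) ^ 2 * ((totalCount w S : ℝ) - 1))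

variable {𝒵 : Set (EuclideanSpace ℝ (Fin d))} {ι : Type}

/-- `∑_t σ_t²`. At most `n` terms are nonzero, also for infinitely many strata. -/
def totalVar (S : Stratification 𝒵 ι) (w : Fin n → Obs d) : ℝ :=
  ∑' t, stratumVar w (S.stratum t)

/-- The Cochran-Mantel-Haenszel statistic `M_n` (equal to `0` if `∑_t σ_t² = 0`). At most `n`
terms of the sum in the numerator are nonzero, also for infinitely many strata. -/
def statistic (S : Stratification 𝒵 ι) (w : Fin n → Obs d) : ℝ :=
  (∑' t, ((cellCount w 0 0 (S.stratum t) : ℝ) - stratumMean w (S.stratum t)))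
    / Real.sqrt (totalVar S w)

end Statistic

/-- The chi-square law with one degree of freedom: the law of the square of a standard normal. -/
def chiSqOne : Measure ℝ := (gaussianReal 0 1).map (fun x => x ^ 2)

/-- The upper `α`-quantile `χ²_{α,1}` in `[0, ∞]`; it is `∞` for `α = 0` and `0` for `α = 1`. -/
def chiSqUpperQuantile (α : ℝ) : ℝ≥0∞ :=
  sInf {q : ℝ≥0∞ | chiSqOne {x : ℝ | q < ENNReal.ofReal x} ≤ ENNReal.ofReal α}

open Classical in
/-- The test `ψ_n = 1{M_n² > χ²_{α,1}}`. -/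
def test {n : ℕ} {𝒵 : Set (EuclideanSpace ℝ (Fin d))} {ι : Type} (α : ℝ)
    (S : Stratification 𝒵 ι) (w : Fin n → Obs d) : ℝ :=
  if chiSqUpperQuantile α < ENNReal.ofReal (statistic S w ^ 2) then 1 else 0

/-- The law `P^n` of `n` independent observations from `P`. -/
def iidLaw (P : Measure (Obs d)) (n : ℕ) : Measure (Fin n → Obs d) :=
  Measure.pi (fun _ => P)

end CMH

end

/-! For a stratum t let p_t and r_t be the conditional probabilities of X = 0 and Y = 0, and δ_t the
conditional covariance of these events. Under the null, X and Y are dependent inside a stratum only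
because Z still varies there, so δ_t is the covariance of two functions of Z. The proof replaces P^n
by `modelLaw`, which has the same strata and margins but δ_t = 0, and proves a central limit theorem
for the model.

Replacement. Hellinger smoothness bounds the variance of P(X = 0 | Z) in a stratum by a multiple of
(Lh)² p_t(1 - p_t), even when p_t is close to 0 or 1, and likewise for Y. By Cauchy-Schwarz, δ_t² ≤
256 (Lh)⁴ p_t(1 - p_t) r_t(1 - r_t) (`sq_zeroCov_le`). The ratio of δ_t² to this product of
variances is the chi-square divergence between the cell law of one observation and the product of
its margins. Second moments of likelihood ratios multiply, so n observations cost at most (1 + 256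
(Lh)⁴)^n - 1, which vanishes because n h⁴ → 0 (`integral_toSample_le`, `tendsto_one_add_mesh_pow`).

Model. The numerator of M_n equals `centeredSum`, in which the indicators of Y = 0 are centred at
r_t: this is free, because the deviations of the X-indicators from their stratum mean sum to zero
(`tsum_cellCount_sub`). Given the strata and the X-values it is a sum of independent, centred,
bounded terms. Its conditional variance `sumVarX` and the squared denominator `sumVar` have the same
mean B = `meanVar`, and by Efron-Stein both have variance O(B). Hence, as B → ∞, the characteristic
function of the numerator over √B converges (`norm_integral_exp_sub_le`) and the random denominator
may be replaced by √B (`tendsto_integral_sampleTest`).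

Growth of B. If the mean of ∑σ_t² under P^n diverges, so does B, since that mean is eventually at
most 4(B + 1)² (`integral_sumVar_toSample_le`). If there are O(n) strata and the margins are
nondegenerate with positive probability, B grows at least linearly (`meanVar_lower`). -/

namespace CMH

/-! ### Bounded functions on countable discrete spaces -/

/-- A real function with bounded range. -/
def IsBdd {α : Type*} (f : α → ℝ) : Prop := ∃ K, ∀ x, |f x| ≤ K

namespace IsBdd

variable {α β : Type*} {f g : α → ℝ}

theorem of_finite [Finite α] (f : α → ℝ) : IsBdd f := by
  obtain ⟨K, hK⟩ := (Set.finite_range fun x => |f x|).bddAbove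
  exact ⟨K, fun x => hK ⟨x, rfl⟩⟩

theorem const (c : ℝ) : IsBdd fun _ : α => c := ⟨|c|, fun _ => le_rfl⟩

theorem add (hf : IsBdd f) (hg : IsBdd g) : IsBdd fun x => f x + g x := by
  obtain ⟨K, hK⟩ := hf
  obtain ⟨M, hM⟩ := hg
  exact ⟨K + M, fun x => (abs_add_le _ _).trans (add_le_add (hK x) (hM x))⟩

theorem neg (hf : IsBdd f) : IsBdd fun x => -f x := by
  obtain ⟨K, hK⟩ := hf
  exact ⟨K, fun x => (abs_neg (f x)).trans_le (hK x)⟩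

theorem sub (hf : IsBdd f) (hg : IsBdd g) : IsBdd fun x => f x - g x := by
  simpa only [sub_eq_add_neg] using hf.add hg.neg

theorem mul (hf : IsBdd f) (hg : IsBdd g) : IsBdd fun x => f x * g x := by
  obtain ⟨K, hK⟩ := hf
  obtain ⟨M, hM⟩ := hg
  refine ⟨K * M, fun x => ?_⟩
  rw [abs_mul]
  exact mul_le_mul (hK x) (hM x) (abs_nonneg _) ((abs_nonneg _).trans (hK x))

theorem sq (hf : IsBdd f) : IsBdd fun x => f x ^ 2 := by
  simpa only [_root_.sq] using hf.mul hf

theorem comp (hf : IsBdd f) (φ : β → α) : IsBdd fun x => f (φ x) := by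
  obtain ⟨K, hK⟩ := hf
  exact ⟨K, fun x => hK _⟩

theorem of_mem_Icc {a b : ℝ} (h : ∀ x, f x ∈ Set.Icc a b) : IsBdd f :=
  ⟨max |a| |b|, fun x => abs_le_max_abs_abs (h x).1 (h x).2⟩

theorem integrable [MeasurableSpace α] [DiscreteMeasurableSpace α] (hf : IsBdd f)
    (μ : Measure α) [IsFiniteMeasure μ] : Integrable f μ := by
  obtain ⟨K, hK⟩ := hf
  exact Integrable.of_bound (Measurable.of_discrete (f := f)).aestronglyMeasurable K (ae_of_all _ hK)

theorem integral {F : α → β → ℝ} [MeasurableSpace β] (hF : IsBdd fun q : α × β => F q.1 q.2)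
    (μ : α → Measure β) [∀ a, IsProbabilityMeasure (μ a)] : IsBdd fun a => ∫ b, F a b ∂(μ a) := by
  obtain ⟨K, hK⟩ := hF
  refine ⟨K, fun a => ?_⟩
  simpa using norm_integral_le_of_norm_le_const (μ := μ a) (f := F a) (C := K)
    (ae_of_all _ fun b => hK (a, b))

end IsBdd

/-! ### The Efron-Stein inequality -/

section EfronStein

variable {Ω : Type*} [MeasurableSpace Ω]

/-- Bias-variance decomposition: the mean is the best constant approximation in L². The Efron-Stein
argument uses this to trade a conditional mean for an arbitrary competitor. -/
theorem integral_sub_sq {α : Type*} [MeasurableSpace α] [DiscreteMeasurableSpace α]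
    (μ : Measure α) [IsProbabilityMeasure μ] {f : α → ℝ} (hf : IsBdd f) (c : ℝ) :
    ∫ a, (f a - c) ^ 2 ∂μ = ∫ a, (f a - ∫ b, f b ∂μ) ^ 2 ∂μ + (∫ a, f a ∂μ - c) ^ 2 := by
  have key : ∀ c : ℝ, ∫ a, (f a - c) ^ 2 ∂μ = ∫ a, f a ^ 2 ∂μ - 2 * c * ∫ a, f a ∂μ + c ^ 2 := by
    intro c
    have h : ∀ a, (f a - c) ^ 2 = f a ^ 2 - 2 * c * f a + c ^ 2 := fun a => by ring
    simp_rw [h]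
    have h1 : IsBdd fun a => 2 * c * f a := (IsBdd.const (2 * c)).mul hf
    rw [integral_add ((hf.sq.sub h1).integrable μ) (integrable_const _),
      integral_sub (hf.sq.integrable μ) (h1.integrable μ), integral_const_mul]
    simp
  rw [key c, key (∫ a, f a ∂μ)]
  ring

theorem sq_integral_le {α : Type*} [MeasurableSpace α] [DiscreteMeasurableSpace α]
    (μ : Measure α) [IsProbabilityMeasure μ] {f : α → ℝ} (hf : IsBdd f) :
    (∫ a, f a ∂μ) ^ 2 ≤ ∫ a, f a ^ 2 ∂μ := by
  have h := integral_sub_sq μ hf 0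
  have h2 : 0 ≤ ∫ a, (f a - ∫ b, f b ∂μ) ^ 2 ∂μ := integral_nonneg fun _ => sq_nonneg _
  simp only [sub_zero] at h
  linarith

variable [MeasurableSingletonClass Ω] [Countable Ω]

theorem integral_pi_succ {n : ℕ} (μ : Fin (n + 1) → Measure Ω) [∀ i, IsProbabilityMeasure (μ i)]
    {f : (Fin (n + 1) → Ω) → ℝ} (hf : IsBdd f) :
    ∫ ω, f ω ∂(Measure.pi μ)
      = ∫ b, ∫ a, f (Fin.cons a b) ∂(μ 0) ∂(Measure.pi fun i : Fin n => μ i.succ) := by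
  rw [← ((measurePreserving_piFinSuccAbove μ 0).symm).integral_comp']
  simp only [MeasurableEquiv.piFinSuccAbove_symm_apply, Fin.insertNthEquiv, Fin.insertNth_zero,
    Equiv.coe_fn_mk, Fin.zero_succAbove, cast_eq]
  have hint : Integrable (fun q : Ω × (Fin n → Ω) => f (Fin.cons q.1 q.2))
      ((μ 0).prod (Measure.pi fun i : Fin n => μ i.succ)) :=
    (hf.comp fun q : Ω × (Fin n → Ω) => Fin.cons q.1 q.2).integrable _
  exact integral_prod_symm _ hint

/-- **Efron-Stein inequality**: `g i` is any approximation of `f` that ignores coordinate `i`. -/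
theorem efron_stein {n : ℕ} (μ : Fin n → Measure Ω) [∀ i, IsProbabilityMeasure (μ i)]
    {f : (Fin n → Ω) → ℝ} (hf : IsBdd f) {g : Fin n → (Fin n → Ω) → ℝ} (hg : ∀ i, IsBdd (g i))
    (hgi : ∀ i ω a, g i (Function.update ω i a) = g i ω) :
    ∫ ω, (f ω - ∫ ω', f ω' ∂(Measure.pi μ)) ^ 2 ∂(Measure.pi μ)
      ≤ ∑ i, ∫ ω, (f ω - g i ω) ^ 2 ∂(Measure.pi μ) := by
  induction n with
  | zero =>
    have h : ∀ ω, f ω = ∫ ω', f ω' ∂(Measure.pi μ) := by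
      intro ω
      have : ∀ ω', f ω' = f ω := fun ω' => by rw [Subsingleton.elim ω' ω]
      simp [this]
    simp only [Finset.univ_eq_empty, Finset.sum_empty, fun ω => sub_eq_zero.2 (h ω)]
    simp
  | succ n ih =>
    set ν := Measure.pi fun i : Fin n => μ i.succ with hν
    have hcons : ∀ {h : (Fin (n + 1) → Ω) → ℝ}, IsBdd h →
        IsBdd fun q : (Fin n → Ω) × Ω => h (Fin.cons q.2 q.1) :=
      fun hh => hh.comp fun q : (Fin n → Ω) × Ω => (Fin.cons q.2 q.1 : Fin (n + 1) → Ω)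
    -- Averaging out the first coordinate splits the variance into the mean conditional variance,
    -- paid for by `g 0`, and the variance of `fbar`, paid for by the induction hypothesis.
    set fbar : (Fin n → Ω) → ℝ := fun b => ∫ a, f (Fin.cons a b) ∂(μ 0) with hfbar
    have hfb : IsBdd fbar := (hcons hf).integral (fun _ => μ 0)
    have hE : ∫ ω, f ω ∂(Measure.pi μ) = ∫ b, fbar b ∂ν := integral_pi_succ μ hf
    rw [hE]
    set m := ∫ b, fbar b ∂ν
    rw [integral_pi_succ μ ((hf.sub (IsBdd.const m)).sq)]
    have hsplit : ∀ b, ∫ a, (f (Fin.cons a b) - m) ^ 2 ∂(μ 0)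
        = ∫ a, (f (Fin.cons a b) - fbar b) ^ 2 ∂(μ 0) + (fbar b - m) ^ 2 := fun b =>
      integral_sub_sq (μ 0) (hf.comp fun a => (Fin.cons a b : Fin (n + 1) → Ω)) m
    simp_rw [hsplit]
    have hb1 : IsBdd fun b => ∫ a, (f (Fin.cons a b) - fbar b) ^ 2 ∂(μ 0) :=
      IsBdd.integral (F := fun b a => (f (Fin.cons a b) - fbar b) ^ 2)
        (((hcons hf).sub (hfb.comp Prod.fst)).sq) (fun _ => μ 0)
    rw [integral_add (hb1.integrable ν) ((hfb.sub (IsBdd.const m)).sq.integrable ν),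
      Fin.sum_univ_succ]
    refine add_le_add ?_ ?_
    · rw [integral_pi_succ μ ((hf.sub (hg 0)).sq)]
      refine integral_mono (hb1.integrable ν) ?_ fun b => ?_
      · exact (IsBdd.integral (hcons (hf.sub (hg 0)).sq) (fun _ => μ 0)).integrable ν
      -- For fixed `b`, `g 0` is a constant, and no constant beats the conditional mean.
      · obtain ⟨a₀⟩ : Nonempty Ω := (μ 0).nonempty_of_neZero
        have hc : ∀ a, g 0 (Fin.cons a b) = g 0 (Fin.cons a₀ b) := fun a => by
          rw [← hgi 0 (Fin.cons a₀ b) a, Fin.update_cons_zero]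
        have h := integral_sub_sq (μ 0) (hf.comp fun a => (Fin.cons a b : Fin (n + 1) → Ω))
          (g 0 (Fin.cons a₀ b))
        simp only [hc]
        rw [h]
        exact le_add_of_nonneg_right (sq_nonneg _)
    · have hgb : ∀ i : Fin n, IsBdd fun b => ∫ a, g i.succ (Fin.cons a b) ∂(μ 0) := fun i =>
        (hcons (hg i.succ)).integral (fun _ => μ 0)
      -- The competitors for `fbar` are the averages of `g i.succ` over the first coordinate;
      -- Jensen's inequality then moves that average outside the square.
      refine (ih (fun i => μ i.succ) hfb hgb ?_).trans (Finset.sum_le_sum fun i _ => ?_)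
      · intro i ω a
        refine integral_congr_ae (ae_of_all _ fun c => ?_)
        simp only [Fin.cons_update, hgi]
      · rw [integral_pi_succ μ ((hf.sub (hg i.succ)).sq)]
        refine integral_mono ((hfb.sub (hgb i)).sq.integrable ν) ?_ fun b => ?_
        · exact (IsBdd.integral (hcons (hf.sub (hg i.succ)).sq) (fun _ => μ 0)).integrable ν
        · have h1 := hf.comp fun a => (Fin.cons a b : Fin (n + 1) → Ω)
          have h2 := (hg i.succ).comp fun a => (Fin.cons a b : Fin (n + 1) → Ω)
          have h := sq_integral_le (μ 0) (h1.sub h2)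
          rwa [integral_sub (h1.integrable _) (h2.integrable _)] at h

end EfronStein

end CMH

namespace CMH

/-! ### Independent Bernoulli coordinates -/

/-- The indicator of `0` on `{0, 1}`. -/
noncomputable def ind (a : Fin 2) : ℝ := if a = 0 then 1 else 0

@[simp] theorem ind_zero : ind 0 = 1 := by simp [ind]

@[simp] theorem ind_one : ind 1 = 0 := by simp [ind]

theorem ind_mem (a : Fin 2) : ind a ∈ Set.Icc (0 : ℝ) 1 := by
  fin_cases a <;> simp

/-- The variance of a Bernoulli variable. -/
noncomputable def bvar (p : unitInterval) : ℝ := p * (1 - p)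

theorem bvar_nonneg (p : unitInterval) : 0 ≤ bvar p :=
  mul_nonneg p.2.1 (sub_nonneg.2 p.2.2)

theorem bvar_le (p : unitInterval) : bvar p ≤ 1 / 4 := by
  unfold bvar
  nlinarith [sq_nonneg ((p : ℝ) - 1 / 2)]

/-- The law of independent coordinates in `{0, 1}`, the `i`-th being `0` with probability `p i`. -/
noncomputable def bernPi {n : ℕ} (p : Fin n → unitInterval) : Measure (Fin n → Fin 2) :=
  Measure.pi fun i => bernoulliMeasure (0 : Fin 2) 1 (p i)

instance {n : ℕ} (p : Fin n → unitInterval) : IsProbabilityMeasure (bernPi p) := by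
  unfold bernPi
  infer_instance

/-- The number of zeros of `x` in `s`. -/
noncomputable def cnt {n : ℕ} (x : Fin n → Fin 2) (s : Finset (Fin n)) : ℝ := ∑ i ∈ s, ind (x i)

/-- The product of the number of zeros and the number of ones of `x` in `s`. -/
noncomputable def gini {n : ℕ} (x : Fin n → Fin 2) (s : Finset (Fin n)) : ℝ :=
  cnt x s * (s.card - cnt x s)

/-- The indices with value `t`. -/
noncomputable def fib {n : ℕ} {ι : Type*} (τ : Fin n → ι) (t : ι) : Finset (Fin n) := by
  classical exact Finset.univ.filter fun i => τ i = t

section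

variable {n : ℕ} {ι : Type*}

@[simp] theorem mem_fib {τ : Fin n → ι} {t : ι} {i : Fin n} : i ∈ fib τ t ↔ τ i = t := by
  simp [fib]

theorem cnt_nonneg (x : Fin n → Fin 2) (s : Finset (Fin n)) : 0 ≤ cnt x s :=
  Finset.sum_nonneg fun _ _ => (ind_mem _).1

theorem cnt_le (x : Fin n → Fin 2) (s : Finset (Fin n)) : cnt x s ≤ s.card := by
  unfold cnt
  simpa using Finset.sum_le_card_nsmul s (fun i => ind (x i)) 1 fun _ _ => (ind_mem _).2

theorem gini_nonneg (x : Fin n → Fin 2) (s : Finset (Fin n)) : 0 ≤ gini x s :=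
  mul_nonneg (cnt_nonneg x s) (sub_nonneg.2 (cnt_le x s))

theorem gini_le (x : Fin n → Fin 2) (s : Finset (Fin n)) : gini x s ≤ (s.card : ℝ) ^ 2 / 4 := by
  unfold gini
  nlinarith [sq_nonneg ((s.card : ℝ) - 2 * cnt x s)]

theorem cnt_update {x : Fin n → Fin 2} {s : Finset (Fin n)} {i : Fin n} (hi : i ∈ s) (a : Fin 2) :
    cnt (Function.update x i a) s = ind a + cnt x (s.erase i) := by
  unfold cnt
  rw [← Finset.add_sum_erase s _ hi, Function.update_self]
  congr 1
  refine Finset.sum_congr rfl fun j hj => ?_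
  rw [Function.update_of_ne (Finset.ne_of_mem_erase hj)]

theorem gini_update_of_notMem {x : Fin n → Fin 2} {s : Finset (Fin n)} {i : Fin n} (hi : i ∉ s)
    (a : Fin 2) : gini (Function.update x i a) s = gini x s := by
  have : cnt (Function.update x i a) s = cnt x s :=
    Finset.sum_congr rfl fun j hj => by
      rw [Function.update_of_ne (ne_of_mem_of_not_mem hj hi)]
  simp [gini, this]

/-- With c zeros among the other k - 1 indices, the two values are (c + 1)(k - 1 - c) and c(k - c),
whose difference is k - 1 - 2c. -/
theorem abs_gini_update_sub_le {x : Fin n → Fin 2} {s : Finset (Fin n)} {i : Fin n} (hi : i ∈ s) :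
    |gini (Function.update x i 0) s - gini (Function.update x i 1) s| ≤ (s.card : ℝ) - 1 := by
  have hc : (((s.erase i).card : ℕ) : ℝ) = s.card - 1 := by
    rw [Finset.card_erase_of_mem hi, Nat.cast_sub (Finset.card_pos.2 ⟨i, hi⟩), Nat.cast_one]
  have h1 := cnt_nonneg x (s.erase i)
  have h2 := cnt_le x (s.erase i)
  rw [hc] at h2
  simp only [gini, cnt_update hi, ind_zero, ind_one]
  rw [abs_le]
  constructor <;> nlinarith

theorem integral_bernPi_eval (p : Fin n → unitInterval) (i : Fin n) (f : Fin 2 → ℝ) :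
    ∫ y, f (y i) ∂(bernPi p) = p i * f 0 + (1 - p i) * f 1 := by
  have h := (measurePreserving_eval (fun i => bernoulliMeasure (0 : Fin 2) 1 (p i)) i)
  have h2 : ∫ y, f (y i) ∂(bernPi p) = ∫ a, f a ∂(bernoulliMeasure (0 : Fin 2) 1 (p i)) := by
    rw [← h.map_eq, integral_map h.measurable.aemeasurable
      (Measurable.of_discrete (f := f)).aestronglyMeasurable]
    rfl
  rw [h2, integral_bernoulliMeasure]
  simp

theorem integral_bernPi_mul (p : Fin n → unitInterval) {i j : Fin n} (hij : i ≠ j)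
    (f g : Fin 2 → ℝ) :
    ∫ y, f (y i) * g (y j) ∂(bernPi p) = (∫ y, f (y i) ∂(bernPi p)) * ∫ y, g (y j) ∂(bernPi p) := by
  have h := (iIndepFun_pi (μ := fun i => bernoulliMeasure (0 : Fin 2) 1 (p i))
    (X := fun _ a => a) (fun _ => measurable_id.aemeasurable)).indepFun hij
  have h2 := h.comp (Measurable.of_discrete (f := f)) (Measurable.of_discrete (f := g))
  exact h2.integral_fun_mul_eq_mul_integral
    (Measurable.of_discrete (f := fun y : Fin n → Fin 2 => f (y i))).aestronglyMeasurable
    (Measurable.of_discrete (f := fun y : Fin n → Fin 2 => g (y j))).aestronglyMeasurable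

/-- `gini` counts ordered pairs (zero, one). Each of the k(k - 1) off-diagonal pairs has mean q(1 -
q), and diagonal pairs contribute nothing. -/
theorem integral_gini (p : Fin n → unitInterval) {s : Finset (Fin n)} {q : unitInterval}
    (hp : ∀ i ∈ s, p i = q) :
    ∫ y, gini y s ∂(bernPi p) = s.card * (s.card - 1) * bvar q := by
  have h1 : ∀ y : Fin n → Fin 2, gini y s
      = ∑ i ∈ s, ∑ j ∈ s.erase i, ind (y i) * (1 - ind (y j)) := by
    intro y
    have h0 : (s.card : ℝ) - cnt y s = ∑ j ∈ s, (1 - ind (y j)) := by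
      simp [cnt, Finset.sum_sub_distrib]
    rw [gini, h0, cnt, Finset.sum_mul_sum]
    refine Finset.sum_congr rfl fun i hi => ?_
    rw [← Finset.add_sum_erase s _ hi]
    have : ind (y i) * (1 - ind (y i)) = 0 := by
      generalize y i = a
      fin_cases a <;> simp
    rw [this, zero_add]
  simp_rw [h1]
  rw [integral_finsetSum _ fun _ _ => (IsBdd.of_finite _).integrable _]
  have h2 : ∀ i ∈ s, ∫ y, ∑ j ∈ s.erase i, ind (y i) * (1 - ind (y j)) ∂(bernPi p)
      = ((s.card : ℝ) - 1) * bvar q := by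
    intro i hi
    rw [integral_finsetSum _ fun _ _ => (IsBdd.of_finite _).integrable _]
    have h3 : ∀ j ∈ s.erase i, ∫ y, ind (y i) * (1 - ind (y j)) ∂(bernPi p) = bvar q := by
      intro j hj
      rw [integral_bernPi_mul p (Finset.ne_of_mem_erase hj).symm ind fun a => 1 - ind a,
        integral_bernPi_eval p i ind, integral_bernPi_eval p j fun a => 1 - ind a,
        hp i hi, hp j (Finset.mem_of_mem_erase hj)]
      simp [bvar]
    rw [Finset.sum_congr rfl h3, Finset.sum_const, Finset.card_erase_of_mem hi, nsmul_eq_mul,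
      Nat.cast_sub (Finset.card_pos.2 ⟨i, hi⟩), Nat.cast_one]
  rw [Finset.sum_congr rfl h2, Finset.sum_const, nsmul_eq_mul]
  ring

theorem sum_image_card_mul [DecidableEq ι] (τ : Fin n → ι) (f : ι → ℝ) :
    ∑ t ∈ Finset.univ.image τ, (fib τ t).card * f t = ∑ i, f (τ i) := by
  rw [← Finset.sum_fiberwise_of_maps_to (g := τ) (t := Finset.univ.image τ)
    fun i _ => Finset.mem_image_of_mem τ (Finset.mem_univ i)]
  refine Finset.sum_congr rfl fun t _ => ?_
  have h : (Finset.univ.filter fun i => τ i = t) = fib τ t := by ext; simp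
  rw [h, Finset.sum_congr rfl (g := fun _ => f t) fun i hi => by rw [mem_fib.1 hi],
    Finset.sum_const, nsmul_eq_mul]

theorem integral_sum_gini [DecidableEq ι] (τ : Fin n → ι) (p : ι → unitInterval) (a : ι → ℝ) :
    ∫ y, ∑ t ∈ Finset.univ.image τ, a t * gini y (fib τ t) ∂(bernPi fun i => p (τ i))
      = ∑ t ∈ Finset.univ.image τ,
          a t * ((fib τ t).card * ((fib τ t).card - 1) * bvar (p t)) := by
  rw [integral_finsetSum _ fun _ _ => (IsBdd.of_finite _).integrable _]
  refine Finset.sum_congr rfl fun t _ => ?_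
  rw [integral_const_mul, integral_gini _ (q := p t) fun i hi => by rw [mem_fib.1 hi]]

/-- Efron-Stein, the approximation being the average over the coordinate i. The error is the centred
indicator of y_i = 0 times the jump of the sum in y_i; only the stratum of i jumps, by at most |a
t|(k - 1). Keeping the factor `bvar` is what makes the later variance bounds proportional to the
mean. -/
theorem variance_sum_gini_le [DecidableEq ι] (τ : Fin n → ι) (p : ι → unitInterval) (a : ι → ℝ) :
    ∫ y, (∑ t ∈ Finset.univ.image τ, a t * gini y (fib τ t)
        - ∑ t ∈ Finset.univ.image τ,
          a t * ((fib τ t).card * ((fib τ t).card - 1) * bvar (p t))) ^ 2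
        ∂(bernPi fun i => p (τ i))
      ≤ ∑ t ∈ Finset.univ.image τ,
          (fib τ t).card * (a t ^ 2 * ((fib τ t).card - 1) ^ 2 * bvar (p t)) := by
  rw [← integral_sum_gini, sum_image_card_mul τ fun t =>
    a t ^ 2 * (((fib τ t).card : ℝ) - 1) ^ 2 * bvar (p t)]
  set f : (Fin n → Fin 2) → ℝ := fun y => ∑ t ∈ Finset.univ.image τ, a t * gini y (fib τ t) with hf
  set g : Fin n → (Fin n → Fin 2) → ℝ := fun i y =>
    p (τ i) * f (Function.update y i 0) + (1 - p (τ i)) * f (Function.update y i 1) with hg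
  refine (efron_stein (fun i => bernoulliMeasure (0 : Fin 2) 1 (p (τ i))) (f := f)
    (IsBdd.of_finite _) (g := g) (fun _ => IsBdd.of_finite _) ?_).trans
    (Finset.sum_le_sum fun i _ => ?_)
  · intro i ω b
    simp [hg]
  have hdiff : ∀ y, f (Function.update y i 0) - f (Function.update y i 1)
      = a (τ i) * (gini (Function.update y i 0) (fib τ (τ i))
        - gini (Function.update y i 1) (fib τ (τ i))) := by
    intro y
    simp only [hf]
    rw [← Finset.sum_sub_distrib, Finset.sum_eq_single (τ i)]
    · ring
    · intro t _ ht
      have hi : i ∉ fib τ t := fun h => ht (mem_fib.1 h).symm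
      rw [gini_update_of_notMem hi, gini_update_of_notMem hi, sub_self]
    · exact fun h => absurd (Finset.mem_image_of_mem τ (Finset.mem_univ i)) h
  have hfg : ∀ y, f y - g i y
      = (ind (y i) - p (τ i)) * (f (Function.update y i 0) - f (Function.update y i 1)) := by
    intro y
    have hy : f y = f (Function.update y i (y i)) := by rw [Function.update_eq_self]
    simp only [hg]
    rw [hy]
    generalize y i = b
    fin_cases b
    · simp only [Fin.zero_eta, ind_zero]
      ring
    · simp only [Fin.mk_one, ind_one]
      ring
  have hbound : ∀ y, (f y - g i y) ^ 2
      ≤ (ind (y i) - p (τ i)) ^ 2 * (a (τ i) ^ 2 * (((fib τ (τ i)).card : ℝ) - 1) ^ 2) := by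
    intro y
    rw [hfg, hdiff, mul_pow, mul_pow]
    refine mul_le_mul_of_nonneg_left (mul_le_mul_of_nonneg_left ?_ (sq_nonneg _)) (sq_nonneg _)
    exact sq_le_sq' (by linarith [neg_abs_le (gini (Function.update y i 0) (fib τ (τ i))
      - gini (Function.update y i 1) (fib τ (τ i))),
      abs_gini_update_sub_le (x := y) (mem_fib (τ := τ).2 (rfl : τ i = τ i))])
      ((le_abs_self _).trans (abs_gini_update_sub_le (mem_fib.2 rfl)))
  refine (integral_mono ((IsBdd.of_finite _).integrable _) ((IsBdd.of_finite _).integrable _)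
    hbound).trans_eq ?_
  rw [integral_mul_const]
  have h := integral_bernPi_eval (fun i => p (τ i)) i fun b => (ind b - p (τ i)) ^ 2
  simp only [bernPi] at h
  rw [h]
  simp only [ind_zero, ind_one, bvar]
  ring

end

end CMH

namespace CMH

/-! ### The model with independence within strata -/

section Model

variable {n : ℕ} {ι : Type*}

theorem gini_eq_zero_of_card_le_one (x : Fin n → Fin 2) {s : Finset (Fin n)} (hs : s.card ≤ 1) :
    gini x s = 0 := by
  rcases Nat.le_one_iff_eq_zero_or_eq_one.1 hs with h | h
  · simp [Finset.card_eq_zero.1 h, gini, cnt]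
  · obtain ⟨i, rfl⟩ := Finset.card_eq_one.1 h
    simp only [gini, cnt, Finset.sum_singleton, Finset.card_singleton, Nat.cast_one]
    generalize x i = a
    fin_cases a <;> simp

theorem card_fib_pos [DecidableEq ι] {τ : Fin n → ι} {t : ι} (ht : t ∈ Finset.univ.image τ) :
    1 ≤ (fib τ t).card := by
  obtain ⟨i, _, hi⟩ := Finset.mem_image.1 ht
  exact Finset.card_pos.2 ⟨i, mem_fib.2 hi⟩

theorem fib_eq_empty [DecidableEq ι] {τ : Fin n → ι} {t : ι} (ht : t ∉ Finset.univ.image τ) :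
    fib τ t = ∅ := by
  ext i
  simp only [mem_fib, Finset.notMem_empty, iff_false]
  exact fun h => ht (Finset.mem_image.2 ⟨i, Finset.mem_univ i, h⟩)

open Classical in
/-- The sum of the hypergeometric variances of the strata. -/
noncomputable def sumVar (τ : Fin n → ι) (x y : Fin n → Fin 2) : ℝ :=
  ∑ t ∈ Finset.univ.image τ, gini x (fib τ t) / ((fib τ t).card ^ 2 * ((fib τ t).card - 1))
    * gini y (fib τ t)

open Classical in
/-- The conditional mean of `sumVar` given the strata and the first coordinates. -/
noncomputable def sumVarX (r : ι → unitInterval) (τ : Fin n → ι) (x : Fin n → Fin 2) : ℝ :=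
  ∑ t ∈ Finset.univ.image τ, bvar (r t) / (fib τ t).card * gini x (fib τ t)

open Classical in
/-- The conditional mean of `sumVar` given the strata. -/
noncomputable def sumVarT (c : ι → ℝ) (τ : Fin n → ι) : ℝ :=
  ∑ t ∈ Finset.univ.image τ, c t * ((fib τ t).card - 1)

/-- The centered count of zero pairs. -/
noncomputable def centeredSum (r : ι → unitInterval) (τ : Fin n → ι) (x y : Fin n → Fin 2) : ℝ :=
  ∑ i, (ind (x i) - cnt x (fib τ (τ i)) / (fib τ (τ i)).card) * (ind (y i) - r (τ i))

theorem sumVar_nonneg (τ : Fin n → ι) (x y : Fin n → Fin 2) : 0 ≤ sumVar τ x y := by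
  classical
  refine Finset.sum_nonneg fun t ht => mul_nonneg (div_nonneg (gini_nonneg _ _)
    (mul_nonneg (sq_nonneg _) ?_)) (gini_nonneg _ _)
  have : (1 : ℝ) ≤ (fib τ t).card := by exact_mod_cast card_fib_pos ht
  linarith

theorem sumVarX_nonneg (r : ι → unitInterval) (τ : Fin n → ι) (x : Fin n → Fin 2) :
    0 ≤ sumVarX r τ x :=
  Finset.sum_nonneg fun _ _ => mul_nonneg (div_nonneg (bvar_nonneg _) (Nat.cast_nonneg _))
    (gini_nonneg _ _)

theorem sumVarT_nonneg {c : ι → ℝ} (hc : ∀ t, 0 ≤ c t) (τ : Fin n → ι) : 0 ≤ sumVarT c τ := by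
  classical
  refine Finset.sum_nonneg fun t ht => mul_nonneg (hc t) ?_
  have : (1 : ℝ) ≤ (fib τ t).card := by exact_mod_cast card_fib_pos ht
  linarith

theorem sum_image_card [DecidableEq ι] (τ : Fin n → ι) :
    ∑ t ∈ Finset.univ.image τ, ((fib τ t).card : ℝ) = n := by
  simpa using sum_image_card_mul τ fun _ => (1 : ℝ)

theorem sumVar_le (τ : Fin n → ι) (x y : Fin n → Fin 2) : sumVar τ x y ≤ n := by
  classical
  rw [← sum_image_card τ]
  refine Finset.sum_le_sum fun t ht => ?_
  have hx := gini_le x (fib τ t)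
  have hy := gini_le y (fib τ t)
  have hy0 := gini_nonneg y (fib τ t)
  rcases (card_fib_pos ht).eq_or_lt with h | h
  · simp [gini_eq_zero_of_card_le_one y h.ge]
  · have h2 : (2 : ℝ) ≤ (fib τ t).card := by exact_mod_cast h
    set k : ℝ := ((fib τ t).card : ℝ)
    have h3 : (k ^ 2 / 4) / (k ^ 2 * (k - 1)) * (k ^ 2 / 4) ≤ k := by
      have : k - 1 ≠ 0 := by linarith
      have h4 : (k ^ 2 / 4) / (k ^ 2 * (k - 1)) * (k ^ 2 / 4) = k * (k / (16 * (k - 1))) := by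
        field_simp
        norm_num
      rw [h4]
      have h5 : k / (16 * (k - 1)) ≤ 1 := by
        rw [div_le_one (by linarith)]
        linarith
      nlinarith
    refine le_trans ?_ h3
    have h6 : 0 ≤ k ^ 2 * (k - 1) := mul_nonneg (sq_nonneg _) (by linarith)
    gcongr

theorem sumVarX_le (r : ι → unitInterval) (τ : Fin n → ι) (x : Fin n → Fin 2) :
    sumVarX r τ x ≤ n := by
  classical
  rw [← sum_image_card τ]
  refine Finset.sum_le_sum fun t ht => ?_
  have hx := gini_le x (fib τ t)
  have hb := bvar_le (r t)
  have hb0 := bvar_nonneg (r t)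
  have h1 : (1 : ℝ) ≤ (fib τ t).card := by exact_mod_cast card_fib_pos ht
  set k : ℝ := ((fib τ t).card : ℝ)
  have h3 : (1 / 4) / k * (k ^ 2 / 4) ≤ k := by
    field_simp
    norm_num
  refine le_trans ?_ h3
  gcongr
  exact gini_nonneg _ _

theorem sumVarT_le {c : ι → ℝ} (hc : ∀ t, 0 ≤ c t) (hc1 : ∀ t, c t ≤ 1) (τ : Fin n → ι) :
    sumVarT c τ ≤ n := by
  classical
  rw [← sum_image_card τ]
  refine Finset.sum_le_sum fun t ht => ?_
  have h1 : (1 : ℝ) ≤ (fib τ t).card := by exact_mod_cast card_fib_pos ht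
  nlinarith [hc t, hc1 t]

/-- Stratum by stratum, the Efron-Stein bound is the conditional mean times gini / k², and gini ≤
k²/4. -/
theorem integral_sumVar_sub_sq_le (r : ι → unitInterval) (τ : Fin n → ι) (x : Fin n → Fin 2) :
    ∫ y, (sumVar τ x y - sumVarX r τ x) ^ 2 ∂(bernPi fun i => r (τ i)) ≤ sumVarX r τ x / 4 := by
  classical
  have h := variance_sum_gini_le τ r fun t =>
    gini x (fib τ t) / ((fib τ t).card ^ 2 * ((fib τ t).card - 1))
  have hmean : ∑ t ∈ Finset.univ.image τ,
      gini x (fib τ t) / ((fib τ t).card ^ 2 * ((fib τ t).card - 1))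
        * ((fib τ t).card * ((fib τ t).card - 1) * bvar (r t)) = sumVarX r τ x := by
    refine Finset.sum_congr rfl fun t ht => ?_
    rcases (card_fib_pos ht).eq_or_lt with h | h
    · simp [gini_eq_zero_of_card_le_one x h.ge]
    · have h2 : (2 : ℝ) ≤ (fib τ t).card := by exact_mod_cast h
      have h3 : ((fib τ t).card : ℝ) - 1 ≠ 0 := by linarith
      field_simp
  rw [hmean] at h
  refine h.trans ?_
  rw [sumVarX, Finset.sum_div]
  refine Finset.sum_le_sum fun t ht => ?_
  rcases (card_fib_pos ht).eq_or_lt with h | h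
  · simp [gini_eq_zero_of_card_le_one x h.ge]
  · have h2 : (2 : ℝ) ≤ (fib τ t).card := by exact_mod_cast h
    have h3 : ((fib τ t).card : ℝ) - 1 ≠ 0 := by linarith
    have hg := gini_le x (fib τ t)
    have hg0 := gini_nonneg x (fib τ t)
    have hb := bvar_nonneg (r t)
    set k : ℝ := ((fib τ t).card : ℝ)
    set g := gini x (fib τ t)
    set b := bvar (r t)
    have e1 : k * ((g / (k ^ 2 * (k - 1))) ^ 2 * (k - 1) ^ 2 * b) = b / k * g * (g / k ^ 2) := by
      field_simp
    have h4 : g / k ^ 2 ≤ 1 / 4 := by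
      rw [div_le_iff₀ (by positivity)]
      linarith
    rw [e1]
    have h5 : 0 ≤ b / k * g := by positivity
    nlinarith

theorem integral_sumVarX_sub_sq_le (p r : ι → unitInterval) (τ : Fin n → ι) :
    ∫ x, (sumVarX r τ x - sumVarT (fun t => bvar (p t) * bvar (r t)) τ) ^ 2
        ∂(bernPi fun i => p (τ i))
      ≤ sumVarT (fun t => bvar (p t) * bvar (r t)) τ / 4 := by
  classical
  have h := variance_sum_gini_le τ p fun t => bvar (r t) / (fib τ t).card
  have hmean : ∑ t ∈ Finset.univ.image τ, bvar (r t) / (fib τ t).card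
        * ((fib τ t).card * ((fib τ t).card - 1) * bvar (p t))
      = sumVarT (fun t => bvar (p t) * bvar (r t)) τ := by
    refine Finset.sum_congr rfl fun t ht => ?_
    have h1 : (1 : ℝ) ≤ (fib τ t).card := by exact_mod_cast card_fib_pos ht
    field_simp
  rw [hmean] at h
  refine h.trans ?_
  rw [sumVarT, Finset.sum_div]
  refine Finset.sum_le_sum fun t ht => ?_
  have h1 : (1 : ℝ) ≤ (fib τ t).card := by exact_mod_cast card_fib_pos ht
  have hb := bvar_nonneg (r t)
  have hb1 := bvar_le (r t)
  have hp := bvar_nonneg (p t)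
  set k : ℝ := ((fib τ t).card : ℝ)
  have e1 : k * ((bvar (r t) / k) ^ 2 * (k - 1) ^ 2 * bvar (p t))
      = bvar (p t) * bvar (r t) * (k - 1) * (bvar (r t) * ((k - 1) / k)) := by
    field_simp
  have h3 : 0 ≤ (k - 1) / k := div_nonneg (by linarith) (by linarith)
  have h4 : (k - 1) / k ≤ 1 := by
    rw [div_le_one (by linarith)]
    linarith
  have h5 : bvar (r t) * ((k - 1) / k) ≤ 1 / 4 := by nlinarith
  rw [e1]
  have h6 : 0 ≤ bvar (p t) * bvar (r t) * (k - 1) :=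
    mul_nonneg (mul_nonneg hp hb) (by linarith)
  nlinarith

/-- Dropping observation i lowers `sumVarT` by c(τ i) if its stratum holds another observation, and
by 0 otherwise, since a singleton contributes c(1 - 1). Efron-Stein leaves ∑ k c² over strata with k
≥ 2; there k ≤ 2(k - 1), and one factor c is at most 1/4. -/
theorem variance_sumVarT_le [Countable ι] [MeasurableSpace ι] [MeasurableSingletonClass ι]
    (ν : Measure ι) [IsProbabilityMeasure ν] {c : ι → ℝ} (hc : ∀ t, 0 ≤ c t)
    (hc1 : ∀ t, c t ≤ 1 / 4) :
    ∫ τ : Fin n → ι, (sumVarT c τ - ∫ τ', sumVarT c τ' ∂(Measure.pi fun _ : Fin n => ν)) ^ 2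
        ∂(Measure.pi fun _ : Fin n => ν)
      ≤ (∫ τ, sumVarT c τ ∂(Measure.pi fun _ : Fin n => ν)) / 2 := by
  classical
  have hWb : IsBdd fun τ : Fin n → ι => sumVarT c τ :=
    IsBdd.of_mem_Icc (a := 0) (b := n) fun τ => ⟨sumVarT_nonneg hc τ,
      sumVarT_le hc (fun t => (hc1 t).trans (by norm_num)) τ⟩
  have hW : ∀ τ : Fin n → ι, sumVarT c τ = ∑ i, c (τ i) - ∑ t ∈ Finset.univ.image τ, c t := by
    intro τ
    rw [← sum_image_card_mul τ c, ← Finset.sum_sub_distrib]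
    exact Finset.sum_congr rfl fun t _ => by ring
  set g : Fin n → (Fin n → ι) → ℝ := fun i τ =>
    ∑ j ∈ Finset.univ.erase i, c (τ j) - ∑ t ∈ (Finset.univ.erase i).image τ, c t with hg
  have hsub : ∀ i (τ : Fin n → ι), sumVarT c τ - g i τ
      = if τ i ∈ (Finset.univ.erase i).image τ then c (τ i) else 0 := by
    intro i τ
    have h1 : Finset.univ.image τ = insert (τ i) ((Finset.univ.erase i).image τ) := by
      rw [← Finset.image_insert, Finset.insert_erase (Finset.mem_univ i)]
    rw [hW, hg, ← Finset.add_sum_erase _ _ (Finset.mem_univ i), h1]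
    split_ifs with h
    · rw [Finset.insert_eq_of_mem h]
      ring
    · rw [Finset.sum_insert h]
      ring
  have hgb : ∀ i, IsBdd (g i) := by
    intro i
    have h1 : IsBdd fun τ : Fin n → ι => sumVarT c τ - g i τ := by
      refine IsBdd.of_mem_Icc (a := 0) (b := 1 / 4) fun τ => ?_
      rw [hsub]
      split_ifs
      · exact ⟨hc _, hc1 _⟩
      · norm_num
    simpa using hWb.sub h1
  have hgi : ∀ i (τ : Fin n → ι) a, g i (Function.update τ i a) = g i τ := by
    intro i τ a
    have h1 : ∀ j ∈ Finset.univ.erase i, Function.update τ i a j = τ j := fun j hj =>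
      Function.update_of_ne (Finset.ne_of_mem_erase hj) _ _
    simp only [hg]
    rw [Finset.sum_congr rfl fun j hj => by rw [h1 j hj], Finset.image_congr h1]
  refine (efron_stein (fun _ => ν) hWb hgb hgi).trans ?_
  rw [← integral_finsetSum _ fun i _ => ((hWb.sub (hgb i)).sq).integrable _, ← integral_div]
  have hsum : ∀ τ : Fin n → ι, ∑ i, (sumVarT c τ - g i τ) ^ 2 ≤ sumVarT c τ / 2 := by
    intro τ
    have h1 : ∀ i, (sumVarT c τ - g i τ) ^ 2
        ≤ (if 2 ≤ (fib τ (τ i)).card then c (τ i) else 0) / 4 := by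
      intro i
      rw [hsub]
      by_cases h : τ i ∈ (Finset.univ.erase i).image τ
      · obtain ⟨j, hj, hji⟩ := Finset.mem_image.1 h
        have h2 : 2 ≤ (fib τ (τ i)).card :=
          Finset.one_lt_card.2 ⟨i, mem_fib.2 rfl, j, mem_fib.2 hji,
            (Finset.ne_of_mem_erase hj).symm⟩
        rw [if_pos h, if_pos h2]
        nlinarith [hc (τ i), hc1 (τ i)]
      · rw [if_neg h]
        split_ifs
        · nlinarith [hc (τ i)]
        · simp
    refine (Finset.sum_le_sum fun i _ => h1 i).trans ?_
    rw [← Finset.sum_div, ← sum_image_card_mul τ fun t => if 2 ≤ (fib τ t).card then c t else 0]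
    have h3 : ∑ t ∈ Finset.univ.image τ,
        (fib τ t).card * (if 2 ≤ (fib τ t).card then c t else 0) ≤ 2 * sumVarT c τ := by
      rw [sumVarT, Finset.mul_sum]
      refine Finset.sum_le_sum fun t ht => ?_
      have h4 : (1 : ℝ) ≤ (fib τ t).card := by exact_mod_cast card_fib_pos ht
      split_ifs with h5
      · have h6 : (2 : ℝ) ≤ (fib τ t).card := by exact_mod_cast h5
        nlinarith [hc t]
      · nlinarith [hc t]
    linarith
  have hb2 : IsBdd fun τ : Fin n → ι => sumVarT c τ / 2 := by
    simpa only [div_eq_mul_inv] using hWb.mul (IsBdd.const (2 : ℝ)⁻¹)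
  refine integral_mono ?_ (hb2.integrable _) hsum
  exact integrable_finsetSum _ fun i _ => ((hWb.sub (hgb i)).sq).integrable _

end Model

end CMH

namespace CMH

/-! ### Characteristic function of the centered sum -/

/-- Telescoping: factors are exchanged one at a time, while all the others have norm at most 1. -/
theorem norm_prod_sub_prod_le {α : Type*} (s : Finset α) {f g : α → ℂ} (hf : ∀ i ∈ s, ‖f i‖ ≤ 1)
    (hg : ∀ i ∈ s, ‖g i‖ ≤ 1) : ‖∏ i ∈ s, f i - ∏ i ∈ s, g i‖ ≤ ∑ i ∈ s, ‖f i - g i‖ := by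
  classical
  induction s using Finset.induction_on with
  | empty => simp
  | insert a s ha ih =>
    rw [Finset.prod_insert ha, Finset.prod_insert ha, Finset.sum_insert ha]
    have h1 : f a * ∏ i ∈ s, f i - g a * ∏ i ∈ s, g i
        = (f a - g a) * ∏ i ∈ s, f i + g a * (∏ i ∈ s, f i - ∏ i ∈ s, g i) := by ring
    rw [h1]
    refine (norm_add_le _ _).trans (add_le_add ?_ ?_)
    · rw [norm_mul, norm_prod]
      refine mul_le_of_le_one_right (norm_nonneg _) (Finset.prod_le_one (fun _ _ => norm_nonneg _)
        fun i hi => hf i (Finset.mem_insert_of_mem hi))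
    · rw [norm_mul]
      refine (mul_le_of_le_one_left (norm_nonneg _) (hg a (Finset.mem_insert_self a s))).trans ?_
      exact ih (fun i hi => hf i (Finset.mem_insert_of_mem hi))
        fun i hi => hg i (Finset.mem_insert_of_mem hi)

theorem norm_exp_mul_I_sub_le {z : ℝ} (hz : |z| ≤ 1) :
    ‖Complex.exp (z * Complex.I) - (1 + z * Complex.I - z ^ 2 / 2)‖ ≤ |z| ^ 3 := by
  have hn : ‖(z * Complex.I : ℂ)‖ = |z| := by simp
  have h := Complex.exp_bound (x := z * Complex.I) (by rw [hn]; exact hz) (n := 3) (by norm_num)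
  have hs : ∑ m ∈ Finset.range 3, (z * Complex.I : ℂ) ^ m / (m.factorial : ℂ)
      = 1 + z * Complex.I - z ^ 2 / 2 := by
    simp only [Finset.sum_range_succ, Finset.sum_range_zero, Nat.factorial, mul_pow,
      Complex.I_sq]
    push_cast
    ring
  rw [hs, hn] at h
  refine h.trans ?_
  have h3 : 0 ≤ |z| ^ 3 := by positivity
  norm_num [Nat.factorial]
  linarith

/-- Both terms are compared with 1 - u²v/2, where v = a² `bvar p`; centring removes the linear term.
Each error is at most |u|³v and not merely |u|³, because |a m|³ ≤ (a m)² when |a m| ≤ 1. Summed over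
observations, the errors are thus controlled by the total conditional variance. -/
theorem norm_integral_exp_bernoulli_sub_le (p : unitInterval) {a u : ℝ} (ha : |a| ≤ 1)
    (hu : |u| ≤ 1) :
    ‖∫ b, Complex.exp (((u * (a * (ind b - p)) : ℝ) : ℂ) * Complex.I)
        ∂(bernoulliMeasure (0 : Fin 2) 1 p)
      - Complex.exp ((-(u ^ 2 * (a ^ 2 * bvar p) / 2) : ℝ) : ℂ)‖
      ≤ 2 * |u| ^ 3 * (a ^ 2 * bvar p) := by
  have hp0 : (0 : ℝ) ≤ p := p.2.1
  have hp1 : (p : ℝ) ≤ 1 := p.2.2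
  have hb0 := bvar_nonneg p
  have hb1 := bvar_le p
  have ha2 : a ^ 2 ≤ 1 := by rw [← sq_abs]; exact pow_le_one₀ (abs_nonneg _) ha
  have hu2 : u ^ 2 ≤ 1 := by rw [← sq_abs]; exact pow_le_one₀ (abs_nonneg _) hu
  set v : ℝ := a ^ 2 * bvar p with hv
  have hv0 : 0 ≤ v := mul_nonneg (sq_nonneg _) hb0
  have hv1 : v ≤ 1 := by nlinarith
  have hcube : ∀ m : ℝ, |m| ≤ 1 → |u * (a * m)| ≤ 1 ∧ |u * (a * m)| ^ 3 ≤ |u| ^ 3 * (a * m) ^ 2 := by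
    intro m hm
    have h1 : |a * m| ≤ 1 := by
      rw [abs_mul]
      exact mul_le_one₀ ha (abs_nonneg _) hm
    refine ⟨?_, ?_⟩
    · rw [abs_mul]
      exact mul_le_one₀ hu (abs_nonneg _) h1
    · rw [abs_mul, mul_pow, ← sq_abs (a * m)]
      exact mul_le_mul_of_nonneg_left (pow_le_pow_of_le_one (abs_nonneg _) h1 (by norm_num))
        (by positivity)
  have hm1 := hcube (1 - p) (by rw [abs_le]; constructor <;> linarith)
  have hm2 := hcube (0 - p) (by rw [abs_le]; constructor <;> linarith)
  have e1 := norm_exp_mul_I_sub_le hm1.1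
  have e2 := norm_exp_mul_I_sub_le hm2.1
  rw [integral_bernoulliMeasure]
  simp only [ind_zero, ind_one]
  set z1 : ℝ := u * (a * (1 - p))
  set z2 : ℝ := u * (a * (0 - p))
  have e3 : ‖Complex.exp ((-(u ^ 2 * v / 2) : ℝ) : ℂ) - ((1 - u ^ 2 * v / 2 : ℝ) : ℂ)‖
      ≤ |u| ^ 3 * v := by
    rw [← Complex.ofReal_exp, ← Complex.ofReal_sub, Complex.norm_real, Real.norm_eq_abs]
    have hx : |-(u ^ 2 * v / 2)| ≤ 1 := by
      rw [abs_neg, abs_of_nonneg (by positivity)]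
      nlinarith [sq_nonneg u]
    have h := Real.abs_exp_sub_one_sub_id_le hx
    have h4 : (-(u ^ 2 * v / 2)) ^ 2 ≤ |u| ^ 3 * v := by
      have h5 : (-(u ^ 2 * v / 2)) ^ 2 = |u| ^ 3 * v * (|u| * v / 4) := by
        rw [← sq_abs u]
        ring
      rw [h5]
      have h6 : |u| * v / 4 ≤ 1 := by nlinarith [abs_nonneg u]
      exact mul_le_of_le_one_right (by positivity) h6
    refine le_trans (le_of_eq ?_) (h.trans h4)
    congr 1
    ring
  have key : (p : ℂ) * Complex.exp (z1 * Complex.I) + (1 - p : ℂ) * Complex.exp (z2 * Complex.I)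
        - Complex.exp ((-(u ^ 2 * v / 2) : ℝ) : ℂ)
      = (p : ℂ) * (Complex.exp (z1 * Complex.I) - (1 + z1 * Complex.I - z1 ^ 2 / 2))
        + ((1 - p : ℝ) : ℂ) * (Complex.exp (z2 * Complex.I) - (1 + z2 * Complex.I - z2 ^ 2 / 2))
        - (Complex.exp ((-(u ^ 2 * v / 2) : ℝ) : ℂ) - ((1 - u ^ 2 * v / 2 : ℝ) : ℂ)) := by
    simp only [z1, z2, hv, bvar]
    push_cast
    ring
  have hgoal : ‖(p : ℂ) * Complex.exp (z1 * Complex.I) + (1 - p : ℂ) * Complex.exp (z2 * Complex.I)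
        - Complex.exp ((-(u ^ 2 * v / 2) : ℝ) : ℂ)‖ ≤ 2 * |u| ^ 3 * v := by
    rw [key]
    refine (norm_sub_le _ _).trans ?_
    refine (add_le_add (norm_add_le _ _) e3).trans ?_
    rw [norm_mul, norm_mul, Complex.norm_real, Complex.norm_real, Real.norm_eq_abs,
      Real.norm_eq_abs, abs_of_nonneg hp0, abs_of_nonneg (sub_nonneg.2 hp1)]
    have h1 := mul_le_mul_of_nonneg_left (e1.trans hm1.2) hp0
    have h2 := mul_le_mul_of_nonneg_left (e2.trans hm2.2) (sub_nonneg.2 hp1)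
    have h3 : (p : ℝ) * (|u| ^ 3 * (a * (1 - p)) ^ 2) + (1 - p) * (|u| ^ 3 * (a * (0 - p)) ^ 2)
        = |u| ^ 3 * v := by
      simp only [hv, bvar]
      ring
    linarith
  convert! hgoal using 3
  simp

section

variable {n : ℕ} {ι : Type*}

theorem abs_ind_sub_le (x : Fin n → Fin 2) (s : Finset (Fin n)) (a : Fin 2) :
    |ind a - cnt x s / s.card| ≤ 1 := by
  have h1 := ind_mem a
  have h2 : cnt x s / s.card ∈ Set.Icc (0 : ℝ) 1 :=
    ⟨div_nonneg (cnt_nonneg _ _) (Nat.cast_nonneg _),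
      div_le_one_of_le₀ (cnt_le _ _) (Nat.cast_nonneg _)⟩
  rw [abs_le]
  constructor <;> linarith [h1.1, h1.2, h2.1, h2.2]

theorem sum_sq_ind_sub (x : Fin n → Fin 2) {s : Finset (Fin n)} (hs : 1 ≤ s.card) :
    ∑ i ∈ s, (ind (x i) - cnt x s / s.card) ^ 2 = gini x s / s.card := by
  have h1 : ∀ i, (ind (x i) - cnt x s / s.card) ^ 2
      = ind (x i) * (1 - 2 * (cnt x s / s.card)) + (cnt x s / s.card) ^ 2 := by
    intro i
    generalize x i = a
    fin_cases a
    · simp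
      ring
    · simp
  have h2 : (s.card : ℝ) ≠ 0 := by positivity
  simp_rw [h1]
  rw [Finset.sum_add_distrib, ← Finset.sum_mul, Finset.sum_const, nsmul_eq_mul]
  change cnt x s * _ + _ = _
  unfold gini
  field_simp
  ring

/-- `sumVarX`, introduced as the conditional mean of the squared denominator, is also the
conditional variance of the numerator. This is why the limit law has variance one. -/
theorem sum_sq_mul_bvar (r : ι → unitInterval) (τ : Fin n → ι) (x : Fin n → Fin 2) :
    ∑ i, (ind (x i) - cnt x (fib τ (τ i)) / (fib τ (τ i)).card) ^ 2 * bvar (r (τ i))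
      = sumVarX r τ x := by
  classical
  rw [← Finset.sum_fiberwise_of_maps_to (g := τ) (t := Finset.univ.image τ)
    fun i _ => Finset.mem_image_of_mem τ (Finset.mem_univ i)]
  refine Finset.sum_congr rfl fun t ht => ?_
  have h : (Finset.univ.filter fun i => τ i = t) = fib τ t := by ext; simp
  rw [h, Finset.sum_congr rfl
    (g := fun i => (ind (x i) - cnt x (fib τ t) / (fib τ t).card) ^ 2 * bvar (r t))
    fun i hi => by rw [mem_fib.1 hi], ← Finset.sum_mul, sum_sq_ind_sub x (card_fib_pos ht)]
  ring

theorem norm_integral_exp_centeredSum_sub_le (r : ι → unitInterval) (τ : Fin n → ι)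
    (x : Fin n → Fin 2) {u : ℝ} (hu : |u| ≤ 1) :
    ‖∫ y, Complex.exp (((u * centeredSum r τ x y : ℝ) : ℂ) * Complex.I)
        ∂(bernPi fun i => r (τ i))
      - Complex.exp ((-(u ^ 2 * sumVarX r τ x / 2) : ℝ) : ℂ)‖ ≤ 2 * |u| ^ 3 * sumVarX r τ x := by
  set a : Fin n → ℝ := fun i => ind (x i) - cnt x (fib τ (τ i)) / (fib τ (τ i)).card with ha
  have h1 : ∀ y, Complex.exp (((u * centeredSum r τ x y : ℝ) : ℂ) * Complex.I)
      = ∏ i, Complex.exp (((u * (a i * (ind (y i) - r (τ i))) : ℝ) : ℂ) * Complex.I) := by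
    intro y
    rw [← Complex.exp_sum, centeredSum, Finset.mul_sum, Complex.ofReal_sum, Finset.sum_mul]
  have h2 : Complex.exp ((-(u ^ 2 * sumVarX r τ x / 2) : ℝ) : ℂ)
      = ∏ i, Complex.exp ((-(u ^ 2 * (a i ^ 2 * bvar (r (τ i))) / 2) : ℝ) : ℂ) := by
    rw [← Complex.exp_sum, ← sum_sq_mul_bvar, ← Complex.ofReal_sum, Finset.sum_neg_distrib,
      Finset.mul_sum, Finset.sum_div]
  simp_rw [h1]
  rw [h2, bernPi, integral_fintype_prod_eq_prod (fun i b =>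
    Complex.exp (((u * (a i * (ind b - r (τ i))) : ℝ) : ℂ) * Complex.I)),
    ← sum_sq_mul_bvar, Finset.mul_sum]
  refine (norm_prod_sub_prod_le _ ?_ ?_).trans (Finset.sum_le_sum fun i _ =>
    norm_integral_exp_bernoulli_sub_le (r (τ i)) (abs_ind_sub_le _ _ _) hu)
  · intro i _
    refine (norm_integral_le_of_norm_le_const (C := 1) (ae_of_all _ fun b => ?_)).trans (by simp)
    rw [Complex.norm_exp_ofReal_mul_I]
  · intro i _
    rw [← Complex.ofReal_exp, Complex.norm_real, Real.norm_eq_abs, Real.abs_exp,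
      Real.exp_le_one_iff]
    have := bvar_nonneg (r (τ i))
    have : 0 ≤ u ^ 2 * (a i ^ 2 * bvar (r (τ i))) / 2 := by positivity
    linarith

end

end CMH

namespace CMH

/-! ### The law of the stratified sample under independence within strata -/

/-- The sample space: the strata, the first and the second coordinates of `n` observations. -/
abbrev Sample (n : ℕ) (ι : Type*) : Type _ := (Fin n → ι) × (Fin n → Fin 2) × (Fin n → Fin 2)

section Bounded

variable {n : ℕ} {ι : Type*} (p r : ι → unitInterval)

theorem isBdd_sumVar : IsBdd fun ω : Sample n ι => sumVar ω.1 ω.2.1 ω.2.2 :=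
  IsBdd.of_mem_Icc fun _ => ⟨sumVar_nonneg _ _ _, sumVar_le _ _ _⟩

theorem isBdd_sumVarX : IsBdd fun ω : Sample n ι => sumVarX r ω.1 ω.2.1 :=
  IsBdd.of_mem_Icc fun _ => ⟨sumVarX_nonneg _ _ _, sumVarX_le _ _ _⟩

/-- The product of the within-stratum variances. -/
noncomputable def bvarProd (t : ι) : ℝ := bvar (p t) * bvar (r t)

theorem bvarProd_nonneg (t : ι) : 0 ≤ bvarProd p r t := mul_nonneg (bvar_nonneg _) (bvar_nonneg _)

theorem bvarProd_le (t : ι) : bvarProd p r t ≤ 1 / 4 := by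
  have h1 := bvar_le (p t)
  have h2 := bvar_le (r t)
  have h3 := bvar_nonneg (p t)
  have h4 := bvar_nonneg (r t)
  unfold bvarProd
  nlinarith

theorem isBdd_sumVarT : IsBdd fun τ : Fin n → ι => sumVarT (bvarProd p r) τ :=
  IsBdd.of_mem_Icc fun _ => ⟨sumVarT_nonneg (bvarProd_nonneg p r) _,
    sumVarT_le (bvarProd_nonneg p r) (fun t => (bvarProd_le p r t).trans (by norm_num)) _⟩

/-- The mean of `sumVar`. -/
noncomputable def meanVar [MeasurableSpace ι] (ν : Measure ι) (n : ℕ) : ℝ :=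
  ∫ τ, sumVarT (bvarProd p r) τ ∂(Measure.pi fun _ : Fin n => ν)

theorem meanVar_nonneg [MeasurableSpace ι] (ν : Measure ι) : 0 ≤ meanVar p r ν n :=
  integral_nonneg fun _ => sumVarT_nonneg (bvarProd_nonneg p r) _

end Bounded

section Law

variable {n : ℕ} {ι : Type*} [Countable ι] [MeasurableSpace ι] [MeasurableSingletonClass ι]

/-- Given the strata, all coordinates are independent. -/
noncomputable def modelKernel (p r : ι → unitInterval) (n : ℕ) :
    Kernel (Fin n → ι) ((Fin n → Fin 2) × (Fin n → Fin 2)) where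
  toFun τ := (bernPi fun i => p (τ i)).prod (bernPi fun i => r (τ i))
  measurable' := Measurable.of_discrete

theorem modelKernel_apply (p r : ι → unitInterval) (n : ℕ) (τ : Fin n → ι) :
    modelKernel p r n τ = (bernPi fun i => p (τ i)).prod (bernPi fun i => r (τ i)) := rfl

instance (p r : ι → unitInterval) (n : ℕ) : IsMarkovKernel (modelKernel p r n) :=
  ⟨fun τ => by rw [modelKernel_apply]; infer_instance⟩

/-- The law of `n` independent observations with independence within strata. -/
noncomputable def modelLaw (ν : Measure ι) (p r : ι → unitInterval) (n : ℕ) :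
    Measure (Sample n ι) :=
  (Measure.pi fun _ : Fin n => ν) ⊗ₘ modelKernel p r n

variable (ν : Measure ι) [IsProbabilityMeasure ν] (p r : ι → unitInterval)

instance : IsProbabilityMeasure (modelLaw ν p r n) := by
  unfold modelLaw
  infer_instance

theorem integral_modelLaw {E : Type*} [NormedAddCommGroup E] [NormedSpace ℝ E]
    {G : Sample n ι → E} (hG : ∃ K, ∀ ω, ‖G ω‖ ≤ K) :
    ∫ ω, G ω ∂(modelLaw ν p r n)
      = ∫ τ, ∫ x, ∫ y, G (τ, x, y) ∂(bernPi fun i => r (τ i)) ∂(bernPi fun i => p (τ i))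
          ∂(Measure.pi fun _ : Fin n => ν) := by
  obtain ⟨K, hK⟩ := hG
  rw [modelLaw, Measure.integral_compProd (Integrable.of_bound
    StronglyMeasurable.of_discrete.aestronglyMeasurable K (ae_of_all _ hK))]
  refine integral_congr_ae (ae_of_all _ fun τ => ?_)
  simp only [modelKernel_apply]
  exact integral_prod _ (Integrable.of_bound
    StronglyMeasurable.of_discrete.aestronglyMeasurable K (ae_of_all _ fun q => hK (τ, q)))

theorem integral_modelLaw_real {G : Sample n ι → ℝ} (hG : IsBdd G) :
    ∫ ω, G ω ∂(modelLaw ν p r n)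
      = ∫ τ, ∫ x, ∫ y, G (τ, x, y) ∂(bernPi fun i => r (τ i)) ∂(bernPi fun i => p (τ i))
          ∂(Measure.pi fun _ : Fin n => ν) :=
  integral_modelLaw ν p r hG

theorem integral_modelLaw_sumVarX_sub_sumVarT_sq_le :
    ∫ ω, (sumVarX r ω.1 ω.2.1 - sumVarT (bvarProd p r) ω.1) ^ 2 ∂(modelLaw ν p r n)
      ≤ meanVar p r ν n / 4 := by
  have hb := ((isBdd_sumVarX (n := n) r).sub ((isBdd_sumVarT p r).comp Prod.fst)).sq
  rw [integral_modelLaw_real ν p r hb, meanVar, ← integral_div]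
  refine integral_mono_of_nonneg (ae_of_all _ fun τ => integral_nonneg fun x =>
    integral_nonneg fun y => sq_nonneg _)
    (((isBdd_sumVarT p r).integrable _).div_const 4) (ae_of_all _ fun τ => ?_)
  simpa [bvarProd] using! integral_sumVarX_sub_sq_le p r τ

theorem integral_modelLaw_sumVarT_sub_sq_le :
    ∫ ω, (sumVarT (bvarProd p r) ω.1 - meanVar p r ν n) ^ 2 ∂(modelLaw ν p r n)
      ≤ meanVar p r ν n / 2 := by
  have hb := (((isBdd_sumVarT (n := n) p r).comp
    (Prod.fst : Sample n ι → _)).sub (IsBdd.const (meanVar p r ν n))).sq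
  rw [integral_modelLaw_real ν p r hb]
  simpa using! variance_sumVarT_le (n := n) ν (bvarProd_nonneg p r) (bvarProd_le p r)

theorem integral_modelLaw_sumVar_sub_sumVarX_sq_le :
    ∫ ω, (sumVar ω.1 ω.2.1 ω.2.2 - sumVarX r ω.1 ω.2.1) ^ 2 ∂(modelLaw ν p r n)
      ≤ (∫ ω, sumVarX r ω.1 ω.2.1 ∂(modelLaw ν p r n)) / 4 := by
  have hb := ((isBdd_sumVar (n := n) (ι := ι)).sub (isBdd_sumVarX r)).sq
  rw [integral_modelLaw_real ν p r hb, integral_modelLaw_real ν p r (isBdd_sumVarX r), ← integral_div]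
  have hb2 : IsBdd fun τ : Fin n → ι =>
      (∫ x, sumVarX r τ x ∂(bernPi fun i => p (τ i))) / 4 := by
    have h0 := IsBdd.integral (F := fun τ x => sumVarX r τ x)
      (IsBdd.of_mem_Icc fun _ => ⟨sumVarX_nonneg r _ _, sumVarX_le (n := n) r _ _⟩)
      (fun τ : Fin n → ι => bernPi fun i => p (τ i))
    simpa only [div_eq_mul_inv] using h0.mul (IsBdd.const (4 : ℝ)⁻¹)
  simp only [integral_const, probReal_univ, one_smul]
  refine integral_mono_of_nonneg (ae_of_all _ fun τ => integral_nonneg fun x =>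
    integral_nonneg fun y => sq_nonneg _) (hb2.integrable _) (ae_of_all _ fun τ => ?_)
  simp only
  rw [← integral_div]
  exact integral_mono ((IsBdd.of_finite _).integrable _) ((IsBdd.of_finite _).integrable _)
    fun x => integral_sumVar_sub_sq_le r τ x

theorem integral_modelLaw_sumVarX :
    ∫ ω, sumVarX r ω.1 ω.2.1 ∂(modelLaw ν p r n) = meanVar p r ν n := by
  classical
  rw [integral_modelLaw_real ν p r (isBdd_sumVarX r), meanVar]
  refine integral_congr_ae (ae_of_all _ fun τ => ?_)
  simp only [integral_const, probReal_univ, one_smul]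
  have h := integral_sum_gini τ p fun t => bvar (r t) / (fib τ t).card
  refine h.trans (Finset.sum_congr rfl fun t ht => ?_)
  have h1 : (1 : ℝ) ≤ (fib τ t).card := by exact_mod_cast card_fib_pos ht
  simp only [bvarProd]
  field_simp

theorem integral_modelLaw_sumVar :
    ∫ ω, sumVar ω.1 ω.2.1 ω.2.2 ∂(modelLaw ν p r n) = meanVar p r ν n := by
  classical
  rw [← integral_modelLaw_sumVarX, integral_modelLaw_real ν p r isBdd_sumVar,
    integral_modelLaw_real ν p r (isBdd_sumVarX r)]
  refine integral_congr_ae (ae_of_all _ fun τ => integral_congr_ae (ae_of_all _ fun x => ?_))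
  simp only [integral_const, probReal_univ, one_smul]
  have h := integral_sum_gini τ r fun t =>
    gini x (fib τ t) / ((fib τ t).card ^ 2 * ((fib τ t).card - 1))
  refine h.trans (Finset.sum_congr rfl fun t ht => ?_)
  rcases (card_fib_pos ht).eq_or_lt with h | h
  · simp [gini_eq_zero_of_card_le_one x h.ge]
  · have h2 : (2 : ℝ) ≤ (fib τ t).card := by exact_mod_cast h
    have h3 : ((fib τ t).card : ℝ) - 1 ≠ 0 := by linarith
    field_simp

/-- The randomness of the labels and that of the strata contribute B/4 and B/2, each doubled by (a +
b)² ≤ 2a² + 2b². The variance is of the order of the mean, so relative fluctuations vanish as B → ∞.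
-/
theorem integral_modelLaw_sumVarX_sub_sq_le :
    ∫ ω, (sumVarX r ω.1 ω.2.1 - meanVar p r ν n) ^ 2 ∂(modelLaw ν p r n)
      ≤ 2 * meanVar p r ν n := by
  set B := meanVar p r ν n with hB
  have hT := (isBdd_sumVarT (n := n) p r).comp (Prod.fst : Sample n ι → _)
  have b1 := ((isBdd_sumVarX (n := n) r).sub hT).sq
  have b2 := (hT.sub (IsBdd.const B)).sq
  have b3 := ((isBdd_sumVarX (n := n) r).sub (IsBdd.const B)).sq
  have h : ∀ ω : Sample n ι, (sumVarX r ω.1 ω.2.1 - B) ^ 2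
      ≤ 2 * (sumVarX r ω.1 ω.2.1 - sumVarT (bvarProd p r) ω.1) ^ 2
        + 2 * (sumVarT (bvarProd p r) ω.1 - B) ^ 2 := fun ω => by
    nlinarith [sq_nonneg (sumVarX r ω.1 ω.2.1 - 2 * sumVarT (bvarProd p r) ω.1 + B)]
  have h2 := integral_mono (b3.integrable (modelLaw ν p r n))
    (((b1.integrable _).const_mul 2).add ((b2.integrable _).const_mul 2)) h
  simp only [Pi.add_apply] at h2
  rw [integral_add ((b1.integrable _).const_mul 2) ((b2.integrable _).const_mul 2),
    integral_const_mul, integral_const_mul] at h2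
  have h3 := integral_modelLaw_sumVarX_sub_sumVarT_sq_le (n := n) ν p r
  have h4 := integral_modelLaw_sumVarT_sub_sq_le (n := n) ν p r
  have h5 := meanVar_nonneg (n := n) p r ν
  rw [← hB] at h3 h4 h5
  linarith

theorem integral_modelLaw_sumVar_sub_sq_le :
    ∫ ω, (sumVar ω.1 ω.2.1 ω.2.2 - meanVar p r ν n) ^ 2 ∂(modelLaw ν p r n)
      ≤ 5 * meanVar p r ν n := by
  set B := meanVar p r ν n with hB
  have hX := isBdd_sumVarX (n := n) r
  have hF := isBdd_sumVar (n := n) (ι := ι)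
  have b1 := (hF.sub hX).sq
  have b2 := (hX.sub (IsBdd.const B)).sq
  have b3 := (hF.sub (IsBdd.const B)).sq
  have h : ∀ ω : Sample n ι, (sumVar ω.1 ω.2.1 ω.2.2 - B) ^ 2
      ≤ 2 * (sumVar ω.1 ω.2.1 ω.2.2 - sumVarX r ω.1 ω.2.1) ^ 2
        + 2 * (sumVarX r ω.1 ω.2.1 - B) ^ 2 := fun ω => by
    nlinarith [sq_nonneg (sumVar ω.1 ω.2.1 ω.2.2 - 2 * sumVarX r ω.1 ω.2.1 + B)]
  have h2 := integral_mono (b3.integrable (modelLaw ν p r n))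
    (((b1.integrable _).const_mul 2).add ((b2.integrable _).const_mul 2)) h
  simp only [Pi.add_apply] at h2
  rw [integral_add ((b1.integrable _).const_mul 2) ((b2.integrable _).const_mul 2),
    integral_const_mul, integral_const_mul] at h2
  have h3 := integral_modelLaw_sumVar_sub_sumVarX_sq_le (n := n) ν p r
  have h4 := integral_modelLaw_sumVarX_sub_sq_le (n := n) ν p r
  have h5 := meanVar_nonneg (n := n) p r ν
  rw [integral_modelLaw_sumVarX, ← hB] at h3
  rw [← hB] at h4 h5
  linarith

/-- A quantitative central limit theorem for the characteristic function. -/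
theorem norm_integral_exp_sub_le (s : ℝ) (hB : 0 < meanVar p r ν n)
    (hs : |s| ≤ √(meanVar p r ν n)) :
    ‖∫ ω, Complex.exp (((s * (centeredSum r ω.1 ω.2.1 ω.2.2 / √(meanVar p r ν n)) : ℝ) : ℂ)
          * Complex.I) ∂(modelLaw ν p r n) - Complex.exp ((-(s ^ 2 / 2) : ℝ) : ℂ)‖
      ≤ (2 * |s| ^ 3 + s ^ 2) / √(meanVar p r ν n) := by
  set B := meanVar p r ν n with hBdef
  have hB2 : 0 < √B := Real.sqrt_pos.2 hB
  have hBB : √B * √B = B := Real.mul_self_sqrt hB.le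
  set u : ℝ := s / √B with hu
  have hu1 : |u| ≤ 1 := by
    rw [hu, abs_div, abs_of_pos hB2, div_le_one hB2]
    exact hs
  have hu2 : u ^ 2 = s ^ 2 / B := by rw [hu, div_pow, Real.sq_sqrt hB.le]
  set μ := modelLaw ν p r n
  set V : Sample n ι → ℝ := fun ω => sumVarX r ω.1 ω.2.1
  have hVb : IsBdd V := isBdd_sumVarX r
  have hV0 : ∀ ω, 0 ≤ V ω := fun ω => sumVarX_nonneg _ _ _
  set G : Sample n ι → ℂ := fun ω =>
    Complex.exp (((u * centeredSum r ω.1 ω.2.1 ω.2.2 : ℝ) : ℂ) * Complex.I) with hGdef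
  set H : Sample n ι → ℂ := fun ω => Complex.exp ((-(u ^ 2 * V ω / 2) : ℝ) : ℂ) with hHdef
  have hGn : ∀ ω, ‖G ω‖ ≤ 1 := fun ω => by rw [hGdef, Complex.norm_exp_ofReal_mul_I]
  have hHn : ∀ ω, ‖H ω‖ ≤ 1 := fun ω => by
    simp only [hHdef]
    rw [← Complex.ofReal_exp, Complex.norm_real, Real.norm_eq_abs, Real.abs_exp,
      Real.exp_le_one_iff]
    have : 0 ≤ u ^ 2 * V ω / 2 := by have := hV0 ω; positivity
    linarith
  have hint : ∀ {g : Sample n ι → ℂ} {K : ℝ}, (∀ ω, ‖g ω‖ ≤ K) → Integrable g μ := fun hg =>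
    Integrable.of_bound StronglyMeasurable.of_discrete.aestronglyMeasurable _ (ae_of_all _ hg)
  -- Conditional central limit theorem: given the strata and the first labels, the characteristic
  -- function is close to a Gaussian factor whose variance V is still random. The error 2|u|³V has
  -- mean 2|u|³B.
  have hstep1 : ‖∫ ω, (G ω - H ω) ∂μ‖ ≤ 2 * |u| ^ 3 * B := by
    have hGH : ∀ ω, ‖G ω - H ω‖ ≤ 2 := fun ω =>
      (norm_sub_le _ _).trans (by linarith [hGn ω, hHn ω])
    have hB' : B = ∫ τ, ∫ x, sumVarX r τ x ∂(bernPi fun i => p (τ i))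
        ∂(Measure.pi fun _ : Fin n => ν) := by
      rw [hBdef, ← integral_modelLaw_sumVarX, integral_modelLaw_real ν p r (isBdd_sumVarX r)]
      simp
    have hVxb : IsBdd fun τ : Fin n → ι => ∫ x, sumVarX r τ x ∂(bernPi fun i => p (τ i)) :=
      IsBdd.integral (F := fun τ x => sumVarX r τ x)
        (IsBdd.of_mem_Icc fun _ => ⟨sumVarX_nonneg r _ _, sumVarX_le (n := n) r _ _⟩)
        (fun τ : Fin n → ι => bernPi fun i => p (τ i))
    rw [integral_modelLaw ν p r ⟨2, hGH⟩, hB', ← integral_const_mul]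
    refine norm_integral_le_of_norm_le ((hVxb.integrable _).const_mul _)
      (ae_of_all _ fun τ => ?_)
    rw [← integral_const_mul]
    refine norm_integral_le_of_norm_le ((IsBdd.of_finite _).integrable _)
      (ae_of_all _ fun x => ?_)
    have h := norm_integral_exp_centeredSum_sub_le r τ x hu1
    refine le_trans (le_of_eq ?_) h
    congr 1
    rw [integral_sub]
    · simp [hGdef, hHdef, V]
    · exact Integrable.of_bound StronglyMeasurable.of_discrete.aestronglyMeasurable 1
        (ae_of_all _ fun y => hGn (τ, x, y))
    · exact Integrable.of_bound StronglyMeasurable.of_discrete.aestronglyMeasurable 1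
        (ae_of_all _ fun y => hHn (τ, x, y))
  have hdev : ∫ ω, |V ω - B| ∂μ ≤ 2 * √B := by
    have hb : IsBdd fun ω => |V ω - B| := by
      obtain ⟨K, hK⟩ := hVb.sub (IsBdd.const B)
      exact ⟨K, fun ω => by simpa using hK ω⟩
    have h1 := sq_integral_le μ hb
    simp only [sq_abs] at h1
    have h2 : (∫ ω, |V ω - B| ∂μ) ^ 2 ≤ (2 * √B) ^ 2 := by
      have := integral_modelLaw_sumVarX_sub_sq_le (n := n) ν p r
      rw [mul_pow, Real.sq_sqrt hB.le]
      linarith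
    exact (pow_le_pow_iff_left₀ (integral_nonneg fun _ => abs_nonneg _) (by positivity) two_ne_zero).1 h2
  -- V is replaced by its mean B: t ↦ exp(-t) is 1-Lipschitz on [0, ∞), and `hdev` gives E|V - B| ≤
  -- 2√B.
  have hstep2 : ‖∫ ω, (H ω - Complex.exp ((-(s ^ 2 / 2) : ℝ) : ℂ)) ∂μ‖ ≤ s ^ 2 / √B := by
    have hpt : ∀ ω, ‖H ω - Complex.exp ((-(s ^ 2 / 2) : ℝ) : ℂ)‖
        ≤ s ^ 2 / (2 * B) * |V ω - B| := by
      intro ω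
      simp only [hHdef]
      rw [← Complex.ofReal_exp, ← Complex.ofReal_exp, ← Complex.ofReal_sub, Complex.norm_real,
        Real.norm_eq_abs]
      have hlip : ∀ a b : ℝ, 0 ≤ a → 0 ≤ b → |Real.exp (-a) - Real.exp (-b)| ≤ |a - b| := by
        have hle : ∀ a b : ℝ, 0 ≤ a → a ≤ b → |Real.exp (-a) - Real.exp (-b)| ≤ |a - b| := by
          intro a b ha hab
          have h1 : Real.exp (-b) ≤ Real.exp (-a) := Real.exp_le_exp.2 (by linarith)
          rw [abs_of_nonneg (by linarith), abs_of_nonpos (by linarith)]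
          have h2 := Real.add_one_le_exp (-(b - a))
          have h3 : Real.exp (-b) = Real.exp (-a) * Real.exp (-(b - a)) := by
            rw [← Real.exp_add]
            ring_nf
          have h4 : Real.exp (-a) ≤ 1 := Real.exp_le_one_iff.2 (by linarith)
          have h5 := Real.exp_pos (-a)
          rw [h3]
          nlinarith
        intro a b ha hb
        rcases le_total a b with h | h
        · exact hle a b ha h
        · rw [abs_sub_comm, abs_sub_comm a b]
          exact hle b a hb h
      refine (hlip _ _ (by have := hV0 ω; positivity) (by positivity)).trans (le_of_eq ?_)
      have h1 : u ^ 2 * V ω / 2 - s ^ 2 / 2 = s ^ 2 / (2 * B) * (V ω - B) := by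
        rw [hu2]
        field_simp
      rw [h1, abs_mul, abs_of_nonneg (by positivity)]
    have hb : IsBdd fun ω => s ^ 2 / (2 * B) * |V ω - B| := by
      obtain ⟨K, hK⟩ := hVb.sub (IsBdd.const B)
      exact (IsBdd.const _).mul ⟨K, fun ω => by simpa using hK ω⟩
    refine (norm_integral_le_of_norm_le (hb.integrable μ) (ae_of_all _ hpt)).trans ?_
    rw [integral_const_mul]
    refine (mul_le_mul_of_nonneg_left hdev (by positivity)).trans (le_of_eq ?_)
    have h3 : s ^ 2 / (2 * B) = s ^ 2 / (2 * (√B * √B)) := by rw [hBB]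
    rw [h3]
    field_simp
  have hsplit : ∫ ω, Complex.exp (((s * (centeredSum r ω.1 ω.2.1 ω.2.2 / √B) : ℝ) : ℂ)
          * Complex.I) ∂μ - Complex.exp ((-(s ^ 2 / 2) : ℝ) : ℂ)
      = ∫ ω, (G ω - H ω) ∂μ + ∫ ω, (H ω - Complex.exp ((-(s ^ 2 / 2) : ℝ) : ℂ)) ∂μ := by
    rw [integral_sub (hint hGn) (hint hHn), integral_sub (hint hHn) (integrable_const _)]
    have h1 : ∀ ω : Sample n ι, s * (centeredSum r ω.1 ω.2.1 ω.2.2 / √B)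
        = u * centeredSum r ω.1 ω.2.1 ω.2.2 := fun ω => by rw [hu]; ring
    simp only [h1, integral_const, probReal_univ, one_smul, hGdef]
    ring
  rw [hsplit]
  refine (norm_add_le _ _).trans ((add_le_add hstep1 hstep2).trans (le_of_eq ?_))
  have h4 : |u| = |s| / √B := by rw [hu, abs_div, abs_of_pos hB2]
  rw [h4, add_div]
  congr 1
  have h5 : 2 * (|s| / √B) ^ 3 * B = 2 * (|s| / √B) ^ 3 * (√B * √B) := by rw [hBB]
  rw [h5]
  field_simp

end Law

end CMH

namespace CMH

/-! ### The chi-square quantile -/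

instance : NullSingletonClass (gaussianReal 0 1) :=
  nullSingletonClass_gaussianReal one_ne_zero

theorem gaussian_sq_eq_null (q : ℝ) : gaussianReal 0 1 {x : ℝ | x ^ 2 = q} = 0 := by
  refine measure_mono_null (t := {√q, -√q}) (fun x hx => ?_) (Set.Finite.measure_zero (by simp) _)
  have hx : x ^ 2 = q := hx
  rw [← hx, Real.sqrt_sq_eq_abs]
  rcases abs_choice x with h | h <;> simp [h]

theorem chiSqOne_apply {s : Set ℝ} (hs : MeasurableSet s) :
    chiSqOne s = gaussianReal 0 1 {x | x ^ 2 ∈ s} :=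
  Measure.map_apply (by fun_prop) hs

instance : IsProbabilityMeasure chiSqOne :=
  Measure.isProbabilityMeasure_map (by fun_prop)

theorem measurableSet_lt_ofReal (q : ℝ≥0∞) : MeasurableSet {x : ℝ | q < ENNReal.ofReal x} :=
  measurableSet_lt measurable_const ENNReal.measurable_ofReal

theorem chiSqOne_ofReal_eq_null {q : ℝ≥0∞} : chiSqOne {x : ℝ | q = ENNReal.ofReal x} = 0 := by
  rw [chiSqOne_apply (measurableSet_eq_fun measurable_const ENNReal.measurable_ofReal)]
  refine measure_mono_null (fun x hx => ?_) (gaussian_sq_eq_null q.toReal)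
  have hx : q = ENNReal.ofReal (x ^ 2) := hx
  simp [hx, ENNReal.toReal_ofReal (sq_nonneg x)]

/-- The infimum is approached from above by levels whose tail is at most α and, when positive, from
below by levels whose tail exceeds α. The two one-sided limits of the tail agree because the law has
no atoms. -/
theorem chiSqOne_upperQuantile {α : ℝ} (hα : α ∈ Set.Icc (0 : ℝ) 1) :
    chiSqOne {x : ℝ | chiSqUpperQuantile α < ENNReal.ofReal x} = ENNReal.ofReal α := by
  set s := {q : ℝ≥0∞ | chiSqOne {x : ℝ | q < ENNReal.ofReal x} ≤ ENNReal.ofReal α} with hs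
  have hq : chiSqUpperQuantile α = sInf s := rfl
  refine le_antisymm ?_ ?_
  · have hne : s.Nonempty := ⟨⊤, by simp [hs]⟩
    obtain ⟨u, hu, hut, hus⟩ := exists_seq_tendsto_sInf hne (OrderBot.bddBelow s)
    have hU : {x : ℝ | chiSqUpperQuantile α < ENNReal.ofReal x}
        = ⋃ k, {x : ℝ | u k < ENNReal.ofReal x} := by
      ext x
      simp only [Set.mem_ofPred_eq, Set.mem_iUnion]
      refine ⟨fun h => ((tendsto_order.1 hut).2 _ (hq ▸ h)).exists, fun ⟨k, hk⟩ => ?_⟩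
      rw [hq]
      exact (sInf_le (hus k)).trans_lt hk
    rw [hU]
    have hmono : Monotone fun k => {x : ℝ | u k < ENNReal.ofReal x} :=
      fun i j hij x hx => (hu hij).trans_lt hx
    exact le_of_tendsto' (tendsto_measure_iUnion_atTop hmono) fun k => hus k
  · rcases eq_or_ne (chiSqUpperQuantile α) 0 with h0 | h0
    -- At quantile 0 no lower level is available, but the tail beyond 0 has full mass, hence at
    -- least α.
    · have hc : chiSqOne {x : ℝ | 0 < ENNReal.ofReal x}ᶜ = 0 :=
        measure_mono_null (fun x hx => by
          have hx : ¬ 0 < ENNReal.ofReal x := hx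
          exact (nonpos_iff_eq_zero.1 (not_lt.1 hx)).symm) (chiSqOne_ofReal_eq_null (q := 0))
      rw [h0, (prob_compl_eq_zero_iff (measurableSet_lt_ofReal 0)).1 hc]
      exact ENNReal.ofReal_le_one.2 hα.2
    · obtain ⟨v, hv, hvq, hvt⟩ := exists_seq_strictMono_tendsto' (pos_iff_ne_zero.2 h0)
      have hI : {x : ℝ | chiSqUpperQuantile α ≤ ENNReal.ofReal x}
          = ⋂ k, {x : ℝ | v k < ENNReal.ofReal x} := by
        ext x
        simp only [Set.mem_ofPred_eq, Set.mem_iInter]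
        exact ⟨fun h k => (hvq k).2.trans_le h, fun h => le_of_tendsto' hvt fun k => (h k).le⟩
      have hanti : Antitone fun k => {x : ℝ | v k < ENNReal.ofReal x} :=
        fun i j hij x hx => (hv.monotone hij).trans_lt hx
      have h1 : ENNReal.ofReal α ≤ chiSqOne {x : ℝ | chiSqUpperQuantile α ≤ ENNReal.ofReal x} := by
        rw [hI]
        refine ge_of_tendsto' (tendsto_measure_iInter_atTop
          (fun k => (measurableSet_lt_ofReal _).nullMeasurableSet) hanti
          ⟨0, measure_ne_top _ _⟩) fun k => ?_
        by_contra hlt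
        have hk : v k ∈ s := (not_le.1 hlt).le
        exact absurd (sInf_le hk) (not_le.2 (hq ▸ (hvq k).2))
      have h2 : {x : ℝ | chiSqUpperQuantile α ≤ ENNReal.ofReal x}
          ⊆ {x : ℝ | chiSqUpperQuantile α < ENNReal.ofReal x}
            ∪ {x : ℝ | chiSqUpperQuantile α = ENNReal.ofReal x} := by
        intro x hx
        have hx : chiSqUpperQuantile α ≤ ENNReal.ofReal x := hx
        exact lt_or_eq_of_le hx
      refine h1.trans ((measure_mono h2).trans ((measure_union_le _ _).trans_eq ?_))
      rw [chiSqOne_ofReal_eq_null, add_zero]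

/-! ### Convergence of the test in the model -/

theorem continuousAt_gaussian_sq_tail (q : ℝ) :
    ContinuousAt (fun q : ℝ => (gaussianReal 0 1).real {x : ℝ | q < x ^ 2}) q := by
  have h : ∀ q : ℝ, (gaussianReal 0 1).real {x : ℝ | q < x ^ 2}
      = ∫ x, Set.indicator {x : ℝ | q < x ^ 2} (fun _ => (1 : ℝ)) x ∂(gaussianReal 0 1) := by
    intro q
    rw [integral_indicator_const _ (measurableSet_lt measurable_const (by fun_prop))]
    simp
  simp_rw [h]
  refine tendsto_integral_filter_of_dominated_convergence (fun _ => 1)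
    (Eventually.of_forall fun q => ?_) (Eventually.of_forall fun q => ae_of_all _ fun x => ?_)
    (integrable_const _) ?_
  · exact (measurable_const.indicator
      (measurableSet_lt measurable_const (by fun_prop))).aestronglyMeasurable
  · refine (norm_indicator_le_norm_self _ _).trans (by simp)
  · have hae : ∀ᵐ x ∂(gaussianReal 0 1), x ^ 2 ≠ q := by
      rw [ae_iff]
      simpa using gaussian_sq_eq_null q
    filter_upwards [hae] with x hx
    refine tendsto_const_nhds.congr' ?_
    rcases lt_or_gt_of_ne hx with h | h
    · filter_upwards [eventually_gt_nhds h] with q' hq'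
      rw [Set.indicator_of_notMem, Set.indicator_of_notMem]
      · exact not_lt.2 hq'.le
      · exact not_lt.2 h.le
    · filter_upwards [eventually_lt_nhds h] with q' hq'
      rw [Set.indicator_of_mem, Set.indicator_of_mem]
      · exact hq'
      · exact h

section

variable {ι : ℕ → Type} [∀ n, Countable (ι n)] [∀ n, MeasurableSpace (ι n)]
  [∀ n, MeasurableSingletonClass (ι n)] (ν : ∀ n, Measure (ι n)) [∀ n, IsProbabilityMeasure (ν n)]
  (p r : ∀ n, ι n → unitInterval)

/-- Convergence of characteristic functions gives weak convergence to the standard normal law; the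
boundary of the tail event is contained in the null set x² = q. -/
theorem tendsto_modelLaw_sq_tail
    (hB : Tendsto (fun n => meanVar (p n) (r n) (ν n) n) atTop atTop) (q : ℝ) :
    Tendsto (fun n => (modelLaw (ν n) (p n) (r n) n).real
      {ω | q < (centeredSum (r n) ω.1 ω.2.1 ω.2.2 / √(meanVar (p n) (r n) (ν n) n)) ^ 2}) atTop
      (𝓝 ((gaussianReal 0 1).real {x : ℝ | q < x ^ 2})) := by
  set Z : ∀ n, Sample n (ι n) → ℝ := fun n ω =>
    centeredSum (r n) ω.1 ω.2.1 ω.2.2 / √(meanVar (p n) (r n) (ν n) n) with hZ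
  have hZm : ∀ n, Measurable (Z n) := fun n => Measurable.of_discrete
  set L : ℕ → ProbabilityMeasure ℝ := fun n =>
    ⟨(modelLaw (ν n) (p n) (r n) n).map (Z n),
      Measure.isProbabilityMeasure_map (hZm n).aemeasurable⟩ with hL
  have hsqrt : Tendsto (fun n => √(meanVar (p n) (r n) (ν n) n)) atTop atTop :=
    Real.tendsto_sqrt_atTop.comp hB
  have hconv : Tendsto L atTop (𝓝 (⟨gaussianReal 0 1, inferInstance⟩ : ProbabilityMeasure ℝ)) := by
    refine ProbabilityMeasure.tendsto_of_tendsto_charFun fun s => ?_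
    have h1 : ∀ n, charFun (L n : Measure ℝ) s = ∫ ω, Complex.exp (((s * Z n ω : ℝ) : ℂ)
        * Complex.I) ∂(modelLaw (ν n) (p n) (r n) n) := by
      intro n
      simp only [hL, ProbabilityMeasure.coe_mk]
      rw [charFun_apply_real, integral_map (hZm n).aemeasurable (by fun_prop)]
      simp
    have h2 : charFun (gaussianReal 0 1) s = Complex.exp ((-(s ^ 2 / 2) : ℝ) : ℂ) := by
      rw [charFun_gaussianReal]
      congr 1
      push_cast
      ring
    simp only [ProbabilityMeasure.coe_mk, h2]
    rw [tendsto_iff_norm_sub_tendsto_zero]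
    have h3 : Tendsto (fun n => (2 * |s| ^ 3 + s ^ 2) / √(meanVar (p n) (r n) (ν n) n))
        atTop (𝓝 0) := tendsto_const_nhds.div_atTop hsqrt
    refine squeeze_zero' (Eventually.of_forall fun _ => norm_nonneg _) ?_ h3
    filter_upwards [hB.eventually_gt_atTop 0, hsqrt.eventually_ge_atTop |s|] with n hn hn2
    rw [h1]
    exact norm_integral_exp_sub_le (ν n) (p n) (r n) s hn hn2
  have hopen : IsOpen {x : ℝ | q < x ^ 2} := isOpen_lt continuous_const (by fun_prop)
  have hfr : gaussianReal 0 1 (frontier {x : ℝ | q < x ^ 2}) = 0 := by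
    refine measure_mono_null (fun x hx => ?_) (gaussian_sq_eq_null q)
    exact (frontier_lt_subset_eq continuous_const (by fun_prop) hx).symm
  have h := ProbabilityMeasure.tendsto_measure_of_null_frontier_of_tendsto' hconv hfr
  have h2 := (ENNReal.tendsto_toReal
    (measure_ne_top (gaussianReal 0 1) {x : ℝ | q < x ^ 2})).comp h
  refine h2.congr fun n => ?_
  simp only [Function.comp_apply, hL, ProbabilityMeasure.coe_mk]
  rw [Measure.map_apply (hZm n) hopen.measurableSet]
  rfl

open Classical in
/-- The test in terms of the strata and the two coordinates. -/
noncomputable def sampleTest {n : ℕ} {κ : Type*} (α : ℝ) (r : κ → unitInterval)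
    (ω : Sample n κ) : ℝ :=
  if chiSqUpperQuantile α
    < ENNReal.ofReal ((centeredSum r ω.1 ω.2.1 ω.2.2 / √(sumVar ω.1 ω.2.1 ω.2.2)) ^ 2)
  then 1 else 0

theorem modelLaw_sumVar_deviation_le {n : ℕ} {η : ℝ} (hη : 0 < η)
    (hB : 0 < meanVar (p n) (r n) (ν n) n) :
    (modelLaw (ν n) (p n) (r n) n).real {ω | η * meanVar (p n) (r n) (ν n) n
        ≤ |sumVar ω.1 ω.2.1 ω.2.2 - meanVar (p n) (r n) (ν n) n|}
      ≤ 5 / η ^ 2 / meanVar (p n) (r n) (ν n) n := by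
  have h := integral_modelLaw_sumVar_sub_sq_le (n := n) (ν n) (p n) (r n)
  set B := meanVar (p n) (r n) (ν n) n
  have hb : IsBdd fun ω : Sample n (ι n) => (sumVar ω.1 ω.2.1 ω.2.2 - B) ^ 2 :=
    (isBdd_sumVar.sub (IsBdd.const B)).sq
  have h1 := mul_meas_ge_le_integral_of_nonneg (μ := modelLaw (ν n) (p n) (r n) n)
    (ae_of_all _ fun ω => sq_nonneg _) (hb.integrable _) ((η * B) ^ 2)
  have h2 : {ω : Sample n (ι n) | η * B ≤ |sumVar ω.1 ω.2.1 ω.2.2 - B|}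
      ⊆ {ω | (η * B) ^ 2 ≤ (sumVar ω.1 ω.2.1 ω.2.2 - B) ^ 2} := fun ω hω => by
    have hω : η * B ≤ |sumVar ω.1 ω.2.1 ω.2.2 - B| := hω
    show (η * B) ^ 2 ≤ (sumVar ω.1 ω.2.1 ω.2.2 - B) ^ 2
    rw [← sq_abs (sumVar ω.1 ω.2.1 ω.2.2 - B)]
    exact pow_le_pow_left₀ (by positivity) hω 2
  have h3 := measureReal_mono (μ := modelLaw (ν n) (p n) (r n) n) h2
  rw [div_div, le_div_iff₀ (by positivity)]
  have h4 : (η * B) ^ 2 * (modelLaw (ν n) (p n) (r n) n).real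
      {ω | η * B ≤ |sumVar ω.1 ω.2.1 ω.2.2 - B|} ≤ 5 * B :=
    (mul_le_mul_of_nonneg_left h3 (sq_nonneg _)).trans (h1.trans h)
  nlinarith

/-- Slutsky's argument by hand. Off a Chebyshev event of small probability, `sumVar` lies within a
factor 1 ± η of B, so the rejection event is sandwiched between tail events of `centeredSum` / √B at
the levels q(1 + η) and q(1 - η). Continuity of the Gaussian tail then closes the gap. -/
theorem tendsto_integral_sampleTest
    (hB : Tendsto (fun n => meanVar (p n) (r n) (ν n) n) atTop atTop) {α : ℝ}
    (hα : α ∈ Set.Icc (0 : ℝ) 1) :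
    Tendsto (fun n => ∫ ω, sampleTest α (r n) ω ∂(modelLaw (ν n) (p n) (r n) n)) atTop (𝓝 α) := by
  have hquant := chiSqOne_upperQuantile hα
  -- An infinite quantile forces α = 0, and the test never rejects; otherwise the comparison can be
  -- made in ℝ.
  rcases eq_or_ne (chiSqUpperQuantile α) ⊤ with htop | htop
  · rw [htop] at hquant
    have hα0 : α = 0 := by
      simp only [not_top_lt, Set.ofPred_false, measure_empty] at hquant
      exact le_antisymm (ENNReal.ofReal_eq_zero.1 hquant.symm) hα.1
    have h0 : ∀ n, ∀ ω : Sample n (ι n), sampleTest α (r n) ω = 0 := fun n ω => by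
      simp [sampleTest, htop]
    simp only [h0, integral_zero]
    rw [hα0]
    exact tendsto_const_nhds
  set q : ℝ := (chiSqUpperQuantile α).toReal with hq
  have hq0 : 0 ≤ q := ENNReal.toReal_nonneg
  have hlt : ∀ x : ℝ, 0 ≤ x → (chiSqUpperQuantile α < ENNReal.ofReal x ↔ q < x) := fun x hx => by
    rw [← ENNReal.toReal_lt_toReal htop ENNReal.ofReal_ne_top, ENNReal.toReal_ofReal hx]
  have hgauss : (gaussianReal 0 1).real {x : ℝ | q < x ^ 2} = α := by
    rw [chiSqOne_apply (measurableSet_lt_ofReal _)] at hquant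
    have : {x : ℝ | q < x ^ 2}
        = {x : ℝ | x ^ 2 ∈ {x : ℝ | chiSqUpperQuantile α < ENNReal.ofReal x}} := by
      ext x
      exact (hlt _ (sq_nonneg x)).symm
    rw [measureReal_def, this, hquant, ENNReal.toReal_ofReal hα.1]
  set A : ∀ n, Set (Sample n (ι n)) := fun n =>
    {ω | q < (centeredSum (r n) ω.1 ω.2.1 ω.2.2 / √(sumVar ω.1 ω.2.1 ω.2.2)) ^ 2} with hA
  have htest : ∀ n, ∫ ω, sampleTest α (r n) ω ∂(modelLaw (ν n) (p n) (r n) n)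
      = (modelLaw (ν n) (p n) (r n) n).real (A n) := by
    intro n
    have : ∀ ω, sampleTest α (r n) ω = (A n).indicator (fun _ => (1 : ℝ)) ω := by
      intro ω
      classical
      simp only [sampleTest, hA, Set.indicator, Set.mem_ofPred_eq]
      exact if_congr (hlt _ (sq_nonneg _)) rfl rfl
    simp_rw [this]
    rw [integral_indicator_const _ (Set.to_countable _).measurableSet]
    simp
  simp_rw [htest]
  rw [Metric.tendsto_atTop']
  intro ε hε
  set T : ℝ → ℝ := fun q => (gaussianReal 0 1).real {x : ℝ | q < x ^ 2} with hT
  obtain ⟨δ, hδ, hδT⟩ := Metric.continuousAt_iff.1 (continuousAt_gaussian_sq_tail q) (ε / 4)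
    (by positivity)
  -- The second bound gives q η < δ, also when q = 0; the bound 1/2 keeps `sumVar` positive off the
  -- bad event.
  set η : ℝ := min (1 / 2) (δ / (2 * (q + 1))) with hη
  have hη0 : 0 < η := lt_min (by norm_num) (by positivity)
  have hη1 : η ≤ 1 / 2 := min_le_left _ _
  have hηq : q * η < δ := by
    have h1 : η ≤ δ / (2 * (q + 1)) := min_le_right _ _
    rw [le_div_iff₀ (by positivity)] at h1
    nlinarith
  have hup : |T (q * (1 + η)) - T q| < ε / 4 := hδT (by
    rw [Real.dist_eq, show q * (1 + η) - q = q * η by ring, abs_of_nonneg (by positivity)]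
    exact hηq)
  have hdown : |T (q * (1 - η)) - T q| < ε / 4 := hδT (by
    rw [Real.dist_eq, show q * (1 - η) - q = -(q * η) by ring, abs_neg,
      abs_of_nonneg (by positivity)]
    exact hηq)
  have hlimu := tendsto_modelLaw_sq_tail ν p r hB (q * (1 + η))
  have hlimd := tendsto_modelLaw_sq_tail ν p r hB (q * (1 - η))
  have hbad : Tendsto (fun n => 5 / η ^ 2 / meanVar (p n) (r n) (ν n) n) atTop (𝓝 0) :=
    tendsto_const_nhds.div_atTop hB
  have hev : ∀ᶠ n in atTop, dist ((modelLaw (ν n) (p n) (r n) n).real (A n)) α < ε := by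
    filter_upwards [hB.eventually_gt_atTop 0, Metric.tendsto_nhds.1 hlimu (ε / 4) (by positivity),
      Metric.tendsto_nhds.1 hlimd (ε / 4) (by positivity),
      Metric.tendsto_nhds.1 hbad (ε / 4) (by positivity)] with n hn h1 h2 h3
    have hdev := modelLaw_sumVar_deviation_le ν p r hη0 hn
    set B := meanVar (p n) (r n) (ν n) n
    set μ := modelLaw (ν n) (p n) (r n) n
    set bad : Set (Sample n (ι n)) := {ω | η * B ≤ |sumVar ω.1 ω.2.1 ω.2.2 - B|} with hbadset
    have hgood : ∀ ω ∉ bad, 0 < sumVar ω.1 ω.2.1 ω.2.2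
        ∧ sumVar ω.1 ω.2.1 ω.2.2 ≤ (1 + η) * B ∧ (1 - η) * B ≤ sumVar ω.1 ω.2.1 ω.2.2 := by
      intro ω hω
      have hω : |sumVar ω.1 ω.2.1 ω.2.2 - B| < η * B := not_le.1 hω
      rw [abs_lt] at hω
      refine ⟨?_, ?_, ?_⟩ <;> nlinarith
    have hsub1 : {ω : Sample n (ι n) | q * (1 + η) < (centeredSum (r n) ω.1 ω.2.1 ω.2.2 / √B) ^ 2}
        ⊆ A n ∪ bad := by
      intro ω hω
      by_cases hb : ω ∈ bad
      · exact Or.inr hb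
      · left
        obtain ⟨hF, hF1, hF2⟩ := hgood ω hb
        have hω : q * (1 + η) < (centeredSum (r n) ω.1 ω.2.1 ω.2.2 / √B) ^ 2 := hω
        show q < (centeredSum (r n) ω.1 ω.2.1 ω.2.2 / √(sumVar ω.1 ω.2.1 ω.2.2)) ^ 2
        rw [div_pow, Real.sq_sqrt hn.le, lt_div_iff₀ hn] at hω
        rw [div_pow, Real.sq_sqrt hF.le, lt_div_iff₀ hF]
        nlinarith
    have hsub2 : A n ⊆ {ω : Sample n (ι n) |
        q * (1 - η) < (centeredSum (r n) ω.1 ω.2.1 ω.2.2 / √B) ^ 2} ∪ bad := by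
      intro ω hω
      by_cases hb : ω ∈ bad
      · exact Or.inr hb
      · left
        obtain ⟨hF, hF1, hF2⟩ := hgood ω hb
        have hω : q < (centeredSum (r n) ω.1 ω.2.1 ω.2.2 / √(sumVar ω.1 ω.2.1 ω.2.2)) ^ 2 := hω
        show q * (1 - η) < (centeredSum (r n) ω.1 ω.2.1 ω.2.2 / √B) ^ 2
        rw [div_pow, Real.sq_sqrt hF.le, lt_div_iff₀ hF] at hω
        rw [div_pow, Real.sq_sqrt hn.le, lt_div_iff₀ hn]
        nlinarith
    have hm1 := (measureReal_mono (μ := μ) hsub1).trans (measureReal_union_le _ _)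
    have hm2 := (measureReal_mono (μ := μ) hsub2).trans (measureReal_union_le _ _)
    rw [Real.dist_eq, abs_lt] at h1 h2 h3
    rw [abs_lt] at hup hdown
    have hTq : T q = α := hgauss
    rw [hTq] at hup hdown
    simp only [hT] at hup hdown
    rw [Real.dist_eq, abs_lt]
    constructor <;> linarith [h1.1, h1.2, h2.1, h2.2, h3.1, h3.2, hup.1, hup.2, hdown.1, hdown.2]
  obtain ⟨N, hN⟩ := eventually_atTop.1 hev
  exact ⟨N, fun n hn => hN n hn.le⟩

end

end CMH

namespace CMH

/-! ### Comparison of a law with its conditionally independent version -/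

/-- The mass function of a Bernoulli law. -/
noncomputable def bw (p : unitInterval) (a : Fin 2) : ℝ := if a = 0 then p else 1 - p

/-- The sign of a label. -/
noncomputable def sgn (a : Fin 2) : ℝ := if a = 0 then 1 else -1

theorem bw_nonneg (p : unitInterval) (a : Fin 2) : 0 ≤ bw p a := by
  unfold bw
  split_ifs
  · exact p.2.1
  · exact sub_nonneg.2 p.2.2

/-- The conditional cell probabilities with marginals `p`, `r` and covariance `δ`. -/
noncomputable def cellWeight (p r : unitInterval) (δ : ℝ) (a b : Fin 2) : ℝ :=
  bw p a * bw r b + sgn a * sgn b * δ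

/-- The density of the cell probabilities with respect to the product of the marginals. -/
noncomputable def cellDensity (p r : unitInterval) (δ : ℝ) (a b : Fin 2) : ℝ :=
  1 + sgn a * sgn b * δ / (bw p a * bw r b)

section Cell

variable {p r : unitInterval} {δ ε : ℝ}

/-- The only obstruction is a vanishing marginal mass, where the quotient in the density is 0 by
convention; the hypothesis then forces δ = 0. -/
theorem bw_mul_bw_mul_cellDensity (h : δ ^ 2 ≤ ε * (bvar p * bvar r)) (a b : Fin 2) :
    bw p a * bw r b * cellDensity p r δ a b = cellWeight p r δ a b := by
  by_cases h0 : bw p a * bw r b = 0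
  · have hprod : bvar p * bvar r = 0 := by
      rcases mul_eq_zero.1 h0 with h1 | h1
      · have : bvar p = 0 := by
          fin_cases a <;> simp [bw] at h1 <;> simp [bvar, h1]
        simp [this]
      · have : bvar r = 0 := by
          fin_cases b <;> simp [bw] at h1 <;> simp [bvar, h1]
        simp [this]
    have hδ : δ = 0 := by
      rw [hprod, mul_zero] at h
      exact pow_eq_zero_iff two_ne_zero |>.1 (le_antisymm h (sq_nonneg _))
    simp [cellWeight, cellDensity, hδ]
  · unfold cellWeight cellDensity
    generalize bw p a * bw r b = z at h0
    field_simp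

theorem sum_cellWeight : ∑ a, ∑ b, cellWeight p r δ a b = 1 := by
  simp [Fin.sum_univ_two, cellWeight, bw, sgn]
  ring

theorem sum_bw_mul_bw : ∑ a, ∑ b, bw p a * bw r b = 1 := by
  simp [Fin.sum_univ_two, bw]
  ring

/-- With nondegenerate margins the sum is exactly 1 + δ² / (`bvar p` * `bvar r`), that is, one plus
the chi-square divergence. -/
theorem sum_bw_mul_cellDensity_sq_le (hε : 0 ≤ ε) (h : δ ^ 2 ≤ ε * (bvar p * bvar r)) :
    ∑ a, ∑ b, bw p a * bw r b * cellDensity p r δ a b ^ 2 ≤ 1 + ε := by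
  by_cases h0 : bvar p * bvar r = 0
  · have hδ : δ = 0 := by
      rw [h0, mul_zero] at h
      exact pow_eq_zero_iff two_ne_zero |>.1 (le_antisymm h (sq_nonneg _))
    have : ∀ a b, bw p a * bw r b * cellDensity p r δ a b ^ 2 = bw p a * bw r b := fun a b => by
      simp [cellDensity, hδ]
    simp only [this, sum_bw_mul_bw]
    linarith
  · have hpos : 0 < bvar p * bvar r :=
      lt_of_le_of_ne (mul_nonneg (bvar_nonneg _) (bvar_nonneg _)) (Ne.symm h0)
    have h1 : (p : ℝ) ≠ 0 := fun h => h0 (by simp [bvar, h])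
    have h2 : (1 - p : ℝ) ≠ 0 := fun h => h0 (by simp [bvar, h])
    have h3 : (r : ℝ) ≠ 0 := fun h => h0 (by simp [bvar, h])
    have h4 : (1 - r : ℝ) ≠ 0 := fun h => h0 (by simp [bvar, h])
    have key : ∑ a, ∑ b, bw p a * bw r b * cellDensity p r δ a b ^ 2
        = 1 + δ ^ 2 / (bvar p * bvar r) := by
      simp only [Fin.sum_univ_two, bw, sgn, cellDensity, bvar, if_true, one_ne_zero, if_false]
      field_simp
      ring
    rw [key]
    have : δ ^ 2 / (bvar p * bvar r) ≤ ε := by rwa [div_le_iff₀ hpos]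
    linarith

end Cell

/-! ### Tensorised chi-square bound and change of measure -/

theorem sum_sum_prod {n : ℕ} (f : Fin n → Fin 2 → Fin 2 → ℝ) :
    ∑ x : Fin n → Fin 2, ∑ y : Fin n → Fin 2, ∏ i, f i (x i) (y i) = ∏ i, ∑ a, ∑ b, f i a b := by
  have h1 : ∀ g : Fin n → Fin 2 → ℝ, ∑ x : Fin n → Fin 2, ∏ i, g i (x i) = ∏ i, ∑ a, g i a := by
    intro g
    rw [Finset.prod_univ_sum, Fintype.piFinset_univ]
  rw [← h1 fun i a => ∑ b, f i a b]
  exact Finset.sum_congr rfl fun x _ => h1 fun i b => f i (x i) b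

theorem integral_bernPi {n : ℕ} (p : Fin n → unitInterval) (f : (Fin n → Fin 2) → ℝ) :
    ∫ x, f x ∂(bernPi p) = ∑ x, (∏ i, bw (p i) (x i)) * f x := by
  rw [integral_fintype ((IsBdd.of_finite f).integrable _)]
  refine Finset.sum_congr rfl fun x _ => ?_
  rw [smul_eq_mul, measureReal_def, bernPi, Measure.pi_singleton, ENNReal.toReal_prod]
  congr 1
  refine Finset.prod_congr rfl fun i _ => ?_
  have h2 : (bernoulliMeasure (0 : Fin 2) 1 (p i)).real {x i} = bw (p i) (x i) := by
    generalize x i = a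
    have h3 : (bernoulliMeasure (0 : Fin 2) 1 (p i)).real {a}
        = ∫ b, Set.indicator {a} (fun _ => (1 : ℝ)) b ∂(bernoulliMeasure (0 : Fin 2) 1 (p i)) := by
      rw [integral_indicator_const _ (measurableSet_singleton a)]
      simp
    rw [h3, integral_bernoulliMeasure]
    fin_cases a <;> simp [bw]
  exact h2

/-- With likelihood ratio R, E[RG] = E[G] + E[(R - 1)G], and (R - 1)G ≤ θG²/2 + (R - 1)²/(2θ). The
second moment of R is a product over the observations, so E(R - 1)² ≤ (1 + ε)^n - 1. Young's
inequality, unlike Cauchy-Schwarz, keeps the bound linear in the expectations, so that it can be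
integrated over the strata. -/
theorem sum_cellWeight_mul_le {n : ℕ} {p r : Fin n → unitInterval} {δ : Fin n → ℝ} {ε θ : ℝ}
    (hε : 0 ≤ ε) (hδ : ∀ i, δ i ^ 2 ≤ ε * (bvar (p i) * bvar (r i))) (hθ : 0 < θ)
    (G : (Fin n → Fin 2) → (Fin n → Fin 2) → ℝ) :
    ∑ x, ∑ y, (∏ i, cellWeight (p i) (r i) (δ i) (x i) (y i)) * G x y
      ≤ ∫ x, ∫ y, (G x y + θ / 2 * G x y ^ 2) ∂(bernPi r) ∂(bernPi p)
        + ((1 + ε) ^ n - 1) / (2 * θ) := by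
  set q : (Fin n → Fin 2) → (Fin n → Fin 2) → ℝ := fun x y =>
    ∏ i, bw (p i) (x i) * bw (r i) (y i) with hq
  set R : (Fin n → Fin 2) → (Fin n → Fin 2) → ℝ := fun x y =>
    ∏ i, cellDensity (p i) (r i) (δ i) (x i) (y i) with hR
  have hq0 : ∀ x y, 0 ≤ q x y := fun x y =>
    Finset.prod_nonneg fun i _ => mul_nonneg (bw_nonneg _ _) (bw_nonneg _ _)
  have hqR : ∀ x y, q x y * R x y = ∏ i, cellWeight (p i) (r i) (δ i) (x i) (y i) := by
    intro x y
    simp only [hq, hR]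
    rw [← Finset.prod_mul_distrib]
    exact Finset.prod_congr rfl fun i _ => bw_mul_bw_mul_cellDensity (hδ i) _ _
  have hqsum : ∑ x, ∑ y, q x y = 1 := by
    simp only [hq]
    rw [sum_sum_prod fun i a b => bw (p i) a * bw (r i) b]
    exact Finset.prod_eq_one fun i _ => sum_bw_mul_bw
  have hqRsum : ∑ x, ∑ y, q x y * R x y = 1 := by
    simp only [hqR]
    rw [sum_sum_prod fun i a b => cellWeight (p i) (r i) (δ i) a b]
    exact Finset.prod_eq_one fun i _ => sum_cellWeight
  have hqR2 : ∑ x, ∑ y, q x y * R x y ^ 2 ≤ (1 + ε) ^ n := by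
    simp only [hq, hR, ← Finset.prod_pow, ← Finset.prod_mul_distrib]
    rw [sum_sum_prod fun i a b => bw (p i) a * bw (r i) b * cellDensity (p i) (r i) (δ i) a b ^ 2]
    refine (Finset.prod_le_prod (g := fun _ => 1 + ε) (fun i _ => Finset.sum_nonneg fun a _ =>
      Finset.sum_nonneg fun b _ => ?_) fun i _ =>
      sum_bw_mul_cellDensity_sq_le hε (hδ i)).trans_eq (by simp)
    exact mul_nonneg (mul_nonneg (bw_nonneg _ _) (bw_nonneg _ _)) (sq_nonneg _)
  have hint : ∫ x, ∫ y, (G x y + θ / 2 * G x y ^ 2) ∂(bernPi r) ∂(bernPi p)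
      = ∑ x, ∑ y, q x y * (G x y + θ / 2 * G x y ^ 2) := by
    rw [integral_bernPi]
    refine Finset.sum_congr rfl fun x _ => ?_
    rw [integral_bernPi, Finset.mul_sum]
    refine Finset.sum_congr rfl fun y _ => ?_
    simp only [hq]
    rw [Finset.prod_mul_distrib]
    ring
  have hchi : ∑ x, ∑ y, q x y * (R x y - 1) ^ 2 ≤ (1 + ε) ^ n - 1 := by
    have h1 : ∀ x y, q x y * (R x y - 1) ^ 2 = q x y * R x y ^ 2 - 2 * (q x y * R x y) + q x y :=
      fun x y => by ring
    simp only [h1, Finset.sum_add_distrib, Finset.sum_sub_distrib, ← Finset.mul_sum]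
    rw [hqRsum, hqsum]
    linarith
  have hpt : ∀ x y, q x y * R x y * G x y
      ≤ q x y * (G x y + θ / 2 * G x y ^ 2) + q x y * (R x y - 1) ^ 2 / (2 * θ) := by
    intro x y
    have h1 : (R x y - 1) * G x y ≤ θ / 2 * G x y ^ 2 + (R x y - 1) ^ 2 / (2 * θ) := by
      have h2 : θ / 2 * G x y ^ 2 + (R x y - 1) ^ 2 / (2 * θ) - (R x y - 1) * G x y
          = (θ * G x y - (R x y - 1)) ^ 2 / (2 * θ) := by
        field_simp
        ring
      have h3 : 0 ≤ (θ * G x y - (R x y - 1)) ^ 2 / (2 * θ) := by positivity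
      linarith
    have h4 := mul_le_mul_of_nonneg_left h1 (hq0 x y)
    calc q x y * R x y * G x y = q x y * G x y + q x y * ((R x y - 1) * G x y) := by ring
      _ ≤ q x y * G x y + q x y * (θ / 2 * G x y ^ 2 + (R x y - 1) ^ 2 / (2 * θ)) := by linarith
      _ = _ := by ring
  rw [hint]
  calc ∑ x, ∑ y, (∏ i, cellWeight (p i) (r i) (δ i) (x i) (y i)) * G x y
      = ∑ x, ∑ y, q x y * R x y * G x y := by simp only [hqR]
    _ ≤ ∑ x, ∑ y, (q x y * (G x y + θ / 2 * G x y ^ 2) + q x y * (R x y - 1) ^ 2 / (2 * θ)) :=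
        Finset.sum_le_sum fun x _ => Finset.sum_le_sum fun y _ => hpt x y
    _ = ∑ x, ∑ y, q x y * (G x y + θ / 2 * G x y ^ 2)
        + (∑ x, ∑ y, q x y * (R x y - 1) ^ 2) / (2 * θ) := by
        simp only [Finset.sum_add_distrib, Finset.sum_div]
    _ ≤ _ := by gcongr

section Transfer

variable {n : ℕ} {ι : Type*} [Countable ι] [MeasurableSpace ι] [MeasurableSingletonClass ι]
  {Ω : Type*} [MeasurableSpace Ω] (P : Measure Ω) [IsProbabilityMeasure P]
  {T : Ω → ι} {X Y : Ω → Fin 2} (hT : Measurable T) (hX : Measurable X) (hY : Measurable Y)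
  {p r : ι → unitInterval} {δ : ι → ℝ}
  (hJ0 : ∀ t a b, 0 ≤ cellWeight (p t) (r t) (δ t) a b)
  (hJ : ∀ t a b, P {w | T w = t ∧ X w = a ∧ Y w = b}
    = P.map T {t} * ENNReal.ofReal (cellWeight (p t) (r t) (δ t) a b))

/-- The strata and the coordinates of a sample. -/
def toSample (T : Ω → ι) (X Y : Ω → Fin 2) (w : Fin n → Ω) : Sample n ι :=
  (fun i => T (w i), fun i => X (w i), fun i => Y (w i))

include hT hX hY hJ0 hJ in
-- The sample space is countable, so the two laws need only be compared on points, where both masses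
-- factor over the observations.
theorem integral_toSample {G : Sample n ι → ℝ} (hG : IsBdd G) :
    ∫ w, G (toSample T X Y w) ∂(Measure.pi fun _ : Fin n => P)
      = ∫ τ, ∑ x, ∑ y, (∏ i, cellWeight (p (τ i)) (r (τ i)) (δ (τ i)) (x i) (y i)) * G (τ, x, y)
          ∂(Measure.pi fun _ : Fin n => P.map T) := by
  classical
  have hprobT : IsProbabilityMeasure (P.map T) := Measure.isProbabilityMeasure_map hT.aemeasurable
  set wt : (Fin n → ι) → (Fin n → Fin 2) × (Fin n → Fin 2) → ℝ := fun τ q =>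
    ∏ i, cellWeight (p (τ i)) (r (τ i)) (δ (τ i)) (q.1 i) (q.2 i) with hwt
  have hwt0 : ∀ τ q, 0 ≤ wt τ q := fun τ q => Finset.prod_nonneg fun i _ => hJ0 _ _ _
  have hwt1 : ∀ τ, ∑ q, wt τ q = 1 := by
    intro τ
    rw [Fintype.sum_prod_type]
    simp only [hwt]
    rw [sum_sum_prod fun i a b => cellWeight (p (τ i)) (r (τ i)) (δ (τ i)) a b]
    exact Finset.prod_eq_one fun i _ => sum_cellWeight
  set pmf : (Fin n → ι) → PMF ((Fin n → Fin 2) × (Fin n → Fin 2)) := fun τ =>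
    PMF.ofFintype (fun q => ENNReal.ofReal (wt τ q)) (by
      rw [← ENNReal.ofReal_sum_of_nonneg fun q _ => hwt0 τ q, hwt1, ENNReal.ofReal_one]) with hpmf
  set κ : Kernel (Fin n → ι) ((Fin n → Fin 2) × (Fin n → Fin 2)) :=
    ⟨fun τ => (pmf τ).toMeasure, Measurable.of_discrete⟩ with hκ
  have hκapp : ∀ τ, κ τ = (pmf τ).toMeasure := fun τ => rfl
  have hκm : IsMarkovKernel κ := ⟨fun τ => by rw [hκapp]; infer_instance⟩
  have hΨ : Measurable (toSample (n := n) T X Y) := by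
    unfold toSample
    fun_prop
  have hlaw : (Measure.pi fun _ : Fin n => P).map (toSample T X Y)
      = (Measure.pi fun _ : Fin n => P.map T) ⊗ₘ κ := by
    refine Measure.ext_of_singleton fun ω => ?_
    obtain ⟨τ, x, y⟩ := ω
    have hpre : toSample (n := n) T X Y ⁻¹' {(τ, x, y)}
        = Set.pi Set.univ fun i => {w | T w = τ i ∧ X w = x i ∧ Y w = y i} := by
      ext w
      simp only [Set.mem_preimage, Set.mem_singleton_iff, toSample, Prod.mk.injEq, funext_iff,
        Set.mem_pi, Set.mem_univ, true_imp_iff, Set.mem_ofPred_eq]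
      exact ⟨fun h i => ⟨h.1 i, h.2.1 i, h.2.2 i⟩,
        fun h => ⟨fun i => (h i).1, fun i => (h i).2.1, fun i => (h i).2.2⟩⟩
    rw [Measure.map_apply hΨ (measurableSet_singleton _), hpre, Measure.pi_pi,
      ← Set.singleton_prod_singleton, Measure.compProd_apply_prod (measurableSet_singleton _)
        (measurableSet_singleton _), lintegral_singleton, Measure.pi_singleton, hκapp,
      PMF.toMeasure_apply_singleton _ _ (measurableSet_singleton _)]
    simp only [hpmf, PMF.ofFintype_apply, hwt]
    rw [ENNReal.ofReal_prod_of_nonneg fun i _ => hJ0 _ _ _, ← Finset.prod_mul_distrib]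
    exact Finset.prod_congr rfl fun i _ => by rw [hJ, mul_comm]
  have h1 : ∫ w, G (toSample T X Y w) ∂(Measure.pi fun _ : Fin n => P)
      = ∫ ω, G ω ∂((Measure.pi fun _ : Fin n => P).map (toSample T X Y)) :=
    (integral_map hΨ.aemeasurable
      (Measurable.of_discrete (f := G)).aestronglyMeasurable).symm
  rw [h1, hlaw, Measure.integral_compProd (hG.integrable _)]
  refine integral_congr_ae (ae_of_all _ fun τ => ?_)
  simp only [hκapp]
  rw [PMF.integral_eq_sum, Fintype.sum_prod_type]
  refine Finset.sum_congr rfl fun x _ => Finset.sum_congr rfl fun y _ => ?_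
  simp only [hpmf, PMF.ofFintype_apply, smul_eq_mul, hwt]
  rw [ENNReal.toReal_ofReal (Finset.prod_nonneg fun i _ => hJ0 _ _ _)]

include hT hX hY hJ0 hJ in
/-- Expectations under a law close to conditional independence, bounded by expectations under
the model law with the same margins. -/
theorem integral_toSample_le {ε θ : ℝ} (hε : 0 ≤ ε) (hδ : ∀ t, δ t ^ 2 ≤ ε * bvarProd p r t)
    (hθ : 0 < θ) {G : Sample n ι → ℝ} (hG : IsBdd G) :
    ∫ w, G (toSample T X Y w) ∂(Measure.pi fun _ : Fin n => P)
      ≤ ∫ ω, (G ω + θ / 2 * G ω ^ 2) ∂(modelLaw (P.map T) p r n)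
        + ((1 + ε) ^ n - 1) / (2 * θ) := by
  have hprobT : IsProbabilityMeasure (P.map T) := Measure.isProbabilityMeasure_map hT.aemeasurable
  have hG2 : IsBdd fun ω => G ω + θ / 2 * G ω ^ 2 := hG.add ((IsBdd.const _).mul hG.sq)
  rw [integral_toSample P hT hX hY hJ0 hJ hG, integral_modelLaw_real _ p r hG2]
  set c := ((1 + ε) ^ n - 1) / (2 * θ) with hc
  have hpt : ∀ τ : Fin n → ι,
      ∑ x, ∑ y, (∏ i, cellWeight (p (τ i)) (r (τ i)) (δ (τ i)) (x i) (y i)) * G (τ, x, y)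
      ≤ ∫ x, ∫ y, (G (τ, x, y) + θ / 2 * G (τ, x, y) ^ 2) ∂(bernPi fun i => r (τ i))
          ∂(bernPi fun i => p (τ i)) + c := fun τ =>
    sum_cellWeight_mul_le (p := fun i => p (τ i)) (r := fun i => r (τ i)) (δ := fun i => δ (τ i))
      hε (fun i => hδ (τ i)) hθ fun x y => G (τ, x, y)
  have hb2 : IsBdd fun τ : Fin n → ι =>
      ∫ x, ∫ y, (G (τ, x, y) + θ / 2 * G (τ, x, y) ^ 2) ∂(bernPi fun i => r (τ i))
          ∂(bernPi fun i => p (τ i)) := by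
    refine IsBdd.integral (F := fun τ x => ∫ y, (G (τ, x, y) + θ / 2 * G (τ, x, y) ^ 2)
      ∂(bernPi fun i => r (τ i))) ?_ (fun τ : Fin n → ι => bernPi fun i => p (τ i))
    refine IsBdd.integral (α := (Fin n → ι) × (Fin n → Fin 2))
      (F := fun q y => (G (q.1, q.2, y) + θ / 2 * G (q.1, q.2, y) ^ 2))
      ?_ (fun q => bernPi fun i => r (q.1 i))
    exact hG2.comp fun q : ((Fin n → ι) × (Fin n → Fin 2)) × (Fin n → Fin 2) =>
      (q.1.1, q.1.2, q.2)
  have hb1 : IsBdd fun τ : Fin n → ι =>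
      ∑ x, ∑ y, (∏ i, cellWeight (p (τ i)) (r (τ i)) (δ (τ i)) (x i) (y i)) * G (τ, x, y) := by
    obtain ⟨K, hK⟩ := hG
    refine ⟨K, fun τ => ?_⟩
    have h1 : ∑ x : Fin n → Fin 2, ∑ y : Fin n → Fin 2,
        (∏ i, cellWeight (p (τ i)) (r (τ i)) (δ (τ i)) (x i) (y i)) = 1 := by
      rw [sum_sum_prod fun i a b => cellWeight (p (τ i)) (r (τ i)) (δ (τ i)) a b]
      exact Finset.prod_eq_one fun i _ => sum_cellWeight
    rw [← one_mul K, ← h1, Finset.sum_mul]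
    refine (Finset.abs_sum_le_sum_abs _ _).trans (Finset.sum_le_sum fun x _ => ?_)
    rw [Finset.sum_mul]
    refine (Finset.abs_sum_le_sum_abs _ _).trans (Finset.sum_le_sum fun y _ => ?_)
    have h0 := Finset.prod_nonneg fun i (_ : i ∈ Finset.univ) =>
      hJ0 (τ i) (x i) (y i)
    rw [abs_mul, abs_of_nonneg h0]
    exact mul_le_mul_of_nonneg_left (hK _) h0
  refine (integral_mono (hb1.integrable _) ((hb2.add (IsBdd.const c)).integrable _) hpt).trans_eq ?_
  rw [integral_add (hb2.integrable _) (integrable_const _)]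
  simp

end Transfer

end CMH

namespace CMH

/-! ### The conditional cell probabilities of a stratified law -/

section Params

variable {Ω ι : Type*} [MeasurableSpace Ω] (P : Measure Ω) [IsProbabilityMeasure P]
  (T : Ω → ι) (X Y : Ω → Fin 2)

/-- The conditional probability of `X = 0` in a stratum. -/
noncomputable def zeroProb (t : ι) : unitInterval :=
  ⟨P.real {w | T w = t ∧ X w = 0} / P.real {w | T w = t},
    div_nonneg measureReal_nonneg measureReal_nonneg,
    div_le_one_of_le₀ (measureReal_mono fun _ h => h.1) measureReal_nonneg⟩

/-- The conditional covariance of `{X = 0}` and `{Y = 0}` in a stratum. -/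
noncomputable def zeroCov (t : ι) : ℝ :=
  P.real {w | T w = t ∧ X w = 0 ∧ Y w = 0} / P.real {w | T w = t}
    - zeroProb P T X t * zeroProb P T Y t

variable {T X Y} (hX : Measurable X) (hY : Measurable Y)

theorem measureReal_split (s : Set Ω) {V : Ω → Fin 2} (hV : Measurable V) :
    P.real s = P.real {w | w ∈ s ∧ V w = 0} + P.real {w | w ∈ s ∧ V w = 1} := by
  have h := measureReal_inter_add_sdiff (μ := P) (s := s) (hV (measurableSet_singleton (0 : Fin 2)))
  rw [← h]
  congr 2
  ext w
  simp only [Set.mem_sdiff, Set.mem_preimage, Set.mem_singleton_iff, Set.mem_ofPred_eq]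
  refine and_congr_right fun _ => ?_
  generalize V w = a
  fin_cases a <;> simp

include hX hY in
-- A 2×2 table is determined by its total, its margins and one covariance. In a null stratum both
-- sides vanish, whatever value the quotients 0/0 receive.
theorem measureReal_cell (t : ι) (a b : Fin 2) :
    P.real {w | T w = t ∧ X w = a ∧ Y w = b} = P.real {w | T w = t}
      * cellWeight (zeroProb P T X t) (zeroProb P T Y t) (zeroCov P T X Y t) a b := by
  by_cases h0 : P.real {w | T w = t} = 0
  · rw [h0, zero_mul]
    exact le_antisymm (h0 ▸ measureReal_mono fun _ h => h.1) measureReal_nonneg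
  · have e1 := measureReal_split P {w | T w = t} hX
    have e2 := measureReal_split P {w | T w = t ∧ X w = 0} hY
    have e3 := measureReal_split P {w | T w = t ∧ X w = 1} hY
    have e4 := measureReal_split P {w | T w = t ∧ Y w = 0} hX
    have c4 : ∀ c, {w | w ∈ {w | T w = t ∧ Y w = 0} ∧ X w = c}
        = {w | T w = t ∧ X w = c ∧ Y w = 0} := fun c => by
      ext w
      simp only [Set.mem_ofPred_eq]
      tauto
    rw [c4 0, c4 1] at e4
    simp only [Set.mem_ofPred_eq, and_assoc] at e1 e2 e3 e4
    have key : ∀ a b, P.real {w | T w = t}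
          * cellWeight (zeroProb P T X t) (zeroProb P T Y t) (zeroCov P T X Y t) a b
        = if a = 0 then (if b = 0 then P.real {w | T w = t ∧ X w = 0 ∧ Y w = 0}
            else P.real {w | T w = t ∧ X w = 0} - P.real {w | T w = t ∧ X w = 0 ∧ Y w = 0})
          else (if b = 0 then P.real {w | T w = t ∧ Y w = 0}
            - P.real {w | T w = t ∧ X w = 0 ∧ Y w = 0}
            else P.real {w | T w = t} - P.real {w | T w = t ∧ X w = 0} - P.real {w | T w = t ∧ Y w = 0}
              + P.real {w | T w = t ∧ X w = 0 ∧ Y w = 0}) := by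
      intro a b
      fin_cases a <;> fin_cases b <;>
        simp only [cellWeight, bw, sgn, zeroCov, zeroProb, Fin.zero_eta, Fin.mk_one, if_true,
          one_ne_zero, if_false] <;> field_simp <;> ring
    rw [key]
    fin_cases a <;> fin_cases b <;>
      simp only [Fin.zero_eta, Fin.mk_one, if_true, one_ne_zero, if_false] <;> linarith

include hX hY in
theorem measure_cell [MeasurableSpace ι] [MeasurableSingletonClass ι] (hT : Measurable T) (t : ι) (a b : Fin 2) :
    P {w | T w = t ∧ X w = a ∧ Y w = b} = P.map T {t} * ENNReal.ofReal
      (cellWeight (zeroProb P T X t) (zeroProb P T Y t) (zeroCov P T X Y t) a b) := by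
  have h := measureReal_cell P (T := T) hX hY t a b
  rw [Measure.map_apply hT (measurableSet_singleton t)]
  have h1 : P (T ⁻¹' {t}) = ENNReal.ofReal (P.real {w | T w = t}) := by
    rw [measureReal_def, ENNReal.ofReal_toReal (measure_ne_top _ _)]
    rfl
  rw [h1, ← ENNReal.ofReal_mul measureReal_nonneg, ← h, measureReal_def,
    ENNReal.ofReal_toReal (measure_ne_top _ _)]

include hX hY in
theorem cellWeight_zeroProb_nonneg (t : ι) (a b : Fin 2) :
    0 ≤ cellWeight (zeroProb P T X t) (zeroProb P T Y t) (zeroCov P T X Y t) a b := by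
  by_cases h0 : P.real {w | T w = t} = 0
  · simp only [cellWeight, zeroCov, zeroProb, h0, div_zero, mul_zero, sub_zero, add_zero]
    exact mul_nonneg (bw_nonneg _ _) (bw_nonneg _ _)
  · have h := measureReal_cell P (T := T) hX hY t a b
    have hpos : 0 < P.real {w | T w = t} := lt_of_le_of_ne measureReal_nonneg (Ne.symm h0)
    exact nonneg_of_mul_nonneg_right (h ▸ measureReal_nonneg) hpos

end Params

/-! ### Covariance of smooth functions on small sets -/

section Covariance

variable {α : Type*} [MeasurableSpace α]

/-- Cauchy-Schwarz, from the discriminant of the nonnegative quadratic s ↦ ∫ (s u + v)². -/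
theorem sq_integral_mul_le (m : Measure α) {u v : α → ℝ} (hu : Integrable (fun z => u z ^ 2) m)
    (hv : Integrable (fun z => v z ^ 2) m) (huv : Integrable (fun z => u z * v z) m) :
    (∫ z, u z * v z ∂m) ^ 2 ≤ (∫ z, u z ^ 2 ∂m) * ∫ z, v z ^ 2 ∂m := by
  have h : ∀ s : ℝ, 0 ≤ (∫ z, u z ^ 2 ∂m) * (s * s) + (2 * ∫ z, u z * v z ∂m) * s
      + ∫ z, v z ^ 2 ∂m := by
    intro s
    have h1 : ∫ z, (s * u z + v z) ^ 2 ∂m = (∫ z, u z ^ 2 ∂m) * (s * s)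
        + (2 * ∫ z, u z * v z ∂m) * s + ∫ z, v z ^ 2 ∂m := by
      have h2 : ∀ z, (s * u z + v z) ^ 2 = s * s * u z ^ 2 + 2 * s * (u z * v z) + v z ^ 2 :=
        fun z => by ring
      simp_rw [h2]
      rw [integral_add (f := fun z => s * s * u z ^ 2 + 2 * s * (u z * v z))
        ((hu.const_mul _).add (huv.const_mul _)) hv,
        integral_add (hu.const_mul _) (huv.const_mul _), integral_const_mul, integral_const_mul]
      ring
    rw [← h1]
    exact integral_nonneg fun _ => sq_nonneg _
  have h3 := discrim_le_zero h
  rw [discrim] at h3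
  linarith

/-- A function with values in `[0, 1]` whose square root, and that of its complement, vary little
on `A`. -/
structure SqrtSmooth (A : Set α) (K : ℝ) (f : α → ℝ) : Prop where
  measurable : Measurable f
  mem : ∀ z, f z ∈ Set.Icc (0 : ℝ) 1
  sqrt_sub : ∀ z ∈ A, ∀ z' ∈ A, (√(f z) - √(f z')) ^ 2 ≤ K
  sqrt_compl_sub : ∀ z ∈ A, ∀ z' ∈ A, (√(1 - f z) - √(1 - f z')) ^ 2 ≤ K

variable {m : Measure α} [IsProbabilityMeasure m] {A : Set α} {K : ℝ} {f g : α → ℝ}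

theorem integrable_of_Icc {h : α → ℝ} {a b : ℝ} (hm : Measurable h)
    (hb : ∀ z, h z ∈ Set.Icc a b) : Integrable h m :=
  Integrable.of_bound hm.aestronglyMeasurable (max |a| |b|)
    (ae_of_all _ fun z => abs_le_max_abs_abs (hb z).1 (hb z).2)

theorem SqrtSmooth.compl (hf : SqrtSmooth A K f) : SqrtSmooth A K fun z => 1 - f z where
  measurable := hf.measurable.const_sub 1
  mem z := ⟨sub_nonneg.2 (hf.mem z).2, sub_le_self _ (hf.mem z).1⟩
  sqrt_sub := hf.sqrt_compl_sub
  sqrt_compl_sub := by simpa using hf.sqrt_sub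

theorem SqrtSmooth.integrable (hf : SqrtSmooth A K f) : Integrable f m :=
  integrable_of_Icc hf.measurable hf.mem

theorem SqrtSmooth.integrable_sub_sq (hf : SqrtSmooth A K f) {c : ℝ} (hc : c ∈ Set.Icc (0 : ℝ) 1) :
    Integrable (fun z => (f z - c) ^ 2) m :=
  integrable_of_Icc (a := 0) (b := 1) ((hf.measurable.sub_const c).pow_const 2) fun z =>
    ⟨sq_nonneg _, by
      have h := hf.mem z
      rw [sq_le_one_iff_abs_le_one, abs_le]
      constructor <;> linarith [h.1, h.2, hc.1, hc.2]⟩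

theorem SqrtSmooth.integral_mem (hf : SqrtSmooth A K f) : ∫ z, f z ∂m ∈ Set.Icc (0 : ℝ) 1 := by
  refine ⟨integral_nonneg fun z => (hf.mem z).1, ?_⟩
  have h := integral_mono (μ := m) hf.integrable (integrable_const 1) fun z => (hf.mem z).2
  simpa using h

/-- Centring at f z₀ instead of the mean only increases the integral, and (f - f z₀)² = (√f - √(f
z₀))² (√f + √(f z₀))² ≤ 2K(f + f z₀). Choosing z₀ in A with f z₀ at most the mean makes the bound
proportional to the mean. -/
theorem SqrtSmooth.variance_le_mul_integral (hf : SqrtSmooth A K f) (hA : m Aᶜ = 0) :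
    ∫ z, (f z - ∫ w, f w ∂m) ^ 2 ∂m ≤ 4 * K * ∫ z, f z ∂m := by
  obtain ⟨z₀, hz₀, hle⟩ := exists_notMem_null_le_integral (hf.integrable (m := m)) hA
  have hz₀ : z₀ ∈ A := not_not.1 hz₀
  have hK : 0 ≤ K := (sq_nonneg _).trans (hf.sqrt_sub z₀ hz₀ z₀ hz₀)
  set e := ∫ w, f w ∂m with he
  have h1 : ∫ z, (f z - e) ^ 2 ∂m ≤ ∫ z, (f z - f z₀) ^ 2 ∂m := by
    have hk : ∀ c ∈ Set.Icc (0 : ℝ) 1,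
        ∫ z, (f z - c) ^ 2 ∂m = ∫ z, f z ^ 2 ∂m - 2 * c * e + c ^ 2 := by
      intro c _
      have h2 : ∀ z, (f z - c) ^ 2 = f z ^ 2 - 2 * c * f z + c ^ 2 := fun z => by ring
      have h3 : Integrable (fun z => f z ^ 2) m := by
        simpa using hf.integrable_sub_sq (m := m) (c := 0) (by simp)
      simp_rw [h2]
      rw [integral_add (f := fun z => f z ^ 2 - 2 * c * f z) (h3.sub (hf.integrable.const_mul _))
        (integrable_const _), integral_sub h3 (hf.integrable.const_mul _), integral_const_mul]
      simp [he]
    rw [hk e hf.integral_mem, hk (f z₀) (hf.mem z₀)]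
    nlinarith [sq_nonneg (f z₀ - e)]
  refine h1.trans ?_
  have h4 : ∀ᵐ z ∂m, (f z - f z₀) ^ 2 ≤ 2 * K * (f z + f z₀) := by
    have hAe : ∀ᵐ z ∂m, z ∈ A := by
      rw [ae_iff]
      exact hA
    filter_upwards [hAe] with z hz
    have h5 := hf.sqrt_sub z hz z₀ hz₀
    have h6 := Real.mul_self_sqrt (hf.mem z).1
    have h7 := Real.mul_self_sqrt (hf.mem z₀).1
    set a := √(f z)
    set b := √(f z₀)
    have h8 : (f z - f z₀) ^ 2 = (a - b) ^ 2 * (a + b) ^ 2 := by rw [← h6, ← h7]; ring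
    have h9 : (a + b) ^ 2 ≤ 2 * (f z + f z₀) := by
      rw [← h6, ← h7]
      nlinarith [sq_nonneg (a - b)]
    rw [h8]
    calc (a - b) ^ 2 * (a + b) ^ 2 ≤ K * (2 * (f z + f z₀)) :=
          mul_le_mul h5 h9 (sq_nonneg _) hK
      _ = _ := by ring
  refine (integral_mono_ae (hf.integrable_sub_sq (hf.mem z₀))
    ((hf.integrable.add (integrable_const _)).const_mul _) h4).trans ?_
  simp only [Pi.add_apply]
  rw [integral_const_mul, integral_add hf.integrable (integrable_const _)]
  simp only [integral_const, probReal_univ, one_smul]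
  nlinarith

/-- The preceding bound is applied to f or to 1 - f, whichever has mean at most 1/2; the other mean
is then at least 1/2, which costs a factor 2. -/
theorem SqrtSmooth.variance_le (hf : SqrtSmooth A K f) (hA : m Aᶜ = 0) (hK : 0 ≤ K) :
    ∫ z, (f z - ∫ w, f w ∂m) ^ 2 ∂m ≤ 8 * K * ((∫ z, f z ∂m) * (1 - ∫ z, f z ∂m)) := by
  have h1 := hf.variance_le_mul_integral hA
  have h2 := hf.compl.variance_le_mul_integral hA
  have h3 : ∫ z, (1 - f z) ∂m = 1 - ∫ z, f z ∂m := by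
    rw [integral_sub (integrable_const _) hf.integrable]
    simp
  have h4 : ∀ z, (1 - f z - (1 - ∫ w, f w ∂m)) ^ 2 = (f z - ∫ w, f w ∂m) ^ 2 := fun z => by ring
  simp only [h3, h4] at h2
  have h5 := hf.integral_mem (m := m)
  set e := ∫ w, f w ∂m
  rcases le_total e (1 / 2) with h | h
  · refine h1.trans ?_
    have : 0 ≤ K * (e * (1 - 2 * e)) :=
      mul_nonneg hK (mul_nonneg h5.1 (by linarith))
    nlinarith
  · refine h2.trans ?_
    have : 0 ≤ K * ((1 - e) * (2 * e - 1)) :=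
      mul_nonneg hK (mul_nonneg (by linarith [h5.2]) (by linarith))
    nlinarith

theorem SqrtSmooth.sq_covariance_le (hf : SqrtSmooth A K f) (hg : SqrtSmooth A K g)
    (hA : m Aᶜ = 0) (hK : 0 ≤ K) :
    (∫ z, f z * g z ∂m - (∫ z, f z ∂m) * ∫ z, g z ∂m) ^ 2
      ≤ 64 * K ^ 2 * (((∫ z, f z ∂m) * (1 - ∫ z, f z ∂m))
        * ((∫ z, g z ∂m) * (1 - ∫ z, g z ∂m))) := by
  have hfm := hf.integral_mem (m := m)
  have hgm := hg.integral_mem (m := m)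
  have hfv := hf.variance_le hA hK
  have hgv := hg.variance_le hA hK
  set e := ∫ w, f w ∂m with he
  set e' := ∫ w, g w ∂m with he'
  have hmul : ∀ z, f z * g z ∈ Set.Icc (0 : ℝ) 1 := fun z =>
    ⟨mul_nonneg (hf.mem z).1 (hg.mem z).1,
      mul_le_one₀ (hf.mem z).2 (hg.mem z).1 (hg.mem z).2⟩
  have hfg : Integrable (fun z => f z * g z) m :=
    integrable_of_Icc (hf.measurable.mul hg.measurable) hmul
  have hexp : ∀ z, (f z - e) * (g z - e') = f z * g z - e' * f z - e * g z + e * e' := fun z => by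
    ring
  have hint : Integrable (fun z => (f z - e) * (g z - e')) m := by
    simp_rw [hexp]
    exact ((hfg.sub (hf.integrable.const_mul _)).sub (hg.integrable.const_mul _)).add
      (integrable_const _)
  have hcov : ∫ z, (f z - e) * (g z - e') ∂m = ∫ z, f z * g z ∂m - e * e' := by
    simp_rw [hexp]
    rw [integral_add (f := fun z => f z * g z - e' * f z - e * g z)
      ((hfg.sub (hf.integrable.const_mul _)).sub (hg.integrable.const_mul _)) (integrable_const _),
      integral_sub (f := fun z => f z * g z - e' * f z) (hfg.sub (hf.integrable.const_mul _))
      (hg.integrable.const_mul _), integral_sub hfg (hf.integrable.const_mul _),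
      integral_const_mul, integral_const_mul, ← he, ← he']
    simp
    ring
  rw [← hcov]
  refine (sq_integral_mul_le m (hf.integrable_sub_sq hfm) (hg.integrable_sub_sq hgm) hint).trans ?_
  calc _ ≤ (8 * K * (e * (1 - e))) * (8 * K * (e' * (1 - e'))) :=
        mul_le_mul hfv hgv (integral_nonneg fun _ => sq_nonneg _)
          (mul_nonneg (by positivity) (mul_nonneg hfm.1 (by linarith [hfm.2])))
    _ = _ := by ring

end Covariance

end CMH

namespace CMH

/-! ### The statistic as a function of the strata and the two coordinates -/

section Link

variable {d : ℕ} {𝒵 : Set (EuclideanSpace ℝ (Fin d))} {ι : Type}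

open Classical in
/-- The index of the stratum of a point, with an arbitrary value outside of `𝒵`. -/
noncomputable def Stratification.index [Nonempty ι] (S : Stratification 𝒵 ι)
    (z : EuclideanSpace ℝ (Fin d)) : ι :=
  if h : ∃ t, z ∈ S.stratum t then h.choose else Classical.arbitrary ι

namespace Stratification

variable [Nonempty ι] (S : Stratification 𝒵 ι)

theorem index_eq_of_mem {z : EuclideanSpace ℝ (Fin d)} {t : ι} (h : z ∈ S.stratum t) :
    S.index z = t := by
  have h' : ∃ t, z ∈ S.stratum t := ⟨t, h⟩
  have h1 : S.index z = h'.choose := dif_pos h'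
  rw [h1]
  by_contra hne
  exact Set.disjoint_left.1 (S.pairwise_disjoint hne) h'.choose_spec h

theorem index_eq_iff {z : EuclideanSpace ℝ (Fin d)} (hz : z ∈ 𝒵) {t : ι} :
    S.index z = t ↔ z ∈ S.stratum t := by
  refine ⟨fun h => ?_, S.index_eq_of_mem⟩
  rw [← S.iUnion_stratum, Set.mem_iUnion] at hz
  obtain ⟨s, hs⟩ := hz
  rwa [← h, S.index_eq_of_mem hs]

theorem measurable_index [Countable ι] [MeasurableSpace ι] : Measurable S.index := by
  refine measurable_to_countable' fun t => ?_
  have h : S.index ⁻¹' {t} = S.stratum t ∪ ((⋃ s, S.stratum s)ᶜ ∩ {_z | Classical.arbitrary ι = t}) := by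
    ext z
    simp only [Set.mem_preimage, Set.mem_singleton_iff, Set.mem_union, Set.mem_inter_iff,
      Set.mem_compl_iff, Set.mem_iUnion]
    by_cases hz : ∃ s, z ∈ S.stratum s
    · have hz2 : z ∈ 𝒵 := by rwa [← S.iUnion_stratum, Set.mem_iUnion]
      simp [S.index_eq_iff hz2, hz]
    · have h1 : S.index z = Classical.arbitrary ι := dif_neg hz
      rw [h1]
      have h2 : z ∉ S.stratum t := fun h => hz ⟨t, h⟩
      simp [h2, hz]
  rw [h]
  exact (S.measurableSet_stratum t).union
    ((MeasurableSet.iUnion S.measurableSet_stratum).compl.inter (MeasurableSet.const _))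

end Stratification

variable {n : ℕ} [Nonempty ι] (S : Stratification 𝒵 ι)

/-- The strata and the coordinates of a sample of observations. -/
noncomputable def stratify (w : Fin n → Obs d) : Sample n ι :=
  toSample (fun v => S.index (obsZ v)) obsX obsY w

variable {S} {w : Fin n → Obs d} (hw : ∀ i, obsZ (w i) ∈ 𝒵)

include hw in
theorem cellCount_eq_sum (a b : Fin 2) (t : ι) :
    (cellCount w a b (S.stratum t) : ℝ) = ∑ i ∈ fib (stratify S w).1 t,
      if (stratify S w).2.1 i = a ∧ (stratify S w).2.2 i = b then (1 : ℝ) else 0 := by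
  classical
  rw [Finset.sum_boole, cellCount]
  congr 2
  ext i
  have h : (stratify S w).1 i = t ↔ obsZ (w i) ∈ S.stratum t := S.index_eq_iff (hw i)
  simp only [Finset.mem_filter, Finset.mem_univ, true_and, mem_fib, h]
  simp only [stratify, toSample]
  tauto

include hw in
theorem xCount_zero (t : ι) :
    (xCount w 0 (S.stratum t) : ℝ) = cnt (stratify S w).2.1 (fib (stratify S w).1 t) := by
  rw [xCount, Nat.cast_sum, Fin.sum_univ_two, cellCount_eq_sum hw, cellCount_eq_sum hw,
    ← Finset.sum_add_distrib, cnt]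
  refine Finset.sum_congr rfl fun i _ => ?_
  generalize (stratify S w).2.1 i = a
  generalize (stratify S w).2.2 i = b
  fin_cases a <;> fin_cases b <;> simp

include hw in
theorem yCount_zero (t : ι) :
    (yCount w 0 (S.stratum t) : ℝ) = cnt (stratify S w).2.2 (fib (stratify S w).1 t) := by
  rw [yCount, Nat.cast_sum, Fin.sum_univ_two, cellCount_eq_sum hw, cellCount_eq_sum hw,
    ← Finset.sum_add_distrib, cnt]
  refine Finset.sum_congr rfl fun i _ => ?_
  generalize (stratify S w).2.1 i = a
  generalize (stratify S w).2.2 i = b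
  fin_cases a <;> fin_cases b <;> simp

include hw in
theorem totalCount_eq_card (t : ι) :
    (totalCount w (S.stratum t) : ℝ) = (fib (stratify S w).1 t).card := by
  rw [totalCount, Nat.cast_sum, Fin.sum_univ_two, Nat.cast_sum, Nat.cast_sum, Fin.sum_univ_two,
    Fin.sum_univ_two]
  simp only [cellCount_eq_sum hw]
  rw [← Finset.sum_add_distrib, ← Finset.sum_add_distrib, ← Finset.sum_add_distrib,
    Finset.sum_congr rfl (g := fun _ => (1 : ℝ))]
  · simp
  · intro i _
    generalize (stratify S w).2.1 i = a
    generalize (stratify S w).2.2 i = b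
    fin_cases a <;> fin_cases b <;> simp

theorem totalCount_eq_xCount (A : Set (EuclideanSpace ℝ (Fin d))) :
    totalCount w A = xCount w 0 A + xCount w 1 A := by
  rw [totalCount, Fin.sum_univ_two]
  rfl

theorem totalCount_eq_yCount (A : Set (EuclideanSpace ℝ (Fin d))) :
    totalCount w A = yCount w 0 A + yCount w 1 A := by
  rw [totalCount, Finset.sum_comm, Fin.sum_univ_two]
  rfl

include hw in
theorem stratumVar_eq (t : ι) :
    stratumVar w (S.stratum t) = gini (stratify S w).2.1 (fib (stratify S w).1 t)
      / ((fib (stratify S w).1 t).card ^ 2 * ((fib (stratify S w).1 t).card - 1))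
      * gini (stratify S w).2.2 (fib (stratify S w).1 t) := by
  have h1 : (xCount w 1 (S.stratum t) : ℝ)
      = totalCount w (S.stratum t) - xCount w 0 (S.stratum t) := by
    rw [totalCount_eq_xCount]
    push_cast
    ring
  have h2 : (yCount w 1 (S.stratum t) : ℝ)
      = totalCount w (S.stratum t) - yCount w 0 (S.stratum t) := by
    rw [totalCount_eq_yCount]
    push_cast
    ring
  rw [stratumVar, h1, h2, xCount_zero hw, yCount_zero hw, totalCount_eq_card hw, gini, gini]
  ring

include hw in
theorem totalVar_eq : totalVar S w = sumVar (stratify S w).1 (stratify S w).2.1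
    (stratify S w).2.2 := by
  classical
  rw [totalVar, sumVar, tsum_eq_sum (s := Finset.univ.image (stratify S w).1)]
  · exact Finset.sum_congr rfl fun t _ => stratumVar_eq hw t
  · intro t ht
    rw [stratumVar_eq hw, fib_eq_empty ht]
    simp [gini, cnt]

include hw in
-- Within a stratum the deviations of the x-indicators from their average sum to zero, so any
-- constant r may be subtracted from the y-indicators. The true conditional probability will be
-- used, which centres each term in the model.
theorem tsum_cellCount_sub (r : ι → unitInterval) :
    ∑' t, ((cellCount w 0 0 (S.stratum t) : ℝ) - stratumMean w (S.stratum t))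
      = centeredSum r (stratify S w).1 (stratify S w).2.1 (stratify S w).2.2 := by
  classical
  set τ := (stratify S w).1 with hτ
  set x := (stratify S w).2.1 with hx
  set y := (stratify S w).2.2 with hy
  have hterm : ∀ t, (cellCount w 0 0 (S.stratum t) : ℝ) - stratumMean w (S.stratum t)
      = ∑ i ∈ fib τ t, ind (x i) * ind (y i)
        - cnt x (fib τ t) * cnt y (fib τ t) / (fib τ t).card := by
    intro t
    rw [stratumMean, xCount_zero hw, yCount_zero hw, totalCount_eq_card hw, cellCount_eq_sum hw]
    congr 1
    refine Finset.sum_congr rfl fun i _ => ?_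
    rw [← hx, ← hy]
    generalize x i = a
    generalize y i = b
    fin_cases a <;> fin_cases b <;> simp
  simp_rw [hterm]
  rw [tsum_eq_sum (s := Finset.univ.image τ), centeredSum,
    ← Finset.sum_fiberwise_of_maps_to (g := τ) (t := Finset.univ.image τ)
    fun i _ => Finset.mem_image_of_mem τ (Finset.mem_univ i)]
  · refine Finset.sum_congr rfl fun t ht => ?_
    have h : (Finset.univ.filter fun i => τ i = t) = fib τ t := by ext; simp
    have hk : ((fib τ t).card : ℝ) ≠ 0 := by
      have := card_fib_pos ht
      positivity
    have hexp : ∑ i ∈ fib τ t, (ind (x i) - cnt x (fib τ (τ i)) / (fib τ (τ i)).card)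
          * (ind (y i) - r (τ i))
        = ∑ i ∈ fib τ t, (ind (x i) * ind (y i) - cnt x (fib τ t) / (fib τ t).card * ind (y i)
          - r t * ind (x i) + r t * (cnt x (fib τ t) / (fib τ t).card)) :=
      Finset.sum_congr rfl fun i hi => by rw [mem_fib.1 hi]; ring
    rw [h, hexp, Finset.sum_add_distrib, Finset.sum_sub_distrib, Finset.sum_sub_distrib,
      ← Finset.mul_sum, ← Finset.mul_sum, Finset.sum_const, nsmul_eq_mul]
    change _ = _ - _ * cnt y (fib τ t) - _ * cnt x (fib τ t) + _
    field_simp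
    ring
  · intro t ht
    rw [fib_eq_empty ht]
    simp [cnt]

include hw in
theorem test_eq_sampleTest (α : ℝ) (r : ι → unitInterval) :
    test α S w = sampleTest α r (stratify S w) := by
  rw [test, sampleTest, statistic, tsum_cellCount_sub hw r, totalVar_eq hw]

end Link

/-! ### The conditional covariance in a small stratum -/

section Smooth

variable {d : ℕ}

theorem measurable_obsX : Measurable (obsX (d := d)) := measurable_fst

theorem measurable_obsY : Measurable (obsY (d := d)) := measurable_fst.comp measurable_snd

theorem measurable_obsZ : Measurable (obsZ (d := d)) := measurable_snd.comp measurable_snd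

theorem measureReal_condDistrib (P : Measure (Obs d)) [IsProbabilityMeasure P] {β : Type*}
    [MeasurableSpace β] [StandardBorelSpace β] [Nonempty β]
    {V : Obs d → β} (hV : Measurable V) {κ : EuclideanSpace ℝ (Fin d) → Measure β}
    (hκ : ∀ᵐ z ∂(P.map obsZ), κ z = condDistrib V obsZ P z)
    {A : Set (EuclideanSpace ℝ (Fin d))} (hA : MeasurableSet A) {s : Set β}
    (hs : MeasurableSet s) :
    P.real {w | obsZ w ∈ A ∧ V w ∈ s} = ∫ z in A, (κ z).real s ∂(P.map obsZ) := by
  have : IsProbabilityMeasure (P.map (obsZ (d := d))) :=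
    Measure.isProbabilityMeasure_map measurable_obsZ.aemeasurable
  have h1 : ∫ z in A, (κ z).real s ∂(P.map obsZ)
      = ∫ z in A, (condDistrib V obsZ P z).real s ∂(P.map obsZ) := by
    refine integral_congr_ae (ae_restrict_of_ae ?_)
    filter_upwards [hκ] with z hz
    rw [hz]
  have h2 : P {w | obsZ w ∈ A ∧ V w ∈ s} = ∫⁻ z in A, condDistrib V obsZ P z s ∂(P.map obsZ) := by
    rw [← Measure.compProd_apply_prod hA hs, compProd_map_condDistrib hV.aemeasurable,
      Measure.map_apply (measurable_obsZ.prodMk hV) (hA.prod hs)]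
    rfl
  rw [h1, measureReal_def, h2]
  exact (integral_toReal ((Kernel.measurable_coe _ hs).aemeasurable)
    (ae_of_all _ fun z => measure_lt_top _ _)).symm

theorem sq_sqrt_sub_le_of_hellingerDist_le {p q : Measure (Fin 2)} {c : ℝ}
    (h : hellingerDist p q ≤ c) (x : Fin 2) :
    (√(p.real {x}) - √(q.real {x})) ^ 2 ≤ 2 * c ^ 2 := by
  have h0 : 0 ≤ (∑ x : Fin 2, (√(p.real {x}) - √(q.real {x})) ^ 2) / 2 :=
    div_nonneg (Finset.sum_nonneg fun _ _ => sq_nonneg _) (by norm_num)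
  have h1 := pow_le_pow_left₀ (Real.sqrt_nonneg _) h 2
  rw [Real.sq_sqrt h0] at h1
  have h2 := Finset.single_le_sum (f := fun x : Fin 2 => (√(p.real {x}) - √(q.real {x})) ^ 2)
    (fun _ _ => sq_nonneg _) (Finset.mem_univ x)
  linarith

theorem measureReal_one_eq (p : Measure (Fin 2)) [IsProbabilityMeasure p] :
    p.real {1} = 1 - p.real {0} := by
  have h := measureReal_compl (μ := p) (measurableSet_singleton (0 : Fin 2))
  have hc : ({0}ᶜ : Set (Fin 2)) = {1} := by
    ext a
    fin_cases a <;> simp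
  rw [hc] at h
  simpa using h

/-- Hellinger smoothness of a kernel on a set of bounded diameter. -/
theorem sqrtSmooth_kernel {κ : Kernel (EuclideanSpace ℝ (Fin d)) (Fin 2)} [IsMarkovKernel κ]
    {A : Set (EuclideanSpace ℝ (Fin d))} {L h : ℝ} (hL : 0 ≤ L)
    (hκ : ∀ z ∈ A, ∀ z' ∈ A, hellingerDist (κ z) (κ z') ≤ L * dist z z')
    (hA : ∀ z ∈ A, ∀ z' ∈ A, dist z z' ≤ h) :
    SqrtSmooth A (2 * (L * h) ^ 2) fun z => (κ z).real {0} where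
  measurable := (Kernel.measurable_coe κ (measurableSet_singleton 0)).ennreal_toReal
  mem z := ⟨measureReal_nonneg, measureReal_le_one⟩
  sqrt_sub z hz z' hz' := sq_sqrt_sub_le_of_hellingerDist_le
    ((hκ z hz z' hz').trans (mul_le_mul_of_nonneg_left (hA z hz z' hz') hL)) 0
  sqrt_compl_sub z hz z' hz' := by
    rw [← measureReal_one_eq, ← measureReal_one_eq]
    exact sq_sqrt_sub_le_of_hellingerDist_le
      ((hκ z hz z' hz').trans (mul_le_mul_of_nonneg_left (hA z hz z' hz') hL)) 1

variable {P : Measure (Obs d)} {𝒵 : Set (EuclideanSpace ℝ (Fin d))} {ι : Type} [Nonempty ι]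
  (hZ : ∀ᵐ w ∂P, obsZ w ∈ 𝒵) (S : Stratification 𝒵 ι)

include hZ in
theorem measureReal_index (t : ι) (Q : Obs d → Prop) :
    P.real {w | S.index (obsZ w) = t ∧ Q w} = P.real {w | obsZ w ∈ S.stratum t ∧ Q w} := by
  refine measureReal_congr ?_
  filter_upwards [hZ] with w hw
  exact congrArg (· ∧ Q w) (propext (S.index_eq_iff hw))

variable [IsProbabilityMeasure P] {κX κY : Kernel (EuclideanSpace ℝ (Fin d)) (Fin 2)} [IsMarkovKernel κX] [IsMarkovKernel κY]
  (hκX : ∀ᵐ z ∂(P.map obsZ), κX z = condDistrib obsX obsZ P z)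
  (hκY : ∀ᵐ z ∂(P.map obsZ), κY z = condDistrib obsY obsZ P z)

include hZ in
theorem zeroProb_eq {V : Obs d → Fin 2} (hV : Measurable V)
    {κ : Kernel (EuclideanSpace ℝ (Fin d)) (Fin 2)}
    (hκ : ∀ᵐ z ∂(P.map obsZ), κ z = condDistrib V obsZ P z) (t : ι) :
    (zeroProb P (fun v => S.index (obsZ v)) V t : ℝ)
      = ∫ z, (κ z).real {0} ∂(cond (P.map obsZ) (S.stratum t)) := by
  have hm := S.measurableSet_stratum t
  have h1 := measureReal_condDistrib P hV hκ hm (measurableSet_singleton (0 : Fin 2))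
  have h2 := measureReal_index hZ S t fun w => V w = 0
  have h3 : P.real {w | S.index (obsZ w) = t} = P.real {w | obsZ w ∈ S.stratum t} := by
    simpa using measureReal_index hZ S t fun _ => True
  have h4 : (P.map obsZ) (S.stratum t) = P {w | obsZ w ∈ S.stratum t} :=
    Measure.map_apply measurable_obsZ hm
  simp only [zeroProb, h2, h3]
  simp only [Set.mem_singleton_iff] at h1
  rw [h1, ProbabilityTheory.cond, integral_smul_measure, h4, ENNReal.toReal_inv, ← measureReal_def, smul_eq_mul,
    div_eq_inv_mul]

include hZ hκX hκY in
-- By conditional independence, the joint cell probability of a stratum is the mean of the product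
-- of the two kernels under the law of Z in that stratum, so `zeroCov` is a covariance of two smooth
-- functions of z. The constant is 64K² with K = 2(Lh)².
theorem sq_zeroCov_le (hNull : CondIndependent P) {L h : ℝ} (hL : 0 ≤ L)
    (hX : ∀ z ∈ 𝒵, ∀ z' ∈ 𝒵, hellingerDist (κX z) (κX z') ≤ L * dist z z')
    (hY : ∀ z ∈ 𝒵, ∀ z' ∈ 𝒵, hellingerDist (κY z) (κY z') ≤ L * dist z z')
    (hh : ∀ t, ∀ z ∈ S.stratum t, ∀ z' ∈ S.stratum t, dist z z' ≤ h) (t : ι) :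
    zeroCov P (fun v => S.index (obsZ v)) obsX obsY t ^ 2 ≤ 256 * (L * h) ^ 4
      * bvarProd (zeroProb P (fun v => S.index (obsZ v)) obsX)
          (zeroProb P (fun v => S.index (obsZ v)) obsY) t := by
  have : IsProbabilityMeasure (P.map (obsZ (d := d))) :=
    Measure.isProbabilityMeasure_map measurable_obsZ.aemeasurable
  have hm := S.measurableSet_stratum t
  have hsub : S.stratum t ⊆ 𝒵 := (Set.subset_iUnion _ t).trans S.iUnion_stratum.subset
  have h3 : P.real {w | S.index (obsZ w) = t} = P.real {w | obsZ w ∈ S.stratum t} := by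
    simpa using measureReal_index hZ S t fun _ => True
  have h4 : (P.map obsZ) (S.stratum t) = P {w | obsZ w ∈ S.stratum t} :=
    Measure.map_apply measurable_obsZ hm
  have hRHS := bvarProd_nonneg (zeroProb P (fun v => S.index (obsZ v)) obsX)
    (zeroProb P (fun v => S.index (obsZ v)) obsY) t
  by_cases h0 : P.real {w | obsZ w ∈ S.stratum t} = 0
  · have : zeroCov P (fun v => S.index (obsZ v)) obsX obsY t = 0 := by
      simp [zeroCov, zeroProb, h3, h0]
    rw [this, zero_pow two_ne_zero]
    exact mul_nonneg (by positivity) hRHS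
  have hne : (P.map obsZ) (S.stratum t) ≠ 0 := by
    rw [h4]
    exact fun h => h0 (by simp [measureReal_def, h])
  set m := cond (P.map obsZ) (S.stratum t) with hmdef
  have hmprob : IsProbabilityMeasure m := cond_isProbabilityMeasure hne
  have hmA : m (S.stratum t)ᶜ = 0 := by
    rw [hmdef, cond_apply hm, Set.inter_compl_self, measure_empty, mul_zero]
  have sX := sqrtSmooth_kernel (κ := κX) (A := S.stratum t) hL
    (fun z hz z' hz' => hX z (hsub hz) z' (hsub hz')) (hh t)
  have sY := sqrtSmooth_kernel (κ := κY) (A := S.stratum t) hL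
    (fun z hz z' hz' => hY z (hsub hz) z' (hsub hz')) (hh t)
  have hcov := sX.sq_covariance_le sY (m := m) hmA (by positivity)
  have hpX := zeroProb_eq hZ S measurable_obsX hκX t
  have hpY := zeroProb_eq hZ S measurable_obsY hκY t
  rw [← hpX, ← hpY] at hcov
  have hjoint : P.real {w | obsZ w ∈ S.stratum t ∧ obsX w = 0 ∧ obsY w = 0}
      / P.real {w | obsZ w ∈ S.stratum t}
      = ∫ z, (κX z).real {0} * (κY z).real {0} ∂m := by
    have h1 := measureReal_condDistrib P (measurable_obsX.prodMk measurable_obsY)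
      (κ := condDistrib (fun w => (obsX w, obsY w)) obsZ P) (ae_of_all _ fun z => rfl) hm
      (measurableSet_singleton ((0, 0) : Fin 2 × Fin 2))
    simp only [Set.mem_singleton_iff, Prod.mk.injEq] at h1
    have h5 : ∫ z in S.stratum t, (condDistrib (fun w => (obsX w, obsY w)) obsZ P z).real {(0, 0)}
          ∂(P.map obsZ)
        = ∫ z in S.stratum t, (κX z).real {0} * (κY z).real {0} ∂(P.map obsZ) := by
      refine integral_congr_ae (ae_restrict_of_ae ?_)
      filter_upwards [hNull, hκX, hκY] with z hz hzX hzY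
      rw [hz, hzX, hzY, ← Set.singleton_prod_singleton, measureReal_prod_prod]
    rw [h1, h5, hmdef, ProbabilityTheory.cond, integral_smul_measure, h4, ENNReal.toReal_inv, ← measureReal_def,
      smul_eq_mul, div_eq_inv_mul]
  have hz : zeroCov P (fun v => S.index (obsZ v)) obsX obsY t
      = ∫ z, (κX z).real {0} * (κY z).real {0} ∂m
        - zeroProb P (fun v => S.index (obsZ v)) obsX t
          * zeroProb P (fun v => S.index (obsZ v)) obsY t := by
    rw [← hjoint, zeroCov, h3, measureReal_index hZ S t fun w => obsX w = 0 ∧ obsY w = 0]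
  rw [hz]
  refine hcov.trans (le_of_eq ?_)
  simp only [bvarProd, bvar]
  ring

end Smooth

end CMH

namespace CMH

/-! ### Growth of the mean variance -/

/-- The mean excess over `1`, at least when positive, of a binomial count. -/
theorem binomial_excess_lower {q : ℝ} (hq0 : 0 ≤ q) (hq1 : q ≤ 1) (N n : ℕ) (hn : n ≤ N) :
    n * (n - 1) * q ^ 2 / (2 * (1 + N * q)) ≤ n * q - 1 + (1 - q) ^ n := by
  have hpos : 0 < 1 + (N : ℝ) * q := by positivity
  -- Passing from n to n + 1 adds q(1 - (1 - q)^n) ≥ q · nq/(1 + nq) to the right-hand side. The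
  -- fixed bound N keeps the denominator on the left constant along the induction.
  induction n with
  | zero => simp
  | succ n ih =>
    have ih := ih (by omega)
    have h1 : (1 - q) ^ n * (1 + n * q) ≤ 1 := by
      have h2 := one_add_mul_le_pow (a := q) (by linarith) n
      have h3 : (1 - q) ^ n * (1 + q) ^ n ≤ 1 := by
        rw [← mul_pow]
        exact pow_le_one₀ (by nlinarith) (by nlinarith)
      exact (mul_le_mul_of_nonneg_left h2 (pow_nonneg (by linarith) n)).trans h3
    have h0 : 0 ≤ (1 - q) ^ n := pow_nonneg (by linarith) n
    have hnN : (n : ℝ) ≤ N := by exact_mod_cast (by omega : n ≤ N)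
    have h4 : n * q / (1 + N * q) ≤ 1 - (1 - q) ^ n := by
      have h5 : n * q / (1 + N * q) ≤ n * q / (1 + n * q) := by gcongr
      have h6 : n * q / (1 + n * q) ≤ 1 - (1 - q) ^ n := by
        rw [div_le_iff₀ (by positivity)]
        linarith
      exact h5.trans h6
    have h7 := mul_le_mul_of_nonneg_left h4 hq0
    have h8 : ((n + 1 : ℕ) : ℝ) * (((n + 1 : ℕ) : ℝ) - 1) * q ^ 2 / (2 * (1 + N * q))
        = n * (n - 1) * q ^ 2 / (2 * (1 + N * q)) + q * (n * q / (1 + N * q)) := by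
      push_cast
      field_simp
      ring
    rw [h8, pow_succ (1 - q) n]
    push_cast
    linarith

theorem binomial_excess_lower' {q : ℝ} (hq0 : 0 ≤ q) (hq1 : q ≤ 1) {n : ℕ} (hn : 2 ≤ n) :
    (n * q) ^ 2 / (4 * (1 + n * q)) ≤ n * q - 1 + (1 - q) ^ n := by
  refine le_trans ?_ (binomial_excess_lower hq0 hq1 n n le_rfl)
  have h2 : (2 : ℝ) ≤ n := by exact_mod_cast hn
  have hpos : 0 < 1 + (n : ℝ) * q := by positivity
  rw [div_le_div_iff₀ (by positivity) (by positivity)]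
  have h3 : (n : ℝ) ^ 2 ≤ 2 * (n * (n - 1)) := by nlinarith
  have h4 : 0 ≤ q ^ 2 * (1 + n * q) := by positivity
  nlinarith [mul_le_mul_of_nonneg_right h3 h4]

section Growth

variable {n : ℕ} {ι : Type*} [Fintype ι] [MeasurableSpace ι] [MeasurableSingletonClass ι]

/-- A stratum with k observations enters `sumVarT` through (k - 1)⁺ = k - 1 + 1{k = 0}, and the
indicator of an empty stratum is a product over the observations. -/
theorem meanVar_eq_sum (ν : Measure ι) [IsProbabilityMeasure ν] (p r : ι → unitInterval) :
    meanVar p r ν n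
      = ∑ t, bvarProd p r t * (n * ν.real {t} - 1 + (1 - ν.real {t}) ^ n) := by
  classical
  have h1 : ∀ τ : Fin n → ι, sumVarT (bvarProd p r) τ = ∑ t, bvarProd p r t
      * (∑ i, Set.indicator {t} (fun _ => (1 : ℝ)) (τ i) - 1
        + ∏ i, (1 - Set.indicator {t} (fun _ => (1 : ℝ)) (τ i))) := by
    intro τ
    have hcard : ∀ t, ∑ i, Set.indicator {t} (fun _ => (1 : ℝ)) (τ i) = (fib τ t).card := by
      intro t
      simp only [Set.indicator, Set.mem_singleton_iff]
      rw [Finset.sum_boole]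
      congr 2
    rw [sumVarT, ← Finset.sum_subset (Finset.subset_univ (Finset.univ.image τ))]
    · refine Finset.sum_congr rfl fun t ht => ?_
      obtain ⟨i, _, hi⟩ := Finset.mem_image.1 ht
      rw [hcard, Finset.prod_eq_zero (Finset.mem_univ i) (by simp [hi]), add_zero]
    · intro t _ ht
      have hp : ∏ i, (1 - Set.indicator {t} (fun _ => (1 : ℝ)) (τ i)) = 1 :=
        Finset.prod_eq_one fun i _ => by
          have : τ i ≠ t := fun h => ht (Finset.mem_image.2 ⟨i, Finset.mem_univ i, h⟩)
          simp [this]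
      rw [hcard, hp, fib_eq_empty ht]
      simp
  have hind : ∀ t, ∫ a, Set.indicator {t} (fun _ => (1 : ℝ)) a ∂ν = ν.real {t} := fun t => by
    rw [integral_indicator_const _ (measurableSet_singleton t)]
    simp
  have hev : ∀ (i : Fin n) t, ∫ τ : Fin n → ι, Set.indicator {t} (fun _ => (1 : ℝ)) (τ i)
      ∂(Measure.pi fun _ : Fin n => ν) = ν.real {t} := by
    intro i t
    have h := measurePreserving_eval (fun _ : Fin n => ν) i
    rw [← hind t, ← integral_map (φ := fun τ : Fin n → ι => τ i) h.measurable.aemeasurable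
      (Measurable.of_discrete (f := Set.indicator {t} fun _ => (1 : ℝ))).aestronglyMeasurable]
    exact congrArg (fun m => ∫ a, Set.indicator {t} (fun _ => (1 : ℝ)) a ∂m) h.map_eq
  have hint : ∀ f : (Fin n → ι) → ℝ, Integrable f (Measure.pi fun _ : Fin n => ν) := fun f =>
    (IsBdd.of_finite f).integrable _
  rw [meanVar]
  simp_rw [h1]
  rw [integral_finsetSum _ fun _ _ => hint _]
  refine Finset.sum_congr rfl fun t _ => ?_
  rw [integral_const_mul, integral_add (hint _) (hint _), integral_sub (hint _) (hint _),
    integral_finsetSum _ fun _ _ => hint _,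
    integral_fintype_prod_eq_pow (fun a => 1 - Set.indicator {t} (fun _ => (1 : ℝ)) a),
    integral_sub (integrable_const _) ((IsBdd.of_finite _).integrable _), hind]
  simp only [hev, integral_const, probReal_univ, Finset.sum_const, Finset.card_univ,
    Fintype.card_fin, nsmul_eq_mul, smul_eq_mul, mul_one]

/-- Only strata with variance product at least c are kept. A stratum with expected count l
contributes at least c l²/(4(1 + l)), and by Cauchy-Schwarz ∑ l²/(1 + l) ≥ (∑ l)²/∑(1 + l). Here ∑ l
≥ nη, while ∑(1 + l) ≤ (C + 1)n is where the bound on the number of strata enters. -/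
theorem meanVar_lower (ν : Measure ι) [IsProbabilityMeasure ν] (p r : ι → unitInterval)
    (hn : 2 ≤ n) {c η C : ℝ} (hc : 0 ≤ c) (hη : 0 < η) (hC : (Fintype.card ι : ℝ) ≤ C * n)
    (hG : η ≤ ν.real {t | c ≤ bvarProd p r t}) :
    c * η ^ 2 / (4 * (C + 1)) * n ≤ meanVar p r ν n := by
  classical
  set G : Finset ι := Finset.univ.filter fun t => c ≤ bvarProd p r t with hGdef
  have hn0 : (0 : ℝ) < n := by exact_mod_cast (by omega : 0 < n)
  set l : ι → ℝ := fun t => n * ν.real {t} with hl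
  have hl0 : ∀ t, 0 ≤ l t := fun t => mul_nonneg hn0.le measureReal_nonneg
  have hexc : ∀ t, l t ^ 2 / (4 * (1 + l t)) ≤ n * ν.real {t} - 1 + (1 - ν.real {t}) ^ n :=
    fun t => binomial_excess_lower' measureReal_nonneg measureReal_le_one hn
  have hexc0 : ∀ t, 0 ≤ n * ν.real {t} - 1 + (1 - ν.real {t}) ^ n := fun t =>
    le_trans (by have := hl0 t; positivity) (hexc t)
  have hνG : ν.real {t | c ≤ bvarProd p r t} = ∑ t ∈ G, ν.real {t} := by
    rw [sum_measureReal_singleton]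
    congr 1
    ext t
    simp [hGdef]
  have hsumG : ∑ t ∈ G, l t = n * ν.real {t | c ≤ bvarProd p r t} := by
    rw [hνG, Finset.mul_sum]
  have hsum1 : ∑ t ∈ G, (1 + l t) ≤ (C + 1) * n := by
    rw [Finset.sum_add_distrib, hsumG, Finset.sum_const, nsmul_eq_mul, mul_one]
    have h1 : (G.card : ℝ) ≤ Fintype.card ι := by exact_mod_cast Finset.card_le_univ G
    have h2 : (n : ℝ) * ν.real {t | c ≤ bvarProd p r t} ≤ n * 1 :=
      mul_le_mul_of_nonneg_left measureReal_le_one hn0.le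
    linarith
  have hC1 : 0 < C + 1 := by
    have h0 : (0 : ℝ) ≤ C * n := (Nat.cast_nonneg _).trans hC
    have := nonneg_of_mul_nonneg_left h0 hn0
    linarith
  have hsed := Finset.sq_sum_div_le_sum_sq_div G l (g := fun t => 1 + l t)
    fun t _ => by have := hl0 t; linarith
  have hlow : η ^ 2 * n / (C + 1) ≤ ∑ t ∈ G, l t ^ 2 / (1 + l t) := by
    refine le_trans ?_ hsed
    rw [hsumG]
    have hGne : 0 < ∑ t ∈ G, (1 + l t) := by
      refine lt_of_lt_of_le ?_ (Finset.sum_le_sum fun t _ => le_add_of_nonneg_left zero_le_one)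
      rw [hsumG]
      exact mul_pos hn0 (hη.trans_le hG)
    calc η ^ 2 * n / (C + 1) = (n * η) ^ 2 / ((C + 1) * n) := by field_simp
      _ ≤ (n * ν.real {t | c ≤ bvarProd p r t}) ^ 2 / ∑ t ∈ G, (1 + l t) := by gcongr
  calc c * η ^ 2 / (4 * (C + 1)) * n = c / 4 * (η ^ 2 * n / (C + 1)) := by field_simp
    _ ≤ c / 4 * ∑ t ∈ G, l t ^ 2 / (1 + l t) := by gcongr
    _ = ∑ t ∈ G, c * (l t ^ 2 / (4 * (1 + l t))) := by
        rw [Finset.mul_sum]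
        refine Finset.sum_congr rfl fun t _ => ?_
        have : 0 < 1 + l t := by have := hl0 t; linarith
        field_simp
    _ ≤ ∑ t ∈ G, bvarProd p r t * (n * ν.real {t} - 1 + (1 - ν.real {t}) ^ n) := by
        refine Finset.sum_le_sum fun t ht => ?_
        exact mul_le_mul (Finset.mem_filter.1 ht).2 (hexc t)
          (by have := hl0 t; positivity) (bvarProd_nonneg p r t)
    _ ≤ ∑ t, bvarProd p r t * (n * ν.real {t} - 1 + (1 - ν.real {t}) ^ n) :=
        Finset.sum_le_sum_of_subset_of_nonneg (Finset.subset_univ G) fun t _ _ =>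
          mul_nonneg (bvarProd_nonneg p r t) (hexc0 t)
    _ = meanVar p r ν n := (meanVar_eq_sum ν p r).symm

end Growth

/-! ### Strata with nondegenerate margins -/

theorem SqrtSmooth.lower {α : Type*} [MeasurableSpace α] {A : Set α} {K e : ℝ} {f : α → ℝ}
    (hf : SqrtSmooth A K f) (he : 0 ≤ e) (hK : K ≤ e / 4) {z₀ z : α} (hz₀ : z₀ ∈ A) (hz : z ∈ A)
    (h : e ≤ f z₀) : e / 4 ≤ f z := by
  have h1 := hf.sqrt_sub z hz z₀ hz₀
  have h2 : √e ≤ √(f z₀) := Real.sqrt_le_sqrt h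
  have h3 := Real.sq_sqrt he
  have h4 := Real.sq_sqrt (hf.mem z).1
  by_contra hlt
  have h5 : √(f z) < √e / 2 := by
    refine lt_of_pow_lt_pow_left₀ 2 (by positivity) ?_
    rw [h4, div_pow, h3]
    linarith
  have h6 : (√e / 2) ^ 2 < (√(f z) - √(f z₀)) ^ 2 := by
    rw [← neg_sub (√(f z₀)) (√(f z)), neg_sq]
    exact pow_lt_pow_left₀ (by linarith) (by positivity) two_ne_zero
  rw [div_pow, h3] at h6
  linarith

/-- One nondegenerate point controls the whole stratum: the square roots of f and 1 - f are at least
√e there and vary by at most √e/2, so f and 1 - f stay above e/4. -/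
theorem SqrtSmooth.bvar_lower {α : Type*} [MeasurableSpace α] {m : Measure α}
    [IsProbabilityMeasure m] {A : Set α} {K e : ℝ} {f : α → ℝ} (hf : SqrtSmooth A K f)
    (hA : m Aᶜ = 0) (he : 0 ≤ e) (hK : K ≤ e / 4) {z₀ : α} (hz₀ : z₀ ∈ A) (h : e ≤ f z₀)
    (h' : e ≤ 1 - f z₀) {p : unitInterval} (hp : (p : ℝ) = ∫ z, f z ∂m) :
    (e / 4) ^ 2 ≤ bvar p := by
  have hAe : ∀ᵐ z ∂m, z ∈ A := by
    rw [ae_iff]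
    exact hA
  have h1 : e / 4 ≤ ∫ z, f z ∂m := by
    have := integral_mono_ae (μ := m) (integrable_const (e / 4)) hf.integrable
      (by filter_upwards [hAe] with z hz using hf.lower he hK hz₀ hz h)
    simpa using this
  have h2 : e / 4 ≤ 1 - ∫ z, f z ∂m := by
    have := integral_mono_ae (μ := m) (integrable_const (e / 4)) hf.compl.integrable
      (by filter_upwards [hAe] with z hz using hf.compl.lower he hK hz₀ hz h')
    rw [integral_sub (integrable_const _) hf.integrable] at this
    simpa using this
  rw [bvar, hp, sq]
  exact mul_le_mul h1 h2 (by positivity) (le_trans (by positivity) h1)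

section Nondegenerate

variable {d : ℕ} {P : Measure (Obs d)} {𝒵 : Set (EuclideanSpace ℝ (Fin d))}
  [IsProbabilityMeasure P] {κX κY : Kernel (EuclideanSpace ℝ (Fin d)) (Fin 2)} [IsMarkovKernel κX]
  [IsMarkovKernel κY] (hκX : ∀ᵐ z ∂(P.map obsZ), κX z = condDistrib obsX obsZ P z)
  (hκY : ∀ᵐ z ∂(P.map obsZ), κY z = condDistrib obsY obsZ P z)

/-- The points at which all conditional marginal probabilities are at least `e`. -/
def nondegenerateSet (κX κY : Kernel (EuclideanSpace ℝ (Fin d)) (Fin 2)) (e : ℝ) :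
    Set (EuclideanSpace ℝ (Fin d)) :=
  {z | (e ≤ (κX z).real {0} ∧ e ≤ 1 - (κX z).real {0})
    ∧ (e ≤ (κY z).real {0} ∧ e ≤ 1 - (κY z).real {0})}

include hκX hκY in
-- Under conditional independence, four positive cells mean that both margins are nondegenerate.
-- Such points are covered by the countably many sets at levels 1/(k + 1), so one of these has
-- positive mass.
theorem exists_nondegenerateSet_pos (hNull : CondIndependent P)
    (hpos : ∃ᵐ z ∂(P.map obsZ), ∀ x y : Fin 2,
      condDistrib (fun w => (obsX w, obsY w)) obsZ P z {(x, y)} ≠ 0) :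
    ∃ e : ℝ, 0 < e ∧ 0 < P.real {w | obsZ w ∈ nondegenerateSet κX κY e} := by
  have hfreq : ∃ᵐ z ∂(P.map obsZ), ∃ k : ℕ, z ∈ nondegenerateSet κX κY (1 / (k + 1)) := by
    refine (hpos.and_eventually (hNull.and (hκX.and hκY))).mono ?_
    rintro z ⟨hz, hprod, hzX, hzY⟩
    rw [hprod, ← hzX, ← hzY] at hz
    have hne : ∀ x y, κX z {x} ≠ 0 ∧ κY z {y} ≠ 0 := by
      intro x y
      have h := hz x y
      rw [← Set.singleton_prod_singleton, Measure.prod_prod] at h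
      exact ⟨left_ne_zero_of_mul h, right_ne_zero_of_mul h⟩
    have hr : ∀ (m : Measure (Fin 2)) [IsProbabilityMeasure m] (a : Fin 2), m {a} ≠ 0 →
        0 < m.real {a} := fun m _ a h => ENNReal.toReal_pos h (measure_ne_top _ _)
    have p1 := hr (κX z) 0 (hne 0 0).1
    have p2 := hr (κX z) 1 (hne 1 0).1
    have p3 := hr (κY z) 0 (hne 0 0).2
    have p4 := hr (κY z) 1 (hne 0 1).2
    rw [measureReal_one_eq] at p2 p4
    obtain ⟨k, hk⟩ := exists_nat_one_div_lt (lt_min (lt_min p1 p2) (lt_min p3 p4))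
    rw [lt_min_iff, lt_min_iff, lt_min_iff] at hk
    exact ⟨k, ⟨hk.1.1.le, hk.1.2.le⟩, ⟨hk.2.1.le, hk.2.2.le⟩⟩
  by_contra hcon
  push Not at hcon
  refine hfreq ?_
  have hall : ∀ k : ℕ, ∀ᵐ z ∂(P.map obsZ), z ∉ nondegenerateSet κX κY (1 / (k + 1)) := by
    intro k
    have h0 : P.real {w | obsZ w ∈ nondegenerateSet κX κY (1 / (k + 1))} = 0 :=
      le_antisymm (hcon _ (by positivity)) measureReal_nonneg
    have hmX : Measurable fun z => (κX z).real {0} :=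
      (Kernel.measurable_coe κX (measurableSet_singleton 0)).ennreal_toReal
    have hmY : Measurable fun z => (κY z).real {0} :=
      (Kernel.measurable_coe κY (measurableSet_singleton 0)).ennreal_toReal
    have hm : MeasurableSet (nondegenerateSet κX κY (1 / (k + 1))) :=
      ((measurableSet_le measurable_const hmX).inter
        (measurableSet_le measurable_const (hmX.const_sub 1))).inter
        ((measurableSet_le measurable_const hmY).inter
        (measurableSet_le measurable_const (hmY.const_sub 1)))
    rw [measureReal_eq_zero_iff] at h0
    rw [ae_iff]
    simp only [not_not]
    exact (Measure.map_apply measurable_obsZ hm).trans h0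
  filter_upwards [ae_all_iff.2 hall] with z hz
  exact fun ⟨k, hk⟩ => hz k hk

include hκX hκY in
-- Almost every observation falls in a stratum of positive probability, as there are countably many
-- strata. If its Z-value is nondegenerate, both margins of that stratum have variance at least
-- (e/4)².
theorem measureReal_bvarProd_ge (hZ : ∀ᵐ w ∂P, obsZ w ∈ 𝒵) {ι : Type} [Nonempty ι] [Countable ι]
    [MeasurableSpace ι] [MeasurableSingletonClass ι] (S : Stratification 𝒵 ι) {L h e : ℝ}
    (hL : 0 ≤ L) (he : 0 < e) (hK : 2 * (L * h) ^ 2 ≤ e / 4)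
    (hX : ∀ z ∈ 𝒵, ∀ z' ∈ 𝒵, hellingerDist (κX z) (κX z') ≤ L * dist z z')
    (hY : ∀ z ∈ 𝒵, ∀ z' ∈ 𝒵, hellingerDist (κY z) (κY z') ≤ L * dist z z')
    (hh : ∀ t, ∀ z ∈ S.stratum t, ∀ z' ∈ S.stratum t, dist z z' ≤ h) :
    P.real {w | obsZ w ∈ nondegenerateSet κX κY e}
      ≤ (P.map fun v => S.index (obsZ v)).real {t | (e / 4) ^ 4
        ≤ bvarProd (zeroProb P (fun v => S.index (obsZ v)) obsX)
          (zeroProb P (fun v => S.index (obsZ v)) obsY) t} := by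
  have hTm : Measurable fun v : Obs d => S.index (obsZ v) := S.measurable_index.comp measurable_obsZ
  have hprobZ : IsProbabilityMeasure (P.map (obsZ (d := d))) :=
    Measure.isProbabilityMeasure_map measurable_obsZ.aemeasurable
  rw [map_measureReal_apply hTm (Set.to_countable _).measurableSet]
  have hpos : ∀ᵐ w ∂P, P {v | S.index (obsZ v) = S.index (obsZ w)} ≠ 0 := by
    have h1 : {w : Obs d | ¬ P {v | S.index (obsZ v) = S.index (obsZ w)} ≠ 0}
        ⊆ ⋃ t ∈ {t | P {v | S.index (obsZ v) = t} = 0}, {v | S.index (obsZ v) = t} := by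
      intro w hw
      have hw : ¬ P {v | S.index (obsZ v) = S.index (obsZ w)} ≠ 0 := hw
      exact Set.mem_biUnion (x := S.index (obsZ w)) (not_not.1 hw) rfl
    rw [ae_iff]
    exact measure_mono_null h1 ((measure_biUnion_null_iff (Set.to_countable _)).2 fun t ht => ht)
  refine ENNReal.toReal_mono (measure_ne_top _ _) (measure_mono_ae ?_)
  filter_upwards [hZ, hpos] with w hw hwpos hwE
  have hwE : obsZ w ∈ nondegenerateSet κX κY e := hwE
  show (e / 4) ^ 4 ≤ bvarProd (zeroProb P (fun v => S.index (obsZ v)) obsX)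
    (zeroProb P (fun v => S.index (obsZ v)) obsY) (S.index (obsZ w))
  set t := S.index (obsZ w) with ht
  have hwt : obsZ w ∈ S.stratum t := (S.index_eq_iff hw).1 rfl
  have hm := S.measurableSet_stratum t
  have hsub : S.stratum t ⊆ 𝒵 := (Set.subset_iUnion _ t).trans S.iUnion_stratum.subset
  have hne : (P.map obsZ) (S.stratum t) ≠ 0 := by
    rw [Measure.map_apply measurable_obsZ hm]
    intro h0
    refine hwpos ?_
    rw [← measureReal_eq_zero_iff]
    have h3 : P.real {w | S.index (obsZ w) = t} = P.real {w | obsZ w ∈ S.stratum t} := by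
      simpa using measureReal_index hZ S t fun _ => True
    rw [h3, measureReal_eq_zero_iff]
    exact h0
  have hmprob : IsProbabilityMeasure (ProbabilityTheory.cond (P.map obsZ) (S.stratum t)) :=
    cond_isProbabilityMeasure hne
  have hmA : (ProbabilityTheory.cond (P.map obsZ) (S.stratum t)) (S.stratum t)ᶜ = 0 := by
    rw [cond_apply hm, Set.inter_compl_self, measure_empty, mul_zero]
  have sX := sqrtSmooth_kernel (κ := κX) (A := S.stratum t) hL
    (fun z hz z' hz' => hX z (hsub hz) z' (hsub hz')) (hh t)
  have sY := sqrtSmooth_kernel (κ := κY) (A := S.stratum t) hL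
    (fun z hz z' hz' => hY z (hsub hz) z' (hsub hz')) (hh t)
  have bX := sX.bvar_lower hmA he.le hK hwt hwE.1.1 hwE.1.2
    (zeroProb_eq hZ S measurable_obsX hκX t)
  have bY := sY.bvar_lower hmA he.le hK hwt hwE.2.1 hwE.2.2
    (zeroProb_eq hZ S measurable_obsY hκY t)
  calc (e / 4) ^ 4 = (e / 4) ^ 2 * (e / 4) ^ 2 := by ring
    _ ≤ _ := mul_le_mul bX bY (by positivity) (bvar_nonneg _)

end Nondegenerate

end CMH

namespace CMH

/-! ### Comparison with the model law -/

section Compare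

variable {n : ℕ} {ι : Type*} [Countable ι] [MeasurableSpace ι] [MeasurableSingletonClass ι]
  {Ω : Type*} [MeasurableSpace Ω] (P : Measure Ω) [IsProbabilityMeasure P]
  {T : Ω → ι} {X Y : Ω → Fin 2} (hT : Measurable T) (hX : Measurable X) (hY : Measurable Y)
  {p r : ι → unitInterval} {δ : ι → ℝ}
  (hJ0 : ∀ t a b, 0 ≤ cellWeight (p t) (r t) (δ t) a b)
  (hJ : ∀ t a b, P {w | T w = t ∧ X w = a ∧ Y w = b}
    = P.map T {t} * ENNReal.ofReal (cellWeight (p t) (r t) (δ t) a b))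
  {ε : ℝ} (hε : 0 ≤ ε) (hδ : ∀ t, δ t ^ 2 ≤ ε * bvarProd p r t)

include hT hX hY hJ0 hJ hε hδ

/-- The one-sided comparison is applied to G and to -G. The parameter θ stays free, since it serves
as the error level while the divergence tends to zero. -/
theorem abs_integral_toSample_sub_le {θ : ℝ} (hθ : 0 < θ) {G : Sample n ι → ℝ}
    (hG : ∀ ω, G ω ∈ Set.Icc (0 : ℝ) 1) :
    |∫ w, G (toSample T X Y w) ∂(Measure.pi fun _ : Fin n => P)
        - ∫ ω, G ω ∂(modelLaw (P.map T) p r n)|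
      ≤ θ / 2 + ((1 + ε) ^ n - 1) / (2 * θ) := by
  have hprobT : IsProbabilityMeasure (P.map T) := Measure.isProbabilityMeasure_map hT.aemeasurable
  have hb : IsBdd G := ⟨1, fun ω => by rw [abs_of_nonneg (hG ω).1]; exact (hG ω).2⟩
  have hsq : ∫ ω, G ω ^ 2 ∂(modelLaw (P.map T) p r n) ≤ 1 := by
    have h := integral_mono (μ := modelLaw (P.map T) p r n) (hb.sq.integrable _)
      (integrable_const (1 : ℝ)) fun ω => pow_le_one₀ (hG ω).1 (hG ω).2
    simpa using h
  have hθsq := mul_le_mul_of_nonneg_left hsq (half_pos hθ).le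
  have h1 := integral_toSample_le P hT hX hY hJ0 hJ hε hδ hθ hb
  have h2 := integral_toSample_le P hT hX hY hJ0 hJ hε hδ hθ hb.neg
  simp only [neg_sq] at h2
  rw [integral_add (hb.integrable _) (((IsBdd.const _).mul hb.sq).integrable _),
    integral_const_mul] at h1
  rw [integral_add (hb.neg.integrable _) (((IsBdd.const _).mul hb.sq).integrable _),
    integral_const_mul, integral_neg, integral_neg] at h2
  rw [abs_le]
  constructor <;> linarith

/-- Change of measure with θ = 1: under the model the mean of `sumVar` is B and its second moment at
most B² + 5B. A diverging mean under the true law therefore forces B → ∞. -/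
theorem integral_sumVar_toSample_le (h1 : (1 + ε) ^ n ≤ 2) :
    ∫ w, sumVar (toSample T X Y w).1 (toSample T X Y w).2.1 (toSample T X Y w).2.2
        ∂(Measure.pi fun _ : Fin n => P) ≤ 4 * (meanVar p r (P.map T) n + 1) ^ 2 := by
  have hprobT : IsProbabilityMeasure (P.map T) := Measure.isProbabilityMeasure_map hT.aemeasurable
  have hb := isBdd_sumVar (n := n) (ι := ι)
  have h := integral_toSample_le P hT hX hY hJ0 hJ hε hδ one_pos hb
  have hB := integral_modelLaw_sumVar (n := n) (P.map T) p r
  have hV := integral_modelLaw_sumVar_sub_sq_le (n := n) (P.map T) p r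
  have hB0 := meanVar_nonneg (n := n) p r (P.map T)
  set B := meanVar p r (P.map T) n
  have hsq : ∫ ω, (sumVar ω.1 ω.2.1 ω.2.2 - B) ^ 2 ∂(modelLaw (P.map T) p r n)
      = ∫ ω, sumVar ω.1 ω.2.1 ω.2.2 ^ 2 ∂(modelLaw (P.map T) p r n) - B ^ 2 := by
    have he : ∀ ω : Sample n ι, (sumVar ω.1 ω.2.1 ω.2.2 - B) ^ 2
        = sumVar ω.1 ω.2.1 ω.2.2 ^ 2 - (2 * B * sumVar ω.1 ω.2.1 ω.2.2 - B ^ 2) := fun ω => by ring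
    simp_rw [he]
    rw [integral_sub (hb.sq.integrable _)
      ((((IsBdd.const _).mul hb).sub (IsBdd.const _)).integrable _),
      integral_sub (((IsBdd.const _).mul hb).integrable _) (integrable_const _),
      integral_const_mul, hB]
    simp
    ring
  rw [integral_add (hb.integrable _) (((IsBdd.const _).mul hb.sq).integrable _),
    integral_const_mul, hB] at h
  nlinarith

end Compare

theorem sampleTest_mem {n : ℕ} {κ : Type*} (α : ℝ) (r : κ → unitInterval) (ω : Sample n κ) :
    sampleTest α r ω ∈ Set.Icc (0 : ℝ) 1 := by
  unfold sampleTest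
  split_ifs <;> simp

/-! ### The mesh -/

section Mesh

variable {d : ℕ} {𝒵 : Set (EuclideanSpace ℝ (Fin d))}

theorem Stratification.dist_le_mesh {ι : Type} (S : Stratification 𝒵 ι) (h : S.mesh ≠ ⊤) {t : ι}
    {z z' : EuclideanSpace ℝ (Fin d)} (hz : z ∈ S.stratum t) (hz' : z' ∈ S.stratum t) :
    dist z z' ≤ S.mesh.toReal := by
  rw [dist_edist]
  exact ENNReal.toReal_mono h ((Metric.edist_le_ediam_of_mem hz hz').trans
    (le_iSup (fun t => Metric.ediam (S.stratum t)) t))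

variable {ι : ℕ → Type} {S : ∀ n, Stratification 𝒵 (ι n)}
  (hmesh : Tendsto (fun n : ℕ => (n : ℝ≥0∞) ^ (1 / 4 : ℝ) * (S n).mesh) atTop (𝓝 0))

include hmesh

theorem eventually_mesh_ne_top : ∀ᶠ n in atTop, (S n).mesh ≠ ⊤ := by
  filter_upwards [hmesh.eventually_lt_const ENNReal.zero_lt_top, eventually_gt_atTop 0]
    with n hn hn0 htop
  rw [htop, ENNReal.mul_top] at hn
  · exact lt_irrefl _ hn
  · exact (ENNReal.rpow_pos (by exact_mod_cast hn0) (ENNReal.natCast_ne_top n)).ne'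

theorem tendsto_nat_mul_mesh_pow :
    Tendsto (fun n : ℕ => n * (S n).mesh.toReal ^ 4) atTop (𝓝 0) := by
  have h := ((ENNReal.tendsto_toReal ENNReal.zero_ne_top).comp hmesh).pow 4
  rw [ENNReal.toReal_zero, zero_pow four_ne_zero] at h
  refine h.congr fun n => ?_
  simp only [Function.comp_apply, ENNReal.toReal_mul, mul_pow]
  rw [← ENNReal.toReal_rpow, ENNReal.toReal_natCast, ← Real.rpow_natCast, ← Real.rpow_mul
    (Nat.cast_nonneg n)]
  norm_num

theorem tendsto_mesh : Tendsto (fun n : ℕ => (S n).mesh.toReal) atTop (𝓝 0) := by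
  have h4 : Tendsto (fun n : ℕ => (S n).mesh.toReal ^ 4) atTop (𝓝 0) := by
    refine squeeze_zero' (Eventually.of_forall fun n => by positivity) ?_
      (tendsto_nat_mul_mesh_pow hmesh)
    filter_upwards [eventually_ge_atTop 1] with n hn
    exact le_mul_of_one_le_left (by positivity) (by exact_mod_cast hn)
  have h2 := (Real.continuous_sqrt.tendsto 0).comp h4
  rw [Real.sqrt_zero] at h2
  have h := (Real.continuous_sqrt.tendsto 0).comp h2
  rw [Real.sqrt_zero] at h
  refine h.congr fun n => ?_
  simp only [Function.comp_apply]
  have h0 : 0 ≤ (S n).mesh.toReal := ENNReal.toReal_nonneg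
  rw [show (S n).mesh.toReal ^ 4 = ((S n).mesh.toReal ^ 2) ^ 2 by ring,
    Real.sqrt_sq (by positivity), Real.sqrt_sq h0]

/-- By 1 + x ≤ exp x, the power is squeezed between 1 and the exponential of a multiple of n h⁴ → 0.
-/
theorem tendsto_one_add_mesh_pow (L : ℝ) :
    Tendsto (fun n : ℕ => (1 + 256 * (L * (S n).mesh.toReal) ^ 4) ^ n) atTop (𝓝 1) := by
  have h1 : Tendsto (fun n : ℕ => Real.exp (256 * L ^ 4 * (n * (S n).mesh.toReal ^ 4))) atTop
      (𝓝 1) := by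
    have h := (Real.continuous_exp.tendsto (256 * L ^ 4 * 0)).comp
      ((tendsto_nat_mul_mesh_pow hmesh).const_mul (256 * L ^ 4))
    rw [mul_zero, Real.exp_zero] at h
    exact h
  refine tendsto_of_tendsto_of_tendsto_of_le_of_le tendsto_const_nhds h1 (fun n => ?_) fun n => ?_
  · exact one_le_pow₀ (le_add_of_nonneg_right (by positivity))
  · have h := pow_le_pow_left₀ (by positivity : 0 ≤ 1 + 256 * (L * (S n).mesh.toReal) ^ 4)
      (add_comm (1 : ℝ) _ ▸ Real.add_one_le_exp (256 * (L * (S n).mesh.toReal) ^ 4)) n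
    refine h.trans_eq ?_
    rw [← Real.exp_nat_mul]
    congr 1
    ring

end Mesh

end CMH

namespace CMH

/-! ### The conditional test on a large sample -/

section Limit

variable {d : ℕ} {P : Measure (Obs d)} [IsProbabilityMeasure P]
  {𝒵 : Set (EuclideanSpace ℝ (Fin d))} (hZ : ∀ᵐ w ∂P, obsZ w ∈ 𝒵)

include hZ in
theorem ae_iidLaw_mem (n : ℕ) : ∀ᵐ w ∂(iidLaw P n), ∀ i, obsZ (w i) ∈ 𝒵 :=
  ae_all_iff.2 fun i => (measurePreserving_eval (fun _ : Fin n => P) i).quasiMeasurePreserving.ae hZ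

variable {κX κY : Kernel (EuclideanSpace ℝ (Fin d)) (Fin 2)} [IsMarkovKernel κX] [IsMarkovKernel κY]
  (hκX : ∀ᵐ z ∂(P.map obsZ), κX z = condDistrib obsX obsZ P z)
  (hκY : ∀ᵐ z ∂(P.map obsZ), κY z = condDistrib obsY obsZ P z)
  (hNull : CondIndependent P) {L : ℝ} (hL : 0 ≤ L)
  (hX : ∀ z ∈ 𝒵, ∀ z' ∈ 𝒵, hellingerDist (κX z) (κX z') ≤ L * dist z z')
  (hY : ∀ z ∈ 𝒵, ∀ z' ∈ 𝒵, hellingerDist (κY z) (κY z') ≤ L * dist z z')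

/-- The mean variance of the model with the strata and the marginals of `P`. -/
noncomputable def stratifiedMeanVar {ι : Type} [Nonempty ι] [MeasurableSpace ι]
    (P : Measure (Obs d)) [IsProbabilityMeasure P] (S : Stratification 𝒵 ι) (n : ℕ) : ℝ :=
  meanVar (zeroProb P (fun v => S.index (obsZ v)) obsX)
    (zeroProb P (fun v => S.index (obsZ v)) obsY) (P.map fun v => S.index (obsZ v)) n

section Sample

variable {n : ℕ} {ι : Type} [Nonempty ι] [Countable ι] [MeasurableSpace ι]
  [MeasurableSingletonClass ι] (S : Stratification 𝒵 ι) (hS : S.mesh ≠ ⊤)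

include hZ hκX hκY hNull hL hX hY hS

theorem abs_integral_test_sub_le (α : ℝ) {θ : ℝ} (hθ : 0 < θ) :
    |∫ w, test α S w ∂(iidLaw P n)
        - ∫ ω, sampleTest α (zeroProb P (fun v => S.index (obsZ v)) obsY) ω
          ∂(modelLaw (P.map fun v => S.index (obsZ v))
            (zeroProb P (fun v => S.index (obsZ v)) obsX)
            (zeroProb P (fun v => S.index (obsZ v)) obsY) n)|
      ≤ θ / 2 + ((1 + 256 * (L * S.mesh.toReal) ^ 4) ^ n - 1) / (2 * θ) := by
  have hT : Measurable fun v : Obs d => S.index (obsZ v) :=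
    S.measurable_index.comp measurable_obsZ
  have h1 : ∫ w, test α S w ∂(iidLaw P n)
      = ∫ w, sampleTest α (zeroProb P (fun v => S.index (obsZ v)) obsY) (stratify S w)
          ∂(iidLaw P n) := by
    refine integral_congr_ae ?_
    filter_upwards [ae_iidLaw_mem hZ n] with w hw using test_eq_sampleTest hw α _
  rw [h1]
  exact abs_integral_toSample_sub_le P hT measurable_obsX measurable_obsY
    (cellWeight_zeroProb_nonneg P measurable_obsX measurable_obsY)
    (measure_cell P measurable_obsX measurable_obsY hT) (by positivity)
    (sq_zeroCov_le hZ S hκX hκY hNull hL hX hY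
      fun t z hz z' hz' => S.dist_le_mesh hS hz hz') hθ (sampleTest_mem α _)

theorem integral_totalVar_le (hn : (1 + 256 * (L * S.mesh.toReal) ^ 4) ^ n ≤ 2) :
    ∫ w, totalVar S w ∂(iidLaw P n) ≤ 4 * (stratifiedMeanVar P S n + 1) ^ 2 := by
  have hT : Measurable fun v : Obs d => S.index (obsZ v) :=
    S.measurable_index.comp measurable_obsZ
  have h1 : ∫ w, totalVar S w ∂(iidLaw P n) = ∫ w, sumVar (stratify S w).1 (stratify S w).2.1
      (stratify S w).2.2 ∂(iidLaw P n) := by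
    refine integral_congr_ae ?_
    filter_upwards [ae_iidLaw_mem hZ n] with w hw using totalVar_eq hw
  rw [h1]
  exact integral_sumVar_toSample_le P hT measurable_obsX measurable_obsY
    (cellWeight_zeroProb_nonneg P measurable_obsX measurable_obsY)
    (measure_cell P measurable_obsX measurable_obsY hT) (by positivity)
    (sq_zeroCov_le hZ S hκX hκY hNull hL hX hY
      fun t z hz z' hz' => S.dist_le_mesh hS hz hz') hn

end Sample

/-! ### Limits along the sequence of stratifications -/

variable {ι : ℕ → Type} [∀ n, Nonempty (ι n)] [∀ n, Countable (ι n)] [∀ n, MeasurableSpace (ι n)]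
  [∀ n, MeasurableSingletonClass (ι n)] {S : ∀ n, Stratification 𝒵 (ι n)}
  (hmesh : Tendsto (fun n : ℕ => (n : ℝ≥0∞) ^ (1 / 4 : ℝ) * (S n).mesh) atTop (𝓝 0))

include hZ hκX hκY hNull hL hX hY hmesh

theorem tendsto_stratifiedMeanVar_of_totalVar
    (h : Tendsto (fun n : ℕ => ∫ w, totalVar (S n) w ∂(iidLaw P n)) atTop atTop) :
    Tendsto (fun n => stratifiedMeanVar P (S n) n) atTop atTop := by
  rw [tendsto_atTop]
  intro b
  filter_upwards [h.eventually_gt_atTop (4 * (|b| + 1) ^ 2), eventually_mesh_ne_top hmesh,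
    (tendsto_one_add_mesh_pow hmesh L).eventually_le_const one_lt_two] with n h1 h2 h3
  have h4 := integral_totalVar_le hZ hκX hκY hNull hL hX hY (S n) h2 h3
  have hB : 0 ≤ stratifiedMeanVar P (S n) n := meanVar_nonneg _ _ _
  have h5 : (|b| + 1) ^ 2 < (stratifiedMeanVar P (S n) n + 1) ^ 2 := by linarith
  have h6 := lt_of_pow_lt_pow_left₀ 2 (by positivity) h5
  linarith [le_abs_self b]

theorem tendsto_stratifiedMeanVar_of_card {C : ℕ}
    (hC : ∀ᶠ n in atTop, ENat.card (ι n) ≤ ((C * n : ℕ) : ℕ∞))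
    (hpos : ∃ᵐ z ∂(P.map obsZ), ∀ x y : Fin 2,
      condDistrib (fun w => (obsX w, obsY w)) obsZ P z {(x, y)} ≠ 0) :
    Tendsto (fun n => stratifiedMeanVar P (S n) n) atTop atTop := by
  obtain ⟨e, he, hη⟩ := exists_nondegenerateSet_pos hκX hκY hNull hpos
  set η := P.real {w | obsZ w ∈ nondegenerateSet κX κY e}
  have hK : Tendsto (fun n => 2 * (L * (S n).mesh.toReal) ^ 2) atTop (𝓝 0) := by
    have h := (((tendsto_mesh hmesh).const_mul L).pow 2).const_mul 2
    simpa using h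
  have hlin : Tendsto (fun n : ℕ => (e / 4) ^ 4 * η ^ 2 / (4 * ((C : ℝ) + 1)) * n) atTop atTop :=
    tendsto_natCast_atTop_atTop.const_mul_atTop (by positivity)
  refine tendsto_atTop_mono' _ ?_ hlin
  filter_upwards [hC, hK.eventually_le_const (by positivity : 0 < e / 4),
    eventually_mesh_ne_top hmesh, eventually_ge_atTop 2] with n h1 h2 h3 h4
  have hfin : Finite (ι n) :=
    ENat.card_lt_top.1 (h1.trans_lt (ENat.natCast_lt_top _))
  have := Fintype.ofFinite (ι n)
  have hcard : (Fintype.card (ι n) : ℝ) ≤ (C : ℝ) * n := by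
    rw [ENat.card_eq_coe_fintype_card] at h1
    exact_mod_cast h1
  have hprob : IsProbabilityMeasure (P.map fun v : Obs d => (S n).index (obsZ v)) :=
    Measure.isProbabilityMeasure_map
      ((S n).measurable_index.comp measurable_obsZ).aemeasurable
  exact meanVar_lower _ _ _ h4 (by positivity) hη hcard
    (measureReal_bvarProd_ge hκX hκY hZ (S n) hL he h2 hX hY
      fun t z hz z' hz' => (S n).dist_le_mesh h3 hz hz')

theorem tendsto_integral_test
    (hB : Tendsto (fun n => stratifiedMeanVar P (S n) n) atTop atTop) {α : ℝ}
    (hα : α ∈ Set.Icc (0 : ℝ) 1) :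
    Tendsto (fun n : ℕ => ∫ w, test α (S n) w ∂(iidLaw P n)) atTop (𝓝 α) := by
  have hprob : ∀ n, IsProbabilityMeasure (P.map fun v : Obs d => (S n).index (obsZ v)) := fun n =>
    Measure.isProbabilityMeasure_map
      ((S n).measurable_index.comp measurable_obsZ).aemeasurable
  have h1 := tendsto_integral_sampleTest (fun n => P.map fun v : Obs d => (S n).index (obsZ v))
    (fun n => zeroProb P (fun v => (S n).index (obsZ v)) obsX)
    (fun n => zeroProb P (fun v => (S n).index (obsZ v)) obsY) hB hα
  set M := fun n : ℕ => ∫ ω, sampleTest α (zeroProb P (fun v => (S n).index (obsZ v)) obsY) ω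
    ∂(modelLaw (P.map fun v => (S n).index (obsZ v))
      (zeroProb P (fun v => (S n).index (obsZ v)) obsX)
      (zeroProb P (fun v => (S n).index (obsZ v)) obsY) n)
  have hdiff : Tendsto (fun n => ∫ w, test α (S n) w ∂(iidLaw P n) - M n) atTop (𝓝 0) := by
    rw [Metric.tendsto_nhds]
    intro θ hθ
    -- With the target error θ itself as the parameter, the comparison bound tends to θ/2 < θ.
    have hr : Tendsto (fun n : ℕ => θ / 2
        + ((1 + 256 * (L * (S n).mesh.toReal) ^ 4) ^ n - 1) / (2 * θ)) atTop (𝓝 (θ / 2)) := by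
      have h := (((tendsto_one_add_mesh_pow hmesh L).sub_const 1).div_const (2 * θ)).const_add
        (θ / 2)
      simpa using h
    filter_upwards [hr.eventually_lt_const (half_lt_self hθ), eventually_mesh_ne_top hmesh]
      with n h2 h3
    rw [Real.dist_eq, sub_zero]
    exact (abs_integral_test_sub_le hZ hκX hκY hNull hL hX hY (S n) h3 α hθ).trans_lt h2
  simpa using hdiff.add h1

end Limit

end CMH

theorem mainTheorem1 {d : ℕ}
    (P : MeasureTheory.Measure (CMH.Obs d)) [MeasureTheory.IsProbabilityMeasure P]
    (𝒵 : Set (EuclideanSpace ℝ (Fin d))) (hZ_meas : MeasurableSet 𝒵)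
    (hZ : ∀ᵐ w ∂P, CMH.obsZ w ∈ 𝒵)
    (hNull : CMH.CondIndependent P)
    (hSmooth : CMH.MarginallySmooth P 𝒵)
    (ι : ℕ → Type) [∀ n, Countable (ι n)]
    (S : ∀ n, CMH.Stratification 𝒵 (ι n))
    (hmesh : Tendsto (fun n : ℕ => (n : ℝ≥0∞) ^ (1 / 4 : ℝ) * (S n).mesh) atTop (𝓝 0))
    (hinfo :
      -- either `T = O(n)` and all four cells have positive conditional probability given `Z`,
      -- with positive probability
      ((∃ C : ℕ, ∀ᶠ n in atTop, ENat.card (ι n) ≤ ((C * n : ℕ) : ℕ∞)) ∧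
        ∃ᵐ z ∂(P.map CMH.obsZ), ∀ x y : Fin 2,
          condDistrib (fun w => (CMH.obsX w, CMH.obsY w)) CMH.obsZ P z {(x, y)} ≠ 0) ∨
      -- or the expected value of `∑_t σ_t²` diverges
      Tendsto (fun n : ℕ => ∫ w, CMH.totalVar (S n) w ∂(CMH.iidLaw P n)) atTop atTop)
    (α : ℝ) (hα : α ∈ Set.Icc (0 : ℝ) 1) :
    Tendsto (fun n : ℕ => ∫ w, CMH.test α (S n) w ∂(CMH.iidLaw P n)) atTop (𝓝 α) := by
  obtain ⟨κX, κY, hMX, hMY, hκX, hκY, L, hL, hmax⟩ := hSmooth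
  have hX := fun z hz z' hz' => (le_max_left _ _).trans (hmax z hz z' hz')
  have hY := fun z hz z' hz' => (le_max_right _ _).trans (hmax z hz z' hz')
  -- Since 𝒵 contains a point, each partition has an index; `Stratification.index` needs one as its
  -- value outside 𝒵.
  obtain ⟨w, hw⟩ := hZ.exists
  have hne : ∀ n, Nonempty (ι n) := fun n => by
    rw [← (S n).iUnion_stratum, Set.mem_iUnion] at hw
    exact hw.nonempty
  -- With the discrete σ-algebra on countable index types, every function of the strata is
  -- measurable.
  let _ : ∀ n, MeasurableSpace (ι n) := fun _ => ⊤
  have hsing : ∀ n, MeasurableSingletonClass (ι n) := fun _ => ⟨fun _ => trivial⟩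
  refine CMH.tendsto_integral_test hZ hκX hκY hNull hL hX hY hmesh ?_ hα
  rcases hinfo with ⟨⟨C, hC⟩, hpos⟩ | hinfo
  · exact CMH.tendsto_stratifiedMeanVar_of_card hZ hκX hκY hNull hL hX hY hmesh hC hpos
  · exact CMH.tendsto_stratifiedMeanVar_of_totalVar hZ hκX hκY hNull hL hX hY hmesh hinfo
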